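/- **Setting.** Let $R^*=\begin{pmatrix}-\frac12&-\frac{\sqrt3}2\\ \frac{\sqrt3}2&-\frac12\end{pmatrix}$, let ${\bf u}_1\in\mathbb R^2\setminus\{0\}$, ${\bf u}_2=-R^*{\bf u}_1$, ${\bf U}=\mathbb Z{\bf u}_1\oplus\mathbb Z{\bf u}_2$, $\Omega=\{c_1{\bf u}_1+c_2{\bf u}_2: c_1,c_2\in(-\frac12,\frac12)\}$, ${\bf k}_1,{\bf k}_2$ the dual basis (${\bf k}_l\cdot{\bf u}_j=2\pi\delta_{lj}$), ${\bf v}_1=\frac13(2{\bf u}_1-{\bf u}_2)$, ${\bf v}_2=\frac13({\bf u}_1+{\bf u}_2)$, and ${\bf q}_1,{\bf q}_2$ the basis dual to ${\bf v}_1,{\bf v}_2$ (${\bf q}_l\cdot{\bf v}_j=2\pi\delta_{lj}$). Write $\langle f,g\rangle=\int_\Omega\overline f g$. Let $V\in C^\infty(\mathbb R^2;\mathbb R)$ be a super honeycomb lattice potential: $V$ is periodic with periods ${\bf u}_1,{\bf u}_2,{\bf v}_1,{\bf v}_2$, $V(R^*{\bf x})=V({\bf x})=V(-{\bf x})$, and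 $\frac1{|\Omega|}\int_\Omega e^{-i{\bf q}_1\cdot{\bf y}}V({\bf y})\,d{\bf y}\ne0$. Put $\mathcal H_V=-\Delta+V$. For ${\bf k}\in\mathbb R^2$ let $L^2_{\bf k}(\mathbb R^2/{\bf U})$ be the space of $f\in L^2_{loc}(\mathbb R^2)$ with $f({\bf x}+{\bf u})=e^{i{\bf k}\cdot{\bf u}}f({\bf x})$ for ${\bf u}\in{\bf U}$, and let $E_1({\bf k})\le E_2({\bf k})\le\dots$ be the eigenvalues, with multiplicity, of $\mathcal H_V$ on it; $\chi=L^2_{\bf 0}(\mathbb R^2/{\bf U})$. With $\tau=e^{2\pi i/3}$, let $\chi_{\xi_1,\xi_2}$ be the set of $f\in\chi$ with $f({\bf x}+{\bf v}_1)=\xi_1f({\bf x})$ and $f(R^*{\bf x})=\xi_2f({\bf x})$. Assume that there are $n_*\ge1$, $E_D\in\mathbb R$ with $$E_{n_*}({\bf 0})<E_D=E_{n_*+1}({\bf 0})=\dots=E_{n_*+4}({\bf 0})<E_{n_*+5}({\bf 0}),$$ and a normalized $\phi_1\in\chi_{\tau,\tau}$ such that $\phi_1$, $\phi_2({\bf x})=\overline{\phi_1(-{\bf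 x})}\in\chi_{\tau,\bar\tau}$, $\phi_3({\bf x})=\phi_1(-{\bf x})\in\chi_{\bar\tau,\tau}$, $\phi_4=\overline{\phi_1}\in\chi_{\bar\tau,\bar\tau}$ span $\ker(\mathcal H_V-E_D)$ in $\chi$. Let ${\bm v}_\sharp=\langle\phi_1,\nabla\phi_2\rangle\in\mathbb C^2$ and $v_F=\sqrt2\,\|{\bm v}_\sharp\|$ (equivalently ${\bm v}_\sharp=\frac{v_F}2(1,i)^{T}e^{i\theta_\sharp}$ with $v_F\ge0$), and assume $v_F\neq0$. Let $$b({\bf k})=\big\langle\phi_1,\;2i{\bf k}\cdot\nabla(\mathcal H_V-E_D)^{-1}\mathcal Q_\perp\,2i{\bf k}\cdot\nabla\phi_2\big\rangle,$$ where $\mathcal Q_\perp$ is the orthogonal projection of $\chi$ onto $\ker(\mathcal H_V-E_D)^\perp$ and the inverse is taken there. Let $a_1,b_1$ be coprime integers and ${\bm l}_2=-b_1{\bf k}_1+a_1{\bf k}_2$. Assume that the phase of $\phi_1$ is such that $$-2i\,{\bf r}\cdot{\bm v}_\sharp=\frac{v_F}{\|{\bm l}_2\|}\big({\bf r}\cdot{\bm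 l}_2-i\det[{\bf r},{\bm l}_2]\big)\qquad\text{for all }{\bf r}\in\mathbb R^2,$$ and that $b({\bm l}_2)\neq0$. **Proposition (near-energy approximation along ${\bm l}_2$).** There is $\lambda_0>0$ such that the following holds. 1. There are real-analytic functions $\theta_1,\dots,\theta_4:(-\lambda_0,\lambda_0)\to\mathbb R$ such that for every $|\lambda|<\lambda_0$ the numbers $E_{n_*+1}(\lambda{\bm l}_2),\dots,E_{n_*+4}(\lambda{\bm l}_2)$ are, up to order and with multiplicity, $\theta_1(\lambda),\dots,\theta_4(\lambda)$; moreover, for $|\lambda|<\lambda_0$, $$\theta_j(\lambda)=E_D-v_F\|{\bm l}_2\|\lambda+r_j(\lambda)\lambda^2\ (j=1,2),\qquad \theta_j(\lambda)=E_D+v_F\|{\bm l}_2\|\lambda+r_j(\lambda)\lambda^2\ (j=3,4),$$ with $|r_j(\lambda)|<C$ for a constant $C>0$ independent of $\lambda$. 2. For $|\lambda|<\lambda_0$ there are $\Theta_j(\cdot;\lambda)\in\ker(\mathcal H_V-\theta_j(\lambda))$ in $L^2_{\lambda{\bm l}_2}(\mathbb R^2/{\bf U})$, $j=1,2,3,4$,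 orthonormal for $\langle\cdot,\cdot\rangle$, depending real-analytically on $\lambda$ as elements of $H^2(\Omega)$, with $$\begin{aligned}\Theta_1&=\tfrac1{\sqrt2}e^{i\lambda{\bm l}_2\cdot{\bf x}}(\phi_1-\phi_2)+R_1,&\Theta_2&=\tfrac1{\sqrt2}e^{i\lambda{\bm l}_2\cdot{\bf x}}(\phi_3+\phi_4)+R_2,\\ \Theta_3&=\tfrac1{\sqrt2}e^{i\lambda{\bm l}_2\cdot{\bf x}}(\phi_3-\phi_4)+R_3,&\Theta_4&=\tfrac1{\sqrt2}e^{i\lambda{\bm l}_2\cdot{\bf x}}(\phi_1+\phi_2)+R_4,\end{aligned}$$ and $\|R_j(\cdot;\lambda)\|_{H^2(\Omega)}\le C'|\lambda|$ for a constant $C'$ independent of $\lambda$. -/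

import Mathlib

open MeasureTheory Set ComplexConjugate
open scoped ContDiff ENNReal

noncomputable section

namespace SuperHoneycomb

/-! ## The plane, the lattice and its dual -/

/-- The plane `ℝ²` with the Euclidean norm. -/
abbrev Plane : Type := EuclideanSpace ℝ (Fin 2)

/-- The coordinate vectors of the plane. -/
def basisVec (i : Fin 2) : Plane := EuclideanSpace.single i 1

/-- The determinant of the matrix with columns `a`, `b`. -/
def det2 (a b : Plane) : ℝ := a 0 * b 1 - a 1 * b 0

/-- The rotation `R*` with matrix `((-1/2, -√3/2), (√3/2, -1/2))`. -/
def rot (x : Plane) : Plane :=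
  !₂[-(1 / 2) * x 0 - Real.sqrt 3 / 2 * x 1, Real.sqrt 3 / 2 * x 0 - 1 / 2 * x 1]

/-- First vector of the basis dual to `(a, b)`: its inner products with `a`, `b` are `2π`, `0`. -/
def dualFst (a b : Plane) : Plane := (2 * Real.pi / det2 a b) • !₂[b 1, -b 0]

/-- Second vector of the basis dual to `(a, b)`: its inner products with `a`, `b` are `0`, `2π`. -/
def dualSnd (a b : Plane) : Plane := (2 * Real.pi / det2 a b) • !₂[-a 1, a 0]

theorem dual_inner {a b : Plane} (h : det2 a b ≠ 0) :
    inner ℝ (dualFst a b) a = 2 * Real.pi ∧ inner ℝ (dualFst a b) b = 0 ∧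
      inner ℝ (dualSnd a b) a = 0 ∧ inner ℝ (dualSnd a b) b = 2 * Real.pi := by
  simp only [dualFst, dualSnd, PiLp.inner_apply, Fin.sum_univ_two, PiLp.smul_apply,
    smul_eq_mul, RCLike.inner_apply, conj_trivial, Matrix.cons_val_zero, Matrix.cons_val_one]
  refine ⟨?_, ?_, ?_, ?_⟩
  · field_simp; simp only [det2]; ring
  · field_simp; ring
  · field_simp; ring
  · field_simp; simp only [det2]; ring

/-- The fundamental cell `Ω` of the lattice `ℤ u₁ ⊕ ℤ u₂`. -/
def cell (u₁ u₂ : Plane) : Set Plane :=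
  {x | ∃ c₁ ∈ Ioo (-(1 / 2) : ℝ) (1 / 2), ∃ c₂ ∈ Ioo (-(1 / 2) : ℝ) (1 / 2),
    x = c₁ • u₁ + c₂ • u₂}

/-- The folding vector `v₁ = (2u₁ - u₂)/3`. -/
def foldFst (u₁ u₂ : Plane) : Plane := (1 / 3 : ℝ) • ((2 : ℝ) • u₁ - u₂)

/-- The folding vector `v₂ = (u₁ + u₂)/3`. -/
def foldSnd (u₁ u₂ : Plane) : Plane := (1 / 3 : ℝ) • (u₁ + u₂)

/-! ## Potentials -/

/-- Honeycomb lattice potentials. Invariance under complex conjugation is expressed by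
`V` being real valued. -/
structure IsHoneycombPotential (u₁ u₂ : Plane) (V : Plane → ℝ) : Prop where
  smooth : ContDiff ℝ ∞ V
  lattice : u₂ = -rot u₁
  periodic_fst : ∀ x, V (x + u₁) = V x
  periodic_snd : ∀ x, V (x + u₂) = V x
  rotation : ∀ x, V (rot x) = V x
  reflection : ∀ x, V (-x) = V x

/-- Super honeycomb lattice potentials. -/
structure IsSuperHoneycombPotential (u₁ u₂ : Plane) (V : Plane → ℝ) : Prop extends
    IsHoneycombPotential u₁ u₂ V where
  fold_fst : ∀ x, V (x + foldFst u₁ u₂) = V x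
  fold_snd : ∀ x, V (x + foldSnd u₁ u₂) = V x
  nondegenerate :
    ((volume (cell u₁ u₂)).toReal : ℂ)⁻¹ * ∫ y in cell u₁ u₂,
      Complex.exp (-Complex.I *
        (inner ℝ (dualFst (foldFst u₁ u₂) (foldSnd u₁ u₂)) y : ℝ)) * (V y : ℂ) ≠ 0

/-! ## Quasi-periodic functions -/

/-- `⟨f, g⟩ = ∫_Ω conj f · g`. -/
def cellInner (u₁ u₂ : Plane) (f g : Plane → ℂ) : ℂ :=
  ∫ x in cell u₁ u₂, conj (f x) * g x

/-- The plane wave `x ↦ exp(i k·x)`. -/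
def planeWave (k x : Plane) : ℂ := Complex.exp (Complex.I * (inner ℝ k x : ℝ))

/-- Membership in `L²_k(ℝ²/U)`: functions with `f(x+u) = exp(i k·u) f(x)` that are square
integrable over the cell. For `k = 0` this is the space `χ` of periodic functions. -/
structure MemL2k (u₁ u₂ k : Plane) (f : Plane → ℂ) : Prop where
  aestronglyMeasurable : AEStronglyMeasurable f volume
  quasi_fst : ∀ᵐ x, f (x + u₁) = planeWave k u₁ * f x
  quasi_snd : ∀ᵐ x, f (x + u₂) = planeWave k u₂ * f x
  memLp : MemLp f 2 (volume.restrict (cell u₁ u₂))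

/-- Membership in `χ_{ξ₁,ξ₂}`: periodic functions which are eigenfunctions of the folding
translation by `v₁` (eigenvalue `ξ₁`) and of the rotation (eigenvalue `ξ₂`). -/
structure MemChi (u₁ u₂ : Plane) (ξ₁ ξ₂ : ℂ) (f : Plane → ℂ) : Prop where
  mem : MemL2k u₁ u₂ 0 f
  fold : ∀ᵐ x, f (x + foldFst u₁ u₂) = ξ₁ * f x
  rotation : ∀ᵐ x, f (rot x) = ξ₂ * f x

/-- `f : Fin n → L²(Ω)` is orthonormal. -/
def CellOrthonormal (u₁ u₂ : Plane) {n : ℕ} (f : Fin n → Plane → ℂ) : Prop :=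
  ∀ i j, cellInner u₁ u₂ (f i) (f j) = if i = j then 1 else 0

/-! ## Weak derivatives, weak solutions and Sobolev spaces -/

/-- Test functions on the open set `U`: smooth with compact support inside `U`. -/
structure IsTestFunction (U : Set Plane) (φ : Plane → ℂ) : Prop where
  smooth : ContDiff ℝ ∞ φ
  compact : HasCompactSupport φ
  support : tsupport φ ⊆ U

/-- The classical derivative `∂_{w 0} ⋯ ∂_{w (n-1)} φ` along a word of coordinate directions. -/
def wordDeriv {n : ℕ} (w : Fin n → Fin 2) (φ : Plane → ℂ) (x : Plane) : ℂ :=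
  iteratedFDeriv ℝ n φ x (fun i => basisVec (w i))

/-- `g` is the weak derivative of `f` on the open set `U` along the word `w` (for `f`, `g`
locally integrable on `U`). -/
def IsWeakDeriv (U : Set Plane) {n : ℕ} (w : Fin n → Fin 2) (f g : Plane → ℂ) : Prop :=
  ∀ φ, IsTestFunction U φ →
    ∫ x in U, f x * wordDeriv w φ x = (-1) ^ n * ∫ x in U, g x * φ x

open Classical in
/-- The weak partial derivative `∂ᵢ f` on the whole plane (unique up to null sets; zero if
there is none). -/
def weakPartial (i : Fin 2) (f : Plane → ℂ) : Plane → ℂ :=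
  if h : ∃ g, LocallyIntegrable g volume ∧ IsWeakDeriv univ (fun _ : Fin 1 => i) f g then
    h.choose else 0

/-- The operator `2 i k·∇`, in the weak sense. -/
def twoIKGrad (k : Plane) (f : Plane → ℂ) (x : Plane) : ℂ :=
  2 * Complex.I * ∑ i : Fin 2, (k i : ℂ) * weakPartial i f x

/-- `(-Δ + V - E) f = g` in the sense of distributions on the plane. -/
def IsWeakSolution (V : Plane → ℝ) (E : ℝ) (f g : Plane → ℂ) : Prop :=
  ∀ φ, IsTestFunction univ φ →
    ∫ x, f x * (-(Laplacian.laplacian φ x) + (V x : ℂ) * φ x - (E : ℂ) * φ x) = ∫ x, g x * φ x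

/-- `f` belongs to the kernel of `H_V - E` in `L²_k(ℝ²/U)`, where `H_V = -Δ + V`. -/
structure IsEigenmode (u₁ u₂ : Plane) (V : Plane → ℝ) (k : Plane) (E : ℝ)
    (f : Plane → ℂ) : Prop where
  mem : MemL2k u₁ u₂ k f
  equation : IsWeakSolution V E f 0

/-- The energy band `E_n(k)`, `n ≥ 1`: the `n`-th eigenvalue, counted with multiplicity, of
`H_V` on `L²_k(ℝ²/U)`, that is the least `E` such that `n` orthonormal eigenmodes have
eigenvalues at most `E`. -/
def band (u₁ u₂ : Plane) (V : Plane → ℝ) (n : ℕ) (k : Plane) : ℝ :=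
  sInf {E : ℝ | ∃ f : Fin n → Plane → ℂ, CellOrthonormal u₁ u₂ f ∧
    ∀ i, ∃ e ≤ E, IsEigenmode u₁ u₂ V k e (f i)}

/-- Words of length at most two in the two coordinate directions. -/
abbrev SobolevIndex : Type := Σ n : Fin 3, (Fin (n : ℕ) → Fin 2)

/-- The empty word. -/
def emptyWord : SobolevIndex := ⟨0, Fin.elim0⟩

theorem IsTestFunction.integrable_mul {U : Set Plane} {φ : Plane → ℂ}
    (hφ : IsTestFunction U φ) {n : ℕ} (w : Fin n → Fin 2)
    (f : Lp ℂ 2 (volume.restrict U)) :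
    Integrable (fun x => f x * wordDeriv w φ x) (volume.restrict U) := by
  have hc : Continuous (wordDeriv w φ) := by
    have h := hφ.smooth.continuous_iteratedFDeriv (m := n) (by exact_mod_cast le_top)
    exact (ContinuousMultilinearMap.apply ℝ (fun _ : Fin n => Plane) ℂ
      (fun i => basisVec (w i))).continuous.comp h
  have hs : HasCompactSupport (wordDeriv w φ) := by
    refine (hφ.compact.iteratedFDeriv (𝕜 := ℝ) n).mono ?_
    intro x hx hx0
    apply hx
    simp only [wordDeriv]
    rw [hx0]; rfl
  have hw : MemLp (wordDeriv w φ) 2 (volume.restrict U) :=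
    (hc.memLp_of_hasCompactSupport hs).restrict U
  exact (Lp.memLp f).integrable_mul hw

/-- The Sobolev space `H²(U)`: a function in `L²(U)` together with all its weak derivatives of
order at most two in `L²(U)`. The norm inherited from the ambient Hilbert sum is the `H²` norm
(the component at the empty word is the function itself). -/
def SobolevH2 (U : Set Plane) :
    Submodule ℂ (PiLp 2 (fun _ : SobolevIndex => Lp ℂ 2 (volume.restrict U))) where
  carrier := {F | ∀ s : SobolevIndex, IsWeakDeriv U s.2 (F emptyWord) (F s)}
  zero_mem' := by
    intro s φ _
    have h : ((0 : Lp ℂ 2 (volume.restrict U)) : Plane → ℂ) =ᵐ[volume.restrict U] 0 :=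
      Lp.coeFn_zero _ _ _
    have h1 : ∀ ψ : Plane → ℂ,
        ∫ x in U, ((0 : Lp ℂ 2 (volume.restrict U)) : Plane → ℂ) x * ψ x = 0 := by
      intro ψ
      rw [integral_congr_ae (g := fun _ => (0 : ℂ)) (by
        filter_upwards [h] with x hx
        rw [hx, Pi.zero_apply, zero_mul])]
      simp
    simp only [PiLp.zero_apply]
    rw [h1, h1, mul_zero]
  add_mem' := by
    intro F G hF hG s φ hφ
    have key : ∀ {n : ℕ} (w : Fin n → Fin 2) (a b : Lp ℂ 2 (volume.restrict U)),
        ∫ x in U, (a + b : Lp ℂ 2 (volume.restrict U)) x * wordDeriv w φ x =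
          (∫ x in U, a x * wordDeriv w φ x) + ∫ x in U, b x * wordDeriv w φ x := by
      intro n w a b
      rw [← integral_add (hφ.integrable_mul w a) (hφ.integrable_mul w b)]
      refine integral_congr_ae ?_
      filter_upwards [Lp.coeFn_add a b] with x hx
      rw [hx, Pi.add_apply, add_mul]
    have h0 : wordDeriv (Fin.elim0 : Fin 0 → Fin 2) φ = φ := by
      funext x; simp [wordDeriv]
    have key0 := key (Fin.elim0 : Fin 0 → Fin 2) (F s) (G s)
    rw [h0] at key0
    simp only [PiLp.add_apply]
    rw [key, key0, hF s φ hφ, hG s φ hφ, mul_add]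
  smul_mem' := by
    intro c F hF s φ hφ
    have key : ∀ (ψ : Plane → ℂ) (a : Lp ℂ 2 (volume.restrict U)),
        ∫ x in U, (c • a : Lp ℂ 2 (volume.restrict U)) x * ψ x = c * ∫ x in U, a x * ψ x := by
      intro ψ a
      rw [← integral_const_mul]
      refine integral_congr_ae ?_
      filter_upwards [Lp.coeFn_smul c a] with x hx
      rw [hx, Pi.smul_apply, smul_eq_mul, mul_assoc]
    simp only [PiLp.smul_apply]
    rw [key, key, hF s φ hφ]
    ring

/-- The element `F` of `H²(U)` is the class of the restriction of `f` to `U`. -/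
def Represents {U : Set Plane} (F : SobolevH2 U) (f : Plane → ℂ) : Prop :=
  (F.1 emptyWord : Plane → ℂ) =ᵐ[volume.restrict U] f

/-! ## The fourfold degeneracy and its bifurcation coefficients -/

/-- `τ = exp(2πi/3)`. -/
def tau : ℂ := Complex.exp (2 * Real.pi / 3 * Complex.I)

/-- The four modes `φ₁`, `φ₂ = conj φ₁(-x)`, `φ₃ = φ₁(-x)`, `φ₄ = conj φ₁` generated by `φ₁`
(with indices shifted to start at zero). -/
def modes (φ₁ : Plane → ℂ) : Fin 4 → Plane → ℂ :=
  ![φ₁, fun x => conj (φ₁ (-x)), fun x => φ₁ (-x), fun x => conj (φ₁ x)]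

/-- The operator `H_V` has a fourfold degeneracy at `(0, E_D)` on the bands
`n_*+1, …, n_*+4`, with kernel spanned by the four modes generated by `φ₁ ∈ χ_{τ,τ}`. -/
structure FourfoldDegeneracy (u₁ u₂ : Plane) (V : Plane → ℝ) (nStar : ℕ) (ED : ℝ)
    (φ₁ : Plane → ℂ) : Prop where
  one_le : 1 ≤ nStar
  below : band u₁ u₂ V nStar 0 < ED
  equal : ∀ j : Fin 4, band u₁ u₂ V (nStar + 1 + (j : ℕ)) 0 = ED
  above : ED < band u₁ u₂ V (nStar + 5) 0
  normalized : cellInner u₁ u₂ φ₁ φ₁ = 1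
  chi_one : MemChi u₁ u₂ tau tau (modes φ₁ 0)
  chi_two : MemChi u₁ u₂ tau (conj tau) (modes φ₁ 1)
  chi_three : MemChi u₁ u₂ (conj tau) tau (modes φ₁ 2)
  chi_four : MemChi u₁ u₂ (conj tau) (conj tau) (modes φ₁ 3)
  eigen : ∀ l, IsEigenmode u₁ u₂ V 0 ED (modes φ₁ l)
  spanning : ∀ f, IsEigenmode u₁ u₂ V 0 ED f →
    ∃ c : Fin 4 → ℂ, ∀ᵐ x, f x = ∑ l, c l * modes φ₁ l x

/-- `v_♯ = ⟨φ₁, ∇ φ₂⟩ ∈ ℂ²`. -/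
def vSharp (u₁ u₂ : Plane) (φ₁ : Plane → ℂ) : EuclideanSpace ℂ (Fin 2) :=
  WithLp.toLp 2 fun i => cellInner u₁ u₂ (modes φ₁ 0) (weakPartial i (modes φ₁ 1))

/-- The Fermi velocity `v_F = √2 ‖v_♯‖`, so that `v_♯ = (v_F / 2) (1, i) e^{iθ}`. -/
def fermiVelocity (u₁ u₂ : Plane) (φ₁ : Plane → ℂ) : ℝ :=
  Real.sqrt 2 * ‖vSharp u₁ u₂ φ₁‖

/-- The phase normalization of `v_♯` relative to the direction `l`: for all `r ∈ ℝ²`,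
`-2i r·v_♯ = (v_F / ‖l‖) (r·l - i det[r, l])`. -/
def PhaseNormalized (u₁ u₂ : Plane) (φ₁ : Plane → ℂ) (l : Plane) : Prop :=
  ∀ r : Plane,
    -2 * Complex.I * ∑ i : Fin 2, (r i : ℂ) * vSharp u₁ u₂ φ₁ i =
      ((fermiVelocity u₁ u₂ φ₁ / ‖l‖ : ℝ) : ℂ) *
        (((inner ℝ r l : ℝ) : ℂ) - ((det2 r l : ℝ) : ℂ) * Complex.I)

/-- `f` is orthogonal to the kernel of `H_V - E` on the periodic functions. -/
def OrthogonalToKernel (u₁ u₂ : Plane) (V : Plane → ℝ) (E : ℝ) (f : Plane → ℂ) : Prop :=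
  ∀ e, IsEigenmode u₁ u₂ V 0 E e → cellInner u₁ u₂ e f = 0

/-- `ψ = (H_V - E)⁻¹ Q_⊥ g` on the periodic functions: `ψ` is orthogonal to the kernel and
`(H_V - E) ψ = g - h`, where `h` is the orthogonal projection of `g` on the kernel. -/
structure IsReducedResolvent (u₁ u₂ : Plane) (V : Plane → ℝ) (E : ℝ)
    (g ψ : Plane → ℂ) : Prop where
  mem : MemL2k u₁ u₂ 0 ψ
  orthogonal : OrthogonalToKernel u₁ u₂ V E ψ
  equation : ∃ h, IsEigenmode u₁ u₂ V 0 E h ∧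
    OrthogonalToKernel u₁ u₂ V E (fun x => g x - h x) ∧
    IsWeakSolution V E ψ (fun x => g x - h x)

open Classical in
/-- The function `(H_V - E)⁻¹ Q_⊥ g` (unique up to null sets; zero if there is none). -/
def reducedResolvent (u₁ u₂ : Plane) (V : Plane → ℝ) (E : ℝ) (g : Plane → ℂ) : Plane → ℂ :=
  if h : ∃ ψ, IsReducedResolvent u₁ u₂ V E g ψ then h.choose else 0

/-- `b(k) = ⟨φ₁, 2ik·∇ (H_V - E_D)⁻¹ Q_⊥ 2ik·∇ φ₂⟩`. -/
def bCoeff (u₁ u₂ : Plane) (V : Plane → ℝ) (ED : ℝ) (φ₁ : Plane → ℂ) (k : Plane) : ℂ :=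
  cellInner u₁ u₂ (modes φ₁ 0)
    (twoIKGrad k (reducedResolvent u₁ u₂ V ED (twoIKGrad k (modes φ₁ 1))))

/-- The edge-dual direction `l₂ = -b₁ k₁ + a₁ k₂`. -/
def edgeDual (u₁ u₂ : Plane) (a₁ b₁ : ℤ) : Plane :=
  -(b₁ : ℝ) • dualFst u₁ u₂ + (a₁ : ℝ) • dualSnd u₁ u₂

/-- The signs of the linear terms of the four branches. -/
def slopeSign : Fin 4 → ℝ := ![-1, -1, 1, 1]

/-- The combinations `(φ₁ - φ₂)/√2`, `(φ₃ + φ₄)/√2`, `(φ₃ - φ₄)/√2`, `(φ₁ + φ₂)/√2`. -/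
def leadingMode (φ₁ : Plane → ℂ) (j : Fin 4) (x : Plane) : ℂ :=
  ((1 / Real.sqrt 2 : ℝ) : ℂ) *
    (![modes φ₁ 0 x - modes φ₁ 1 x, modes φ₁ 2 x + modes φ₁ 3 x,
      modes φ₁ 2 x - modes φ₁ 3 x, modes φ₁ 0 x + modes φ₁ 1 x] : Fin 4 → ℂ) j

end SuperHoneycomb

end

/-! A function of quasi-momentum `λ l₂` is `exp(iλ l₂·x)` times a periodic function `g`, and `H_V`
acts on `g` as `H_V + λ(-2i l₂·∇) + λ²|l₂|²`. Since `V` has period `v₁`, this operator preserves,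
for every `λ`, the span of the Fourier modes on which translation by `v₁` acts by a given phase.
Hence the fourfold kernel splits into `span(φ₁, φ₂)` in the sector of `τ` and `span(φ₃, φ₄)` in the
sector of `conj τ`, and each pair can be perturbed by itself.

Inside a pair the matrix of `-2i l₂·∇` has zero diagonal: a diagonal entry is linear in the
direction `l` and invariant under the rotation, while `l + R* l + R*² l = 0`
(`inner_B_eq_zero_of_rotation`). The phase normalization at `r = l₂` makes the off-diagonal entry
`v_F ‖l₂‖` in the first pair; the inversion `x ↦ -x` makes it `-v_F ‖l₂‖` in the second. So in each
sector the first order eigenvalues `± v_F ‖l₂‖` are simple, with the leading modes as eigenvectors.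

To stay with bounded operators the unknown is `h = (H_V + c) g`, with `S = (H_V + c)⁻¹` compact and
symmetric and `B = (-2i l₂·∇) S` bounded. `exists_analytic_branch` divides the degenerate equation
by `λ` and solves it by the implicit function theorem; `exists_mode_branches` applies it four times.

The branches are the four bands because the resolvents at `λ l₂` converge in norm to the one at `0`:
by min-max, the number of eigenvalues below the window, and the bound on the number up to its top,
persist (`eventually_hasModes`, `eventually_not_hasModes`, `isLeast_of_modes`).

For the `H²` statements, a branch is `g = R y` with `R` the free resolvent at `0` and `y` analytic
in `L²`. Up to two derivatives of `exp(iλ l₂·x) R y` are polynomial in `λ` with bounded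
coefficients, times a phase analytic in the sup norm (`exists_sobolev_lift`). The remainder is an
analytic curve vanishing at `0`, hence `O(λ)`. The weak formulations reduce to Fourier coefficients
by unfolding integrals over the lattice (`isWeakSolution_quasiExt_iff`). -/

noncomputable section

set_option linter.unusedSectionVars false

namespace SuperHoneycomb

open scoped BoundedContinuousFunction InnerProductSpace Topology
open Filter Module

/-! ### Operators diagonal in a Hilbert basis. -/

section Diagonal

variable {ι H : Type*} [TopologicalSpace ι] [DiscreteTopology ι]
  [NormedAddCommGroup H] [InnerProductSpace ℂ H] (e : HilbertBasis ι ℂ H)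

theorem memℓp_mul (d : ι →ᵇ ℂ) (x : lp (fun _ : ι => ℂ) 2) :
    Memℓp (fun i => d i * x i) 2 := by
  have h := (lp.memℓp x).summable (by norm_num)
  refine memℓp_gen (Summable.of_nonneg_of_le (fun i => by positivity) (fun i => ?_)
    (h.mul_left (‖d‖ ^ (2 : ENNReal).toReal)))
  rw [norm_mul, Real.mul_rpow (norm_nonneg _) (norm_nonneg _)]
  gcongr
  exact d.norm_coe_le_norm i

/-- The operator which is diagonal in a Hilbert basis with prescribed bounded eigenvalues. -/
def diagOp : (ι →ᵇ ℂ) →L[ℂ] H →L[ℂ] H :=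
  LinearMap.mkContinuous₂
    { toFun := fun d =>
        { toFun := fun x => e.repr.symm ⟨fun i => d i * e.repr x i, memℓp_mul d (e.repr x)⟩
          map_add' := fun x y => by
            rw [← map_add]; congr 1; ext i
            simp only [map_add, lp.coeFn_add, Pi.add_apply, mul_add]
          map_smul' := fun c x => by
            rw [RingHom.id_apply, ← map_smul]; congr 1; ext i
            simp [mul_left_comm] }
      map_add' := fun d d' => by
        ext x
        simp only [LinearMap.coe_mk, AddHom.coe_mk, LinearMap.add_apply]
        rw [← map_add]; congr 1; ext i
        simp only [BoundedContinuousFunction.coe_add, Pi.add_apply, add_mul, lp.coeFn_add]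
      map_smul' := fun c d => by
        ext x
        simp only [LinearMap.coe_mk, AddHom.coe_mk, LinearMap.smul_apply, RingHom.id_apply]
        rw [← map_smul]; congr 1; ext i
        simp [mul_assoc] }
    1 (fun d x => by
      rw [one_mul]
      simp only [LinearMap.coe_mk, AddHom.coe_mk, LinearIsometryEquiv.norm_map]
      rw [← e.repr.norm_map x]
      refine lp.norm_le_of_forall_sum_le (by norm_num) (by positivity) (fun s => ?_)
      calc ∑ i ∈ s, ‖d i * e.repr x i‖ ^ (2 : ENNReal).toReal
          ≤ ∑ i ∈ s, ‖d‖ ^ (2 : ENNReal).toReal * ‖e.repr x i‖ ^ (2 : ENNReal).toReal := by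
            refine Finset.sum_le_sum fun i _ => ?_
            rw [norm_mul, Real.mul_rpow (norm_nonneg _) (norm_nonneg _)]
            gcongr
            exact d.norm_coe_le_norm i
        _ ≤ _ := by
            rw [← Finset.mul_sum, Real.mul_rpow (norm_nonneg _) (norm_nonneg _)]
            gcongr
            exact lp.sum_rpow_le_norm_rpow (by norm_num) _ _)

@[simp] theorem repr_diagOp (d : ι →ᵇ ℂ) (x : H) (i : ι) :
    e.repr (diagOp e d x) i = d i * e.repr x i := by
  simp [diagOp, LinearMap.mkContinuous₂_apply]

theorem norm_diagOp_le (d : ι →ᵇ ℂ) : ‖diagOp e d‖ ≤ ‖d‖ := by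
  have h : ‖diagOp e‖ ≤ 1 := LinearMap.mkContinuous₂_norm_le _ zero_le_one _
  calc ‖diagOp e d‖ ≤ ‖diagOp e‖ * ‖d‖ := (diagOp e).le_opNorm d
    _ ≤ 1 * ‖d‖ := by gcongr
    _ = ‖d‖ := one_mul _

theorem repr_ext {x y : H} (h : ∀ i, e.repr x i = e.repr y i) : x = y :=
  e.repr.injective (lp.ext (funext h))

theorem diagOp_mul (d d' : ι →ᵇ ℂ) : diagOp e (d * d') = diagOp e d * diagOp e d' := by
  ext x
  refine repr_ext e fun i => ?_
  simp [mul_assoc]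

theorem diagOp_comm (d d' : ι →ᵇ ℂ) : Commute (diagOp e d) (diagOp e d') := by
  rw [Commute, SemiconjBy, ← diagOp_mul, mul_comm, diagOp_mul]

theorem diagOp_symm {d : ι →ᵇ ℂ} (hd : ∀ i, conj (d i) = d i) (x y : H) :
    ⟪diagOp e d x, y⟫_ℂ = ⟪x, diagOp e d y⟫_ℂ := by
  rw [← e.tsum_inner_mul_inner, ← e.tsum_inner_mul_inner]
  refine tsum_congr fun i => ?_
  rw [← inner_conj_symm, ← e.repr_apply_apply, ← e.repr_apply_apply, ← inner_conj_symm x (e i),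
    ← e.repr_apply_apply, ← e.repr_apply_apply, repr_diagOp, repr_diagOp, map_mul, hd]
  ring

/-- A norm limit of the finite truncations of the diagonal, each of finite rank. This is the source
of compactness of all resolvents below. -/
theorem diagOp_isCompact [CompleteSpace H] {d : ι →ᵇ ℂ} (hd : Tendsto d cofinite (𝓝 0)) :
    IsCompactOperator (diagOp e d) := by
  classical
  have hcut : ∀ s : Finset ι, ∃ d' : ι →ᵇ ℂ, ∀ i, d' i = if i ∈ s then d i else 0 := fun s =>
    ⟨BoundedContinuousFunction.ofNormedAddCommGroupDiscrete
      (fun i => if i ∈ s then d i else 0) ‖d‖ (fun i => by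
        by_cases h : i ∈ s
        · simpa [h] using d.norm_coe_le_norm i
        · simp [h]), fun i => rfl⟩
  choose cut hcut using hcut
  refine isCompactOperator_of_tendsto (l := (atTop : Filter (Finset ι)))
    (F := fun s => diagOp e (cut s)) ?_ (Eventually.of_forall fun s => ?_)
  · refine ((diagOp e).continuous.tendsto d).comp ?_
    rw [Metric.tendsto_atTop]
    intro ε hε
    have h1 : ∀ᶠ i in cofinite, ‖d i‖ < ε / 2 := by
      have := hd.norm
      rw [norm_zero] at this
      exact this.eventually_lt_const (by positivity)
    rw [eventually_cofinite] at h1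
    refine ⟨h1.toFinset, fun s hs => ?_⟩
    refine lt_of_le_of_lt ((BoundedContinuousFunction.dist_le (C := ε / 2) (by positivity)).2
      fun i => ?_) (by linarith)
    rw [hcut, dist_eq_norm]
    by_cases hi : i ∈ s
    · simp [hi]; positivity
    · have : i ∉ h1.toFinset := fun h => hi (hs h)
      simp only [Finite.mem_toFinset, Set.mem_ofPred_eq, not_not] at this
      simpa [hi] using this.le
  · have : ∀ x, diagOp e (cut s) x = ∑ i ∈ s, (d i * e.repr x i) • e i := by
      intro x
      refine repr_ext e fun j => ?_
      rw [map_sum]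
      simp only [map_smul, HilbertBasis.repr_self, repr_diagOp, hcut, lp.coeFn_sum,
        Finset.sum_apply, lp.coeFn_smul, Pi.smul_apply, smul_eq_mul, lp.single_apply]
      simp [Pi.single_apply]
    have hfin : FiniteDimensional ℂ (Submodule.span ℂ (e '' (s : Set ι))) :=
      FiniteDimensional.span_of_finite ℂ (s.finite_toSet.image e)
    have hr : ∀ x, diagOp e (cut s) x ∈ Submodule.span ℂ (e '' (s : Set ι)) := fun x => by
      rw [this]
      exact Submodule.sum_mem _ fun i hi => Submodule.smul_mem _ _
        (Submodule.subset_span ⟨i, hi, rfl⟩)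
    have hc : IsCompactOperator ((diagOp e (cut s)).codRestrict _ hr) := by
      have : IsCompactOperator (id : Submodule.span ℂ (e '' (s : Set ι)) → _) :=
        isCompactOperator_id_iff_finiteDimensional.2 hfin
      exact this.comp_clm ((diagOp e (cut s)).codRestrict _ hr)
    exact hc.clm_comp (Submodule.subtypeL _)

end Diagonal

/-! ### Variational theory of compact symmetric operators. -/

section Spectral

variable {H : Type*} [NormedAddCommGroup H] [InnerProductSpace ℂ H]

/-- Positivity at the single vector `x - t P x` shows that a nonnegative form controls `P x` itself
when its value at `x` is small. -/
theorem norm_apply_sq_le_of_nonneg {P : H →L[ℂ] H} (hP : (P : H →ₗ[ℂ] H).IsSymmetric)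
    (h0 : ∀ x, 0 ≤ (⟪P x, x⟫_ℂ).re) (x : H) :
    ‖P x‖ ^ 2 ≤ (‖P‖ + 1) * (⟪P x, x⟫_ℂ).re := by
  -- The `+ 1` keeps `t` meaningful when `P = 0`.
  set t : ℝ := (‖P‖ + 1)⁻¹ with ht
  have hpos : 0 < ‖P‖ + 1 := by positivity
  have htp : 0 < t := by positivity
  have h1 := h0 (x - (t : ℂ) • P x)
  have e1 : ⟪P (P x), x⟫_ℂ = ⟪P x, P x⟫_ℂ := hP (P x) x
  have e2 : (⟪P (P x), P x⟫_ℂ).re ≤ ‖P‖ * ‖P x‖ ^ 2 := by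
    calc (⟪P (P x), P x⟫_ℂ).re ≤ ‖P (P x)‖ * ‖P x‖ := re_inner_le_norm (𝕜 := ℂ) _ _
      _ ≤ ‖P‖ * ‖P x‖ * ‖P x‖ := by gcongr; exact P.le_opNorm _
      _ = _ := by ring
  have e3 : (⟪P x, P x⟫_ℂ) = ((‖P x‖ ^ 2 : ℝ) : ℂ) := by
    rw [inner_self_eq_norm_sq_to_K]; push_cast; rfl
  simp only [map_sub, map_smul, inner_sub_left, inner_sub_right, inner_smul_left, inner_smul_right,
    Complex.conj_ofReal, e1, e3, Complex.sub_re, ← Complex.ofReal_mul, Complex.ofReal_re,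
    Complex.re_ofReal_mul] at h1
  have h2 : t * (‖P‖ + 1) = 1 := inv_mul_cancel₀ hpos.ne'
  have h3 : t * ‖P x‖ ^ 2 ≤ (⟪P x, x⟫_ℂ).re := by
    nlinarith [mul_le_mul_of_nonneg_left e2 (mul_pos htp htp).le, sq_nonneg ‖P x‖,
      mul_nonneg htp.le (sq_nonneg ‖P x‖)]
  calc ‖P x‖ ^ 2 = (‖P‖ + 1) * (t * ‖P x‖ ^ 2) := by rw [← mul_assoc, mul_comm _ t, h2, one_mul]
    _ ≤ _ := by gcongr

variable [CompleteSpace H]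

/-- The supremum `σ` of the form on the unit sphere is an eigenvalue. Otherwise, `S` being compact
and `σ > 0`, the operator `σ - S` would be bounded below, whereas it is small on almost maximizing
unit vectors by `norm_apply_sq_le_of_nonneg`. -/
theorem exists_hasEigenvector_ge {S : H →L[ℂ] H} (hc : IsCompactOperator S)
    (hs : (S : H →ₗ[ℂ] H).IsSymmetric) {x : H} (hx : x ≠ 0) {μ : ℝ} (hμ : 0 < μ)
    (h : μ * ‖x‖ ^ 2 ≤ (⟪S x, x⟫_ℂ).re) :
    ∃ ν : ℝ, μ ≤ ν ∧ ∃ y : H, ‖y‖ = 1 ∧ S y = (ν : ℂ) • y := by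
  set A : Set ℝ := (fun z => (⟪S z, z⟫_ℂ).re) '' {z | ‖z‖ = 1} with hA
  have hbd : BddAbove A := by
    refine ⟨‖S‖, ?_⟩
    rintro _ ⟨z, hz, rfl⟩
    have hz : ‖z‖ = 1 := hz
    calc (⟪S z, z⟫_ℂ).re ≤ ‖S z‖ * ‖z‖ := re_inner_le_norm (𝕜 := ℂ) _ _
      _ ≤ ‖S‖ * ‖z‖ * ‖z‖ := by gcongr; exact S.le_opNorm _
      _ = ‖S‖ := by simp [hz]
  have scale : ∀ z : H, z ≠ 0 → (⟪S z, z⟫_ℂ).re = ‖z‖ ^ 2 *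
      (⟪S (((‖z‖⁻¹ : ℝ) : ℂ) • z), ((‖z‖⁻¹ : ℝ) : ℂ) • z⟫_ℂ).re := by
    intro z hz
    have : ‖z‖ ≠ 0 := norm_ne_zero_iff.2 hz
    simp only [map_smul, inner_smul_left, inner_smul_right, Complex.conj_ofReal,
      Complex.re_ofReal_mul]
    field_simp
  have unit : ∀ z : H, z ≠ 0 → ‖((‖z‖⁻¹ : ℝ) : ℂ) • z‖ = 1 := by
    intro z hz
    have : ‖z‖ ≠ 0 := norm_ne_zero_iff.2 hz
    rw [norm_smul, Complex.norm_real, norm_inv, norm_norm, inv_mul_cancel₀ this]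
  have hle : ∀ z : H, (⟪S z, z⟫_ℂ).re ≤ sSup A * ‖z‖ ^ 2 := by
    intro z
    by_cases hz : z = 0
    · simp [hz]
    rw [scale z hz, mul_comm]
    gcongr
    exact le_csSup hbd ⟨_, unit z hz, rfl⟩
  set σ := sSup A with hσ
  have hσμ : μ ≤ σ := by
    have h1 := h.trans (hle x)
    have : 0 < ‖x‖ ^ 2 := by positivity
    exact le_of_mul_le_mul_right h1 this
  have hσ0 : 0 < σ := hμ.trans_le hσμ
  by_contra hcon
  have hne : ¬ End.HasEigenvalue (S : End ℂ H) (σ : ℂ) := by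
    intro hev
    obtain ⟨v, hv⟩ := hev.exists_hasEigenvector
    refine hcon ⟨σ, hσμ, ((‖v‖⁻¹ : ℝ) : ℂ) • v, unit v hv.2, ?_⟩
    have : S v = (σ : ℂ) • v := hv.apply_eq_smul
    rw [map_smul, this, smul_comm]
  obtain ⟨K, hK⟩ := IsCompactOperator.antilipschitz_of_not_hasEigenvalue hc
    (Complex.ofReal_ne_zero.2 hσ0.ne') hne
  set P : H →L[ℂ] H := (σ : ℂ) • 1 - S with hPdef
  have hPs : (P : H →ₗ[ℂ] H).IsSymmetric := by
    intro u v
    have := hs u v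
    simp only [ContinuousLinearMap.coe_coe] at this ⊢
    simp only [hPdef, sub_apply, smul_apply, one_apply_eq_self, inner_sub_left, inner_sub_right,
      inner_smul_left, inner_smul_right, Complex.conj_ofReal, this]
  have hPe : ∀ z, (⟪P z, z⟫_ℂ).re = σ * ‖z‖ ^ 2 - (⟪S z, z⟫_ℂ).re := by
    intro z
    simp only [hPdef, sub_apply, smul_apply,
      one_apply_eq_self, inner_sub_left, inner_smul_left, Complex.conj_ofReal,
      Complex.sub_re, Complex.re_ofReal_mul]
    congr 2
    exact inner_self_eq_norm_sq (𝕜 := ℂ) z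
  have hP0 : ∀ z, 0 ≤ (⟪P z, z⟫_ℂ).re := fun z => by rw [hPe]; linarith [hle z]
  have hKz : ∀ z, ‖z‖ ≤ K * ‖P z‖ := by
    intro z
    have := hK.le_mul_dist z 0
    simp only [map_zero, dist_zero_right] at this
    convert this using 2
    rw [hPdef, ← norm_neg]; congr 1
    simp
  have hAne : A.Nonempty := ⟨_, _, unit x hx, rfl⟩
  -- A unit vector within `ε` of the supremum has `‖P z‖² < 1 / (K² + 1)`, against `1 ≤ K ‖P z‖`.
  set ε : ℝ := ((K : ℝ) ^ 2 + 1)⁻¹ * (‖P‖ + 1)⁻¹ with hε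
  have hεp : 0 < ε := by positivity
  obtain ⟨_, ⟨z, hz, rfl⟩, hzl⟩ := exists_lt_of_lt_csSup hAne (show σ - ε < sSup A by linarith)
  have hz : ‖z‖ = 1 := hz
  have h1 := norm_apply_sq_le_of_nonneg hPs hP0 z
  have h2 : (⟪P z, z⟫_ℂ).re < ε := by rw [hPe, hz]; simp only at hzl; linarith
  have h3 : ‖P z‖ ^ 2 < ((K : ℝ) ^ 2 + 1)⁻¹ := by
    calc ‖P z‖ ^ 2 ≤ _ := h1
      _ < (‖P‖ + 1) * ε := by gcongr
      _ = ((K : ℝ) ^ 2 + 1)⁻¹ := by rw [hε]; field_simp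
  have h4 := hKz z
  rw [hz] at h4
  have h5 : 1 ≤ (K : ℝ) ^ 2 * ‖P z‖ ^ 2 := by nlinarith [K.2, norm_nonneg (P z)]
  have h6 : ((K : ℝ) ^ 2 + 1) * ‖P z‖ ^ 2 < 1 := by
    have := mul_lt_mul_of_pos_left h3 (show 0 < (K : ℝ) ^ 2 + 1 by positivity)
    rwa [mul_inv_cancel₀ (by positivity)] at this
  nlinarith [sq_nonneg ‖P z‖]

/-- By symmetry the complement of an invariant subspace is invariant, so the restriction of `S` to
it is again compact and symmetric. -/
theorem exists_hasEigenvector_ge_orthogonal {S : H →L[ℂ] H} (hc : IsCompactOperator S)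
    (hs : (S : H →ₗ[ℂ] H).IsSymmetric) {Y : Submodule ℂ H} (hY : ∀ y ∈ Y, S y ∈ Y)
    {x : H} (hxY : x ∈ Yᗮ) (hx : x ≠ 0) {μ : ℝ} (hμ : 0 < μ)
    (h : μ * ‖x‖ ^ 2 ≤ (⟪S x, x⟫_ℂ).re) :
    ∃ ν : ℝ, μ ≤ ν ∧ ∃ y ∈ Yᗮ, ‖y‖ = 1 ∧ S y = (ν : ℂ) • y := by
  have hinv : ∀ z ∈ Yᗮ, S z ∈ Yᗮ := by
    intro z hz y hy
    rw [← show ⟪S y, z⟫_ℂ = ⟪y, S z⟫_ℂ from hs y z]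
    exact hz _ (hY y hy)
  let T : Yᗮ →L[ℂ] Yᗮ := S.restrict hinv
  have hTc : IsCompactOperator T := hc.restrict' hinv
  have hTs : (T : Yᗮ →ₗ[ℂ] Yᗮ).IsSymmetric := hs.restrict_invariant hinv
  obtain ⟨ν, hν, y, hy1, hy⟩ := exists_hasEigenvector_ge hTc hTs (x := ⟨x, hxY⟩)
    (by simpa using hx) hμ h
  exact ⟨ν, hν, y, y.2, hy1, congrArg Subtype.val hy⟩

/-- The orthogonal projection of `X` to the smaller space `Y` has a nontrivial kernel. -/
theorem exists_ne_zero_orthogonal {X Y : Submodule ℂ H} [FiniteDimensional ℂ X]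
    [FiniteDimensional ℂ Y] (h : finrank ℂ Y < finrank ℂ X) : ∃ x ∈ X, x ∈ Yᗮ ∧ x ≠ 0 := by
  let f : X →ₗ[ℂ] Y := (Y.orthogonalProjectionOnto : H →ₗ[ℂ] Y) ∘ₗ X.subtype
  have hk := LinearMap.ker_ne_bot_of_finrank_lt (f := f) h
  obtain ⟨x, hx, hx0⟩ := (Submodule.ne_bot_iff _).1 hk
  refine ⟨x, x.2, ?_, by simpa using hx0⟩
  exact Submodule.orthogonalProjectionOnto_eq_zero_iff.1 hx

theorem span_invariant_of_eigenvectors {S : H →L[ℂ] H} {κ : Type*} {y : κ → H} {ν : κ → ℝ}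
    (h : ∀ i, S (y i) = (ν i : ℂ) • y i) :
    ∀ z ∈ Submodule.span ℂ (range y), S z ∈ Submodule.span ℂ (range y) := by
  intro z hz
  induction hz using Submodule.span_induction with
  | mem z hz =>
    obtain ⟨i, rfl⟩ := hz
    rw [h]
    exact Submodule.smul_mem _ _ (Submodule.subset_span ⟨i, rfl⟩)
  | zero => simp
  | add a b _ _ ha hb => rw [map_add]; exact Submodule.add_mem _ ha hb
  | smul c a _ ha => rw [map_smul]; exact Submodule.smul_mem _ _ ha

theorem orthonormal_snoc {n : ℕ} {y : Fin n → H} (hy : Orthonormal ℂ y) {z : H} (hz : ‖z‖ = 1)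
    (hzy : z ∈ (Submodule.span ℂ (range y))ᗮ) :
    Orthonormal ℂ (Fin.snoc y z : Fin (n + 1) → H) := by
  have h0 : ∀ i, ⟪y i, z⟫_ℂ = 0 := fun i => hzy _ (Submodule.subset_span ⟨i, rfl⟩)
  rw [orthonormal_iff_ite] at hy ⊢
  intro i j
  induction i using Fin.lastCases with
  | last =>
    induction j using Fin.lastCases with
    | last => simp [hz]
    | cast j =>
      rw [Fin.snoc_last, Fin.snoc_castSucc, ← inner_conj_symm, h0]
      simp [(Fin.castSucc_lt_last j).ne']
  | cast i =>
    induction j using Fin.lastCases with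
    | last => 
      rw [Fin.snoc_last, Fin.snoc_castSucc, h0]
      simp [(Fin.castSucc_lt_last i).ne]
    | cast j =>
      rw [Fin.snoc_castSucc, Fin.snoc_castSucc, hy i j]
      simp

/-- A compact symmetric operator has `N` orthonormal eigenvectors with large eigenvalues as soon as
the quadratic form is large somewhere in the complement of any space of smaller dimension. -/
theorem exists_orthonormal_eigenvectors {S : H →L[ℂ] H} (hc : IsCompactOperator S)
    (hs : (S : H →ₗ[ℂ] H).IsSymmetric) (p : ℝ) (N : ℕ)
    (h : ∀ Y : Submodule ℂ H, FiniteDimensional ℂ Y → finrank ℂ Y < N →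
      ∃ x ∈ Yᗮ, x ≠ 0 ∧ ∃ μ : ℝ, 0 < μ ∧ p ≤ μ ∧ μ * ‖x‖ ^ 2 ≤ (⟪S x, x⟫_ℂ).re) :
    ∃ (y : Fin N → H) (ν : Fin N → ℝ), Orthonormal ℂ y ∧
      ∀ i, 0 < ν i ∧ p ≤ ν i ∧ S (y i) = (ν i : ℂ) • y i := by
  -- Eigenvectors are added one at a time; the hypothesis is available as long as fewer than `N`
  -- have been found.
  suffices H' : ∀ n ≤ N, ∃ (y : Fin n → H) (ν : Fin n → ℝ), Orthonormal ℂ y ∧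
      ∀ i, 0 < ν i ∧ p ≤ ν i ∧ S (y i) = (ν i : ℂ) • y i from H' N le_rfl
  intro n
  induction n with
  | zero => exact fun _ => ⟨Fin.elim0, Fin.elim0, ⟨fun i => i.elim0, fun i => i.elim0⟩,
      fun i => i.elim0⟩
  | succ n ih =>
    intro hn
    obtain ⟨y, ν, hy, hν⟩ := ih (by omega)
    set Y := Submodule.span ℂ (range y) with hY
    have hfin : FiniteDimensional ℂ Y := FiniteDimensional.span_of_finite ℂ (finite_range y)
    obtain ⟨x, hxY, hx0, μ, hμ, hpμ, hx⟩ := h Y hfin (by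
      rw [hY, finrank_span_eq_card hy.linearIndependent, Fintype.card_fin]; omega)
    obtain ⟨ν', hν', z, hzY, hz1, hz⟩ := exists_hasEigenvector_ge_orthogonal hc hs
      (span_invariant_of_eigenvectors fun i => (hν i).2.2) hxY hx0 hμ hx
    refine ⟨Fin.snoc y z, Fin.snoc ν ν', orthonormal_snoc hy hz1 hzY, fun i => ?_⟩
    induction i using Fin.lastCases with
    | last => simpa [hz] using ⟨hμ.trans_le hν', hpμ.trans hν'⟩
    | cast i => simpa using hν i

theorem inner_apply_of_eigenvectors {S : H →L[ℂ] H} {n : ℕ} {y : Fin n → H} {ν : Fin n → ℝ}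
    (hy : Orthonormal ℂ y) (h : ∀ i, S (y i) = (ν i : ℂ) • y i) (c : Fin n → ℂ) :
    (⟪S (∑ i, c i • y i), ∑ i, c i • y i⟫_ℂ).re = ∑ i, ν i * ‖c i‖ ^ 2 ∧
      ‖∑ i, c i • y i‖ ^ 2 = ∑ i, ‖c i‖ ^ 2 := by
  have h1 : S (∑ i, c i • y i) = ∑ i, ((ν i : ℂ) * c i) • y i := by
    rw [map_sum]
    refine Finset.sum_congr rfl fun i _ => ?_
    rw [map_smul, h, smul_smul, mul_comm]
  constructor
  · rw [h1, hy.inner_sum, Complex.re_sum]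
    refine Finset.sum_congr rfl fun i _ => ?_
    rw [map_mul, Complex.conj_ofReal, mul_assoc, Complex.re_ofReal_mul, mul_comm (conj (c i)),
      Complex.mul_conj, Complex.ofReal_re, Complex.normSq_eq_norm_sq]
  · have := inner_self_eq_norm_sq (𝕜 := ℂ) (∑ i, c i • y i)
    rw [← this, hy.inner_sum, map_sum]
    refine Finset.sum_congr rfl fun i _ => ?_
    rw [mul_comm, Complex.mul_conj, Complex.normSq_eq_norm_sq]
    exact Complex.ofReal_re _

/-- Courant–Fischer counting: more than `M` such eigenvectors would span a space meeting the
complement of the `x i`, and there the form would exceed `μ`. -/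
theorem card_le_of_inner_le_on_orthogonal {S : H →L[ℂ] H} {M n : ℕ} {x : Fin M → H} {μ : ℝ}
    (hx : ∀ z ∈ (Submodule.span ℂ (range x))ᗮ, (⟪S z, z⟫_ℂ).re ≤ μ * ‖z‖ ^ 2)
    {y : Fin n → H} {ν : Fin n → ℝ} (hy : Orthonormal ℂ y)
    (h : ∀ i, μ < ν i ∧ S (y i) = (ν i : ℂ) • y i) : n ≤ M := by
  by_contra hlt
  have hfin : FiniteDimensional ℂ (Submodule.span ℂ (range x)) :=
    FiniteDimensional.span_of_finite ℂ (finite_range x)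
  have hfin' : FiniteDimensional ℂ (Submodule.span ℂ (range y)) :=
    FiniteDimensional.span_of_finite ℂ (finite_range y)
  obtain ⟨z, hzy, hzx, hz0⟩ := exists_ne_zero_orthogonal (X := Submodule.span ℂ (range y))
    (Y := Submodule.span ℂ (range x)) (by
      rw [finrank_span_eq_card hy.linearIndependent, Fintype.card_fin]
      have := finrank_range_le_card (R := ℂ) x
      rw [Fintype.card_fin] at this
      exact lt_of_le_of_lt this (by omega))
  obtain ⟨c, rfl⟩ := (Submodule.mem_span_range_iff_exists_fun ℂ).1 hzy
  obtain ⟨e1, e2⟩ := inner_apply_of_eigenvectors hy (fun i => (h i).2) c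
  have h1 := hx _ hzx
  rw [e1, e2, Finset.mul_sum] at h1
  have hci : ∃ i, c i ≠ 0 := by
    by_contra hcon
    push Not at hcon
    exact hz0 (by simp [hcon])
  obtain ⟨i, hi⟩ := hci
  refine absurd h1 (not_le.2 (Finset.sum_lt_sum (fun j _ => ?_) ⟨i, Finset.mem_univ i, ?_⟩))
  · gcongr; exact (h j).1.le
  · have : 0 < ‖c i‖ := norm_pos_iff.2 hi
    gcongr; exact (h i).1

/-- A vector of the complement with form above `μ` would yield one more orthonormal eigenvector,
contradicting maximality. -/
theorem inner_le_on_orthogonal_of_maximal {S : H →L[ℂ] H} (hc : IsCompactOperator S)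
    (hs : (S : H →ₗ[ℂ] H).IsSymmetric) {M : ℕ} {x : Fin M → H} {ν : Fin M → ℝ}
    (hx : Orthonormal ℂ x) {μ : ℝ} (hμ : 0 < μ) (h : ∀ i, μ ≤ ν i ∧ S (x i) = (ν i : ℂ) • x i)
    (hmax : ∀ (y : Fin (M + 1) → H) (ν' : Fin (M + 1) → ℝ), Orthonormal ℂ y →
      ¬ ∀ i, μ ≤ ν' i ∧ S (y i) = (ν' i : ℂ) • y i) :
    ∀ z ∈ (Submodule.span ℂ (range x))ᗮ, (⟪S z, z⟫_ℂ).re ≤ μ * ‖z‖ ^ 2 := by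
  intro z hz
  by_contra hlt
  push Not at hlt
  have hz0 : z ≠ 0 := by
    rintro rfl
    simp at hlt
  obtain ⟨ν', hν', y, hyY, hy1, hy⟩ := exists_hasEigenvector_ge_orthogonal hc hs
    (span_invariant_of_eigenvectors fun i => (h i).2) hz hz0 hμ hlt.le
  refine hmax (Fin.snoc x y) (Fin.snoc ν ν') (orthonormal_snoc hx hy1 hyY) fun i => ?_
  induction i using Fin.lastCases with
  | last => simpa [hy] using hν'
  | cast i => simpa using h i

/-- Together with norm continuity of the resolvent, this transfers eigenvalue counts from `k = 0` to
small `k`. -/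
theorem re_inner_apply_le_add {S T : H →L[ℂ] H} {ε : ℝ} (h : ‖S - T‖ ≤ ε) (z : H) :
    (⟪S z, z⟫_ℂ).re ≤ (⟪T z, z⟫_ℂ).re + ε * ‖z‖ ^ 2 := by
  have h1 : (⟪(S - T) z, z⟫_ℂ).re ≤ ε * ‖z‖ ^ 2 := by
    calc (⟪(S - T) z, z⟫_ℂ).re ≤ ‖(S - T) z‖ * ‖z‖ := re_inner_le_norm (𝕜 := ℂ) _ _
      _ ≤ ‖S - T‖ * ‖z‖ * ‖z‖ := by gcongr; exact (S - T).le_opNorm _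
      _ ≤ ε * ‖z‖ * ‖z‖ := by gcongr
      _ = _ := by ring
  rw [sub_apply, inner_sub_left, Complex.sub_re] at h1
  linarith

end Spectral

/-! ### Analytic perturbation by Lyapunov–Schmidt reduction. -/

section Branch

variable {H : Type*} [NormedAddCommGroup H] [InnerProductSpace ℂ H]

/-- The operator `x ↦ ⟪a, x⟫ a`. -/
def rankOne (a : H) : H →L[ℂ] H := (innerSL ℂ a).smulRight a

theorem rankOne_isCompact (a : H) : IsCompactOperator (rankOne a) := by
  have h : IsCompactOperator (id : ℂ → ℂ) :=
    (isCompactOperator_id_iff_finiteDimensional (𝕜 := ℂ)).2 inferInstance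
  exact (h.comp_clm (innerSL ℂ a)).clm_comp (ContinuousLinearMap.toSpanSingleton ℂ a)

variable [CompleteSpace H]

/-- Subtracting the projections on `a` and `b` from `κ S` removes the eigenvalue `1`: `T` maps into
the complement of `a`, `b`, so a fixed vector of `T` is fixed by `κ S`, hence lies in their span and
vanishes. The Fredholm alternative then inverts `1 - T`. -/
theorem exists_solution_orthogonal {S : H →L[ℂ] H} (hc : IsCompactOperator S)
    (hs : (S : H →ₗ[ℂ] H).IsSymmetric) {a b : H} (ha1 : ⟪a, a⟫_ℂ = 1) (hb1 : ⟪b, b⟫_ℂ = 1)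
    (hab : ⟪a, b⟫_ℂ = 0) {κ : ℝ} (hκ : 0 < κ) (ha : (κ : ℂ) • S a = a) (hb : (κ : ℂ) • S b = b)
    (hker : ∀ x, (κ : ℂ) • S x = x → ∃ α β : ℂ, x = α • a + β • b) {y : H}
    (hya : ⟪a, y⟫_ℂ = 0) (hyb : ⟪b, y⟫_ℂ = 0) :
    ∃ z, ⟪a, z⟫_ℂ = 0 ∧ ⟪b, z⟫_ℂ = 0 ∧ z - (κ : ℂ) • S z = y := by
  have hκ0 : (κ : ℂ) ≠ 0 := Complex.ofReal_ne_zero.2 hκ.ne'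
  have hba : ⟪b, a⟫_ℂ = 0 := by rw [← inner_conj_symm, hab, map_zero]
  have hSa : ∀ x, (κ : ℂ) * ⟪a, S x⟫_ℂ = ⟪a, x⟫_ℂ := fun x => by
    have h1 : ⟪S a, x⟫_ℂ = ⟪a, S x⟫_ℂ := hs a x
    calc (κ : ℂ) * ⟪a, S x⟫_ℂ = ⟪(κ : ℂ) • S a, x⟫_ℂ := by
          rw [inner_smul_left, Complex.conj_ofReal, h1]
      _ = _ := by rw [ha]
  have hSb : ∀ x, (κ : ℂ) * ⟪b, S x⟫_ℂ = ⟪b, x⟫_ℂ := fun x => by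
    have h1 : ⟪S b, x⟫_ℂ = ⟪b, S x⟫_ℂ := hs b x
    calc (κ : ℂ) * ⟪b, S x⟫_ℂ = ⟪(κ : ℂ) • S b, x⟫_ℂ := by
          rw [inner_smul_left, Complex.conj_ofReal, h1]
      _ = _ := by rw [hb]
  set T : H →L[ℂ] H := (κ : ℂ) • S - rankOne a - rankOne b with hT
  have hTx : ∀ x, T x = (κ : ℂ) • S x - ⟪a, x⟫_ℂ • a - ⟪b, x⟫_ℂ • b := fun x => rfl
  have hTc : IsCompactOperator T :=
    ((hc.smul (κ : ℂ)).sub (rankOne_isCompact a)).sub (rankOne_isCompact b)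
  have hTa : ∀ x, ⟪a, T x⟫_ℂ = 0 := fun x => by
    rw [hTx, inner_sub_right, inner_sub_right, inner_smul_right, inner_smul_right,
      inner_smul_right, hSa, ha1, hab]; ring
  have hTb : ∀ x, ⟪b, T x⟫_ℂ = 0 := fun x => by
    rw [hTx, inner_sub_right, inner_sub_right, inner_smul_right, inner_smul_right,
      inner_smul_right, hSb, hb1, hba]; ring
  rcases IsCompactOperator.hasEigenvalue_or_mem_resolventSet hTc (one_ne_zero (α := ℂ)) with hev | hr
  · exfalso
    obtain ⟨v, hv⟩ := hev.exists_hasEigenvector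
    have hv1 : T v = v := by simpa using hv.apply_eq_smul
    have h1 : ⟪a, v⟫_ℂ = 0 := by rw [← hv1, hTa]
    have h2 : ⟪b, v⟫_ℂ = 0 := by rw [← hv1, hTb]
    have h3 : (κ : ℂ) • S v = v := by
      have := hTx v
      rw [h1, h2, hv1] at this
      simpa using this.symm
    obtain ⟨α, β, hαβ⟩ := hker v h3
    have hα : α = 0 := by
      rw [hαβ] at h1
      simp only [inner_add_right, inner_smul_right, hab, ha1] at h1
      linear_combination h1
    have hβ : β = 0 := by
      rw [hαβ] at h2
      simp only [inner_add_right, inner_smul_right, hba, hb1] at h2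
      linear_combination h2
    exact hv.2 (by rw [hαβ, hα, hβ]; simp)
  · rw [spectrum.mem_resolventSet_iff] at hr
    obtain ⟨u, hu⟩ := hr
    have hz : ∀ y, u.1 ((u⁻¹ : (H →L[ℂ] H)ˣ).1 y) = y := fun y => by
      rw [← mul_apply_eq_comp, u.mul_inv]; rfl
    refine ⟨(u⁻¹ : (H →L[ℂ] H)ˣ).1 y, ?_⟩
    set z := (u⁻¹ : (H →L[ℂ] H)ˣ).1 y with hzdef
    have h0 : z - T z = y := by
      have := hz y
      rw [hu] at this
      simpa using this
    have h1 : ⟪a, z⟫_ℂ = 0 := by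
      rw [← sub_add_cancel z (T z), h0, inner_add_right, hTa, hya, add_zero]
    have h2 : ⟪b, z⟫_ℂ = 0 := by
      rw [← sub_add_cancel z (T z), h0, inner_add_right, hTb, hyb, add_zero]
    refine ⟨h1, h2, ?_⟩
    rw [hTx, h1, h2] at h0
    simpa using h0

/-- Analytic perturbation of an eigenvalue of multiplicity two which splits at first order. -/
theorem exists_analytic_branch {S B : H →L[ℂ] H} (hc : IsCompactOperator S)
    (hs : (S : H →ₗ[ℂ] H).IsSymmetric) (hSB : ∀ x, ⟪B x, S x⟫_ℂ = ⟪S x, B x⟫_ℂ)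
    {a b : H} (ha1 : ⟪a, a⟫_ℂ = 1) (hb1 : ⟪b, b⟫_ℂ = 1)
    (hab : ⟪a, b⟫_ℂ = 0) {κ : ℝ} (hκ : 0 < κ) (ha : (κ : ℂ) • S a = a) (hb : (κ : ℂ) • S b = b)
    (hker : ∀ x, (κ : ℂ) • S x = x → ∃ α β : ℂ, x = α • a + β • b)
    {νa νb : ℝ} (hne : νa ≠ νb) (hBa : (κ : ℂ) * ⟪a, B a⟫_ℂ = νa)
    (hBb : (κ : ℂ) * ⟪b, B b⟫_ℂ = νb) (hBab : ⟪b, B a⟫_ℂ = 0) (p : ℝ) :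
    ∃ (ν : ℝ → ℝ) (h : ℝ → H), AnalyticAt ℝ ν 0 ∧ AnalyticAt ℝ h 0 ∧ ν 0 = νa ∧
      h 0 = (κ : ℂ) • a ∧ ∀ᶠ t : ℝ in 𝓝 0, h t - (κ : ℂ) • S (h t) + (t : ℂ) • B (h t) +
        ((t ^ 2 * p - t * ν t : ℝ) : ℂ) • S (h t) = 0 := by
  have hκ0 : (κ : ℂ) ≠ 0 := Complex.ofReal_ne_zero.2 hκ.ne'
  have hba : ⟪b, a⟫_ℂ = 0 := by rw [← inner_conj_symm, hab, map_zero]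
  have hSa : ∀ x, (κ : ℂ) * ⟪a, S x⟫_ℂ = ⟪a, x⟫_ℂ := fun x => by
    have h1 : ⟪S a, x⟫_ℂ = ⟪a, S x⟫_ℂ := hs a x
    calc (κ : ℂ) * ⟪a, S x⟫_ℂ = ⟪(κ : ℂ) • S a, x⟫_ℂ := by
          rw [inner_smul_left, Complex.conj_ofReal, h1]
      _ = _ := by rw [ha]
  have hSb : ∀ x, (κ : ℂ) * ⟪b, S x⟫_ℂ = ⟪b, x⟫_ℂ := fun x => by
    have h1 : ⟪S b, x⟫_ℂ = ⟪b, S x⟫_ℂ := hs b x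
    calc (κ : ℂ) * ⟪b, S x⟫_ℂ = ⟪(κ : ℂ) • S b, x⟫_ℂ := by
          rw [inner_smul_left, Complex.conj_ofReal, h1]
      _ = _ := by rw [hb]
  have hbSb : ⟪b, S b⟫_ℂ = (κ : ℂ)⁻¹ := by
    have := hSb b
    rw [hb1] at this
    field_simp
    linear_combination this
  have hLa : ∀ x, ⟪a, x - (κ : ℂ) • S x⟫_ℂ = 0 := fun x => by
    rw [inner_sub_right, inner_smul_right, hSa, sub_self]
  have hLb : ∀ x, ⟪b, x - (κ : ℂ) • S x⟫_ℂ = 0 := fun x => by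
    rw [inner_sub_right, inner_smul_right, hSb, sub_self]
  -- This number is `(νb - νa) / κ`; the first order splitting enters here.
  have hγ : ⟪b, B b - (νa : ℂ) • S b⟫_ℂ ≠ 0 := by
    rw [inner_sub_right, inner_smul_right, hbSb]
    intro h0
    apply hne
    have h1 : (νb : ℂ) = νa := by
      rw [← hBb]
      have : (κ : ℂ) * (⟪b, B b⟫_ℂ - νa * (κ : ℂ)⁻¹) = 0 := by rw [h0, mul_zero]
      field_simp at this
      linear_combination this
    exact_mod_cast h1.symm
  set γ := ⟪b, B b - (νa : ℂ) • S b⟫_ℂ with hγdef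
  have hBadd : ∀ x y : H, ⟪b, B (x + y) - (νa : ℂ) • S (x + y)⟫_ℂ =
      ⟪b, B x - (νa : ℂ) • S x⟫_ℂ + ⟪b, B y - (νa : ℂ) • S y⟫_ℂ := fun x y => by
    rw [← inner_add_right, map_add, map_add, smul_add]; congr 1; abel
  have hBsmul : ∀ (c : ℂ) (x : H), ⟪b, B (c • x) - (νa : ℂ) • S (c • x)⟫_ℂ =
      c * ⟪b, B x - (νa : ℂ) • S x⟫_ℂ := fun c x => by
    rw [← inner_smul_right, map_smul, map_smul, smul_sub, smul_comm c]
  have hLb0 : ∀ c : ℂ, c • b - (κ : ℂ) • S (c • b) = 0 := fun c => by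
    rw [map_smul, smul_comm, hb, sub_self]
  have hLa0 : ∀ c : ℂ, c • a - (κ : ℂ) • S (c • a) = 0 := fun c => by
    rw [map_smul, smul_comm, ha, sub_self]
  have hLadd : ∀ x y : H, (x + y) - (κ : ℂ) • S (x + y) = (x - (κ : ℂ) • S x) +
      (y - (κ : ℂ) • S y) := fun x y => by
    rw [map_add, smul_add]; abel
  -- The value of the corrector at `t = 0`: the equation fixes it modulo `a` and `b`, the
  -- normalization kills its `a`-component, and its `b`-component is chosen to satisfy the
  -- solvability condition of the next order.
  obtain ⟨z0, hz0a, hz0b, hz0⟩ := exists_solution_orthogonal hc hs ha1 hb1 hab hκ ha hb hker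
    (y := (νa : ℂ) • a - (κ : ℂ) • B a)
    (by rw [inner_sub_right, inner_smul_right, inner_smul_right, ha1, hBa]; ring)
    (by rw [inner_sub_right, inner_smul_right, inner_smul_right, hba, hBab]; ring)
  set w0 : H := z0 + (-(⟪b, B z0 - (νa : ℂ) • S z0⟫_ℂ) / γ) • b with hw0
  have hw0L : w0 - (κ : ℂ) • S w0 = (νa : ℂ) • a - (κ : ℂ) • B a := by
    rw [hw0, hLadd, hLb0, hz0, add_zero]
  have hw0b : ⟪b, B w0 - (νa : ℂ) • S w0⟫_ℂ = 0 := by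
    rw [hw0, hBadd, hBsmul, ← hγdef, div_mul_cancel₀ _ hγ]; ring
  have hw0a : ⟪a, w0⟫_ℂ = 0 := by
    rw [hw0, inner_add_right, inner_smul_right, hz0a, hab]; ring
  -- With `h = κ a + t w` the equation is `t` times `w - κ S w + κ B a - ν a + t G`. The component
  -- of this bracket along `b` is `t ⟪b, G⟫`, which degenerates at `t = 0`. In `F` it is replaced by
  -- `⟪b, G⟫`, and the normalization `⟪a, w⟫ = 0` is added; a zero of `F` still solves the equation.
  let G : ℂ × (ℂ × H) → H := fun q => B q.2.2 + (q.1 * p - q.2.1) • S q.2.2 + (p : ℂ) • a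
  let F : ℂ × (ℂ × H) → H × ℂ := fun q =>
    (q.2.2 - (κ : ℂ) • S q.2.2 + (κ : ℂ) • B a - q.2.1 • a + q.1 • (G q - innerSL ℂ b (G q) • b) +
      innerSL ℂ b (G q) • b, innerSL ℂ a q.2.2)
  have hGc : ContDiff ℂ ω G := by fun_prop
  have hFc : ContDiff ℂ ω F := by fun_prop
  set u0 : ℂ × (ℂ × H) := (0, ((νa : ℂ), w0)) with hu0
  let D : ℂ × H →L[ℂ] H × ℂ :=
    (((1 - (κ : ℂ) • S) ∘L .snd ℂ ℂ H - (ContinuousLinearMap.fst ℂ ℂ H).smulRight a) +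
      (innerSL ℂ b ∘L ((B - (νa : ℂ) • S) ∘L .snd ℂ ℂ H -
        (ContinuousLinearMap.fst ℂ ℂ H).smulRight (S w0))).smulRight b).prod
      (innerSL ℂ a ∘L .snd ℂ ℂ H)
  have hDa : ∀ v, D v = ((v.2 - (κ : ℂ) • S v.2 - v.1 • a) +
      ⟪b, B v.2 - (νa : ℂ) • S v.2 - v.1 • S w0⟫_ℂ • b, ⟪a, v.2⟫_ℂ) := fun v => rfl
  -- Pairing with `a` gives `s = 0`; pairing with `b` and using the kernel leaves `γ` times the
  -- `b`-component, and the second coordinate removes the `a`-component.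
  have hDinj : Function.Injective D := by
    rw [injective_iff_map_eq_zero]
    rintro ⟨s, w⟩ h0
    rw [hDa, Prod.mk_eq_zero] at h0
    obtain ⟨h1, h2⟩ := h0
    simp only at h1 h2
    have hs0 : s = 0 := by
      have := congrArg (fun x => ⟪a, x⟫_ℂ) h1
      simp only [inner_add_right, inner_sub_right (𝕜 := ℂ) a (w - _), inner_smul_right, hLa, ha1,
        hab, inner_zero_right] at this
      simpa using this
    subst hs0
    have h3 : ⟪b, B w - (νa : ℂ) • S w⟫_ℂ = 0 := by
      have := congrArg (fun x => ⟪b, x⟫_ℂ) h1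
      simp only [zero_smul, sub_zero] at this
      simp only [inner_add_right, inner_smul_right, hLb, hb1, inner_zero_right, mul_one,
        zero_add] at this
      exact this
    simp only [zero_smul, sub_zero] at h1
    rw [h3, zero_smul, add_zero, sub_eq_zero] at h1
    obtain ⟨α, β, rfl⟩ := hker w h1.symm
    have hα : α = 0 := by
      simp only [inner_add_right, inner_smul_right, hab, ha1] at h2
      linear_combination h2
    subst hα
    rw [zero_smul, zero_add, hBsmul, ← hγdef] at h3
    have hβ : β = 0 := (mul_eq_zero.1 h3).resolve_right hγ
    simp [hβ]
  have hDsurj : Function.Surjective D := by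
    rintro ⟨y, t⟩
    set s := -⟪a, y⟫_ℂ with hsdef
    obtain ⟨z, hza, hzb, hz⟩ := exists_solution_orthogonal hc hs ha1 hb1 hab hκ ha hb hker
      (y := y - ⟪a, y⟫_ℂ • a - ⟪b, y⟫_ℂ • b)
      (by simp only [inner_sub_right, inner_smul_right, ha1, hab]; ring)
      (by simp only [inner_sub_right, inner_smul_right, hb1, hba]; ring)
    set r := ⟪b, B (z + t • a) - (νa : ℂ) • S (z + t • a)⟫_ℂ with hr
    refine ⟨(s, z + t • a + ((⟪b, y⟫_ℂ + s * ⟪b, S w0⟫_ℂ - r) / γ) • b), ?_⟩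
    rw [hDa]
    simp only
    rw [inner_sub_right, hBadd, hBsmul, ← hγdef, ← hr, div_mul_cancel₀ _ hγ, hLadd, hLb0, hLadd,
      hLa0, hz, inner_smul_right]
    refine Prod.ext ?_ ?_
    · simp only [hsdef]
      module
    · simp only [inner_add_right, inner_smul_right, hza, ha1, hab]; ring
  have hFD : fderiv ℂ F u0 ∘L .inr ℂ ℂ (ℂ × H) = D := by
    have h1 : HasFDerivAt F (fderiv ℂ F u0) u0 := (hFc.differentiable (by simp) u0).hasFDerivAt
    have h2 : HasFDerivAt (fun v : ℂ × H => ((0 : ℂ), v)) (.inr ℂ ℂ (ℂ × H)) ((νa : ℂ), w0) :=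
      hasFDerivAt_prodMk_right _ _
    have h3 := h1.comp ((νa : ℂ), w0) h2
    have h4 : HasFDerivAt (F ∘ fun v : ℂ × H => ((0 : ℂ), v)) D ((νa : ℂ), w0) := by
      let D₁ : ℂ × H →L[ℂ] H :=
        (1 - (κ : ℂ) • S) ∘L .snd ℂ ℂ H - (ContinuousLinearMap.fst ℂ ℂ H).smulRight a
      have hD₁ : ∀ v, D₁ v = v.2 - (κ : ℂ) • S v.2 - v.1 • a := fun v => rfl
      have e : (F ∘ fun v : ℂ × H => ((0 : ℂ), v)) = fun v : ℂ × H =>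
          ((D₁ v + (κ : ℂ) • B a) + (innerSL ℂ b (B v.2 - v.1 • S v.2 + (p : ℂ) • a)) • b,
            (innerSL ℂ a ∘L .snd ℂ ℂ H) v) := by
        funext v
        simp only [F, G, Function.comp_apply]
        refine Prod.ext ?_ rfl
        simp only [zero_mul, zero_sub, neg_smul, zero_smul, add_zero, hD₁, ← sub_eq_add_neg]
        abel
      rw [e]
      have hsm : HasFDerivAt (fun v : ℂ × H => v.1 • S v.2) ((νa : ℂ) • (S ∘L .snd ℂ ℂ H) +
          (ContinuousLinearMap.fst ℂ ℂ H).smulRight (S w0)) ((νa : ℂ), w0) := by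
        have := (ContinuousLinearMap.fst ℂ ℂ H).hasFDerivAt (x := ((νa : ℂ), w0)) |>.smul
          ((S ∘L .snd ℂ ℂ H).hasFDerivAt (x := ((νa : ℂ), w0)))
        exact this
      have hB2 : HasFDerivAt (fun v : ℂ × H => B v.2) (B ∘L .snd ℂ ℂ H) ((νa : ℂ), w0) :=
        (B ∘L .snd ℂ ℂ H).hasFDerivAt
      have hin := ((innerSL ℂ b).hasFDerivAt.comp ((νa : ℂ), w0)
        ((hB2.sub hsm).add_const ((p : ℂ) • a))).smul_const b
      have hfirst := ((D₁.hasFDerivAt (x := ((νa : ℂ), w0))).add_const ((κ : ℂ) • B a)).add hin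
      have := hfirst.prodMk ((innerSL ℂ a ∘L .snd ℂ ℂ H).hasFDerivAt (x := ((νa : ℂ), w0)))
      refine this.congr_fderiv (ContinuousLinearMap.ext fun v => ?_)
      rw [hDa]
      refine Prod.ext ?_ rfl
      simp [sub_sub, hD₁]
    exact h3.unique h4
  have hinv : (fderiv ℂ F u0 ∘L .inr ℂ ℂ (ℂ × H)).IsInvertible := by
    rw [hFD]
    exact ⟨ContinuousLinearEquiv.ofBijective D (LinearMap.ker_eq_bot.2 hDinj)
      (LinearMap.range_eq_top.2 hDsurj), by ext v <;> rfl⟩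
  have hF0 : F u0 = 0 := by
    refine Prod.ext ?_ hw0a
    have : innerSL ℂ b (G u0) = 0 := by
      show ⟪b, B w0 + ((0 : ℂ) * p - νa) • S w0 + (p : ℂ) • a⟫_ℂ = 0
      rw [inner_add_right, inner_smul_right _ a, hba, mul_zero, add_zero]
      refine Eq.trans ?_ hw0b
      congr 1; module
    show w0 - (κ : ℂ) • S w0 + (κ : ℂ) • B a - (νa : ℂ) • a +
      (0 : ℂ) • (G u0 - innerSL ℂ b (G u0) • b) + innerSL ℂ b (G u0) • b = 0
    rw [this, zero_smul, zero_smul, hw0L]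
    module
  have hFA : ContDiffAt ℂ ω F u0 := hFc.contDiffAt
  set ψ := hFA.implicitFunction (by simp) hinv with hψ
  have hψ0 : ψ 0 = ((νa : ℂ), w0) := hFA.implicitFunction_apply_self (by simp) hinv
  have hψA : AnalyticAt ℂ ψ 0 := (hFA.contDiffAt_implicitFunction (by simp) hinv).analyticAt
  have hψe : ∀ᶠ t in 𝓝 (0 : ℂ), F (t, ψ t) = 0 := by
    have := hFA.eventually_apply_implicitFunction (by simp) hinv
    rwa [hF0] at this
  have hof : AnalyticAt ℝ (fun t : ℝ => (t : ℂ)) 0 := Complex.ofRealCLM.analyticAt 0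
  have hψR : AnalyticAt ℝ (fun t : ℝ => ψ (t : ℂ)) 0 :=
    AnalyticAt.fun_comp (g := ψ) (by simpa using hψA.restrictScalars) hof
  have hψ1 : AnalyticAt ℝ (fun t : ℝ => (ψ (t : ℂ)).1) 0 :=
    AnalyticAt.fun_comp analyticAt_fst hψR
  have hψ2 : AnalyticAt ℝ (fun t : ℝ => (ψ (t : ℂ)).2) 0 :=
    AnalyticAt.fun_comp analyticAt_snd hψR
  set h : ℝ → H := fun t => (κ : ℂ) • a + t • (ψ (t : ℂ)).2 with hh
  have hhA : AnalyticAt ℝ h 0 := analyticAt_const.add (analyticAt_id.smul hψ2)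
  have hh0 : h 0 = (κ : ℂ) • a := by simp [hh]
  have heq : ∀ᶠ t : ℝ in 𝓝 0, h t - (κ : ℂ) • S (h t) + (t : ℂ) • B (h t) +
        ((t : ℂ) ^ 2 * p - t * (ψ t).1) • S (h t) = 0 := by
    have : Tendsto (fun t : ℝ => (t : ℂ)) (𝓝 0) (𝓝 0) := by
      simpa using hof.continuousAt.tendsto
    filter_upwards [this.eventually hψe] with t ht
    simp only [F, Prod.mk_eq_zero] at ht
    obtain ⟨ht1, -⟩ := ht
    set g := G (t, ψ t) with hg
    -- The `b`-component of `F = 0` says exactly that the modification of the equation vanishes.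
    have hbg : innerSL ℂ b g = 0 := by
      have := congrArg (fun x => ⟪b, x⟫_ℂ) ht1
      simp only [inner_add_right, inner_sub_right, inner_smul_right, inner_zero_right, hSb, hBab,
        hba, hb1, innerSL_apply_apply] at this
      rw [innerSL_apply_apply]
      linear_combination this
    rw [hbg] at ht1
    simp only [zero_smul, sub_zero, add_zero] at ht1
    have hcoe : ∀ x : H, t • x = (t : ℂ) • x := fun x => (Complex.coe_smul t x).symm
    have hSaa : S a = (κ : ℂ)⁻¹ • a := by
      rw [← ha, smul_smul, inv_mul_cancel₀ hκ0, one_smul, ha]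
    have key : h t - (κ : ℂ) • S (h t) + (t : ℂ) • B (h t) +
        ((t : ℂ) ^ 2 * p - t * (ψ t).1) • S (h t) = (t : ℂ) •
        ((ψ t).2 - (κ : ℂ) • S (ψ t).2 + (κ : ℂ) • B a - (ψ t).1 • a + (t : ℂ) • g) := by
      simp only [hh, hcoe, map_add, map_smul, hSaa, hg, G, smul_smul, smul_add, smul_sub,
        mul_inv_cancel₀ hκ0]
      match_scalars <;> field_simp <;> ring
    rw [key, ht1, smul_zero]
  have hSh : ∀ᶠ t : ℝ in 𝓝 0, S (h t) ≠ 0 := by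
    have hcont : ContinuousAt (fun t => S (h t)) 0 :=
      S.continuous.continuousAt.comp hhA.continuousAt
    refine hcont.eventually_ne ?_
    rw [hh0, map_smul, ha]
    rintro rfl
    simp at ha1
  refine ⟨fun t => (ψ (t : ℂ)).1.re, h, ?_, hhA, by simp [hψ0], hh0, ?_⟩
  · exact (Complex.reCLM.analyticAt _).fun_comp hψ1
  filter_upwards [heq, hSh] with t ht htS
  convert ht using 3
  rcases eq_or_ne t 0 with rfl | ht0
  · simp
  -- The implicit function is complex valued. Paired with `S h`, every other term of the equation is
  -- real, so for `t ≠ 0` its first component is real as well; at `t = 0` it is multiplied by `t`.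
  have him : (ψ (t : ℂ)).1.im = 0 := by
    have h1 := congrArg (fun x => ⟪S (h t), x⟫_ℂ) ht
    simp only [inner_add_right, inner_sub_right, inner_smul_right, inner_zero_right] at h1
    have r1 : (⟪S (h t), h t⟫_ℂ).im = 0 := by
      have : ⟪S (h t), h t⟫_ℂ = ⟪h t, S (h t)⟫_ℂ := hs _ _
      rw [← inner_conj_symm] at this
      exact Complex.conj_eq_iff_im.1 (by rw [inner_conj_symm, ← this, inner_conj_symm])
    have r2 : (⟪S (h t), B (h t)⟫_ℂ).im = 0 := by
      have := hSB (h t)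
      exact Complex.conj_eq_iff_im.1 (by rw [inner_conj_symm, this])
    have r3 : ⟪S (h t), S (h t)⟫_ℂ = ((‖S (h t)‖ ^ 2 : ℝ) : ℂ) := by
      rw [inner_self_eq_norm_sq_to_K]; push_cast; rfl
    rw [r3] at h1
    have h2 := congrArg Complex.im h1
    have e1 : ((t : ℂ) ^ 2 * p - t * (ψ t).1) = ((t ^ 2 * p : ℝ) : ℂ) - (t : ℂ) * (ψ t).1 := by
      push_cast; ring
    rw [e1] at h2
    simp only [Complex.add_im, Complex.sub_im, Complex.im_ofReal_mul, Complex.im_mul_ofReal, r1, r2,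
      Complex.ofReal_im, Complex.zero_im] at h2
    have : 0 < ‖S (h t)‖ := norm_pos_iff.2 htS
    have h3 : t * (ψ (t : ℂ)).1.im * ‖S (h t)‖ ^ 2 = 0 := by linarith
    rcases mul_eq_zero.1 h3 with h4 | h4
    · exact (mul_eq_zero.1 h4).resolve_left ht0
    · exact absurd h4 (by positivity)
  have : (ψ (t : ℂ)).1 = ((ψ (t : ℂ)).1.re : ℂ) := by
    apply Complex.ext <;> simp [him]
  rw [this]
  push_cast
  simp

end Branch

/-! ### The cell as a fundamental domain of the lattice. -/

section Lattice

variable {u₁ u₂ : Plane}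

/-- The linear coordinates `t ↦ t₀ u₁ + t₁ u₂`. -/
def cellEquiv (hd : det2 u₁ u₂ ≠ 0) : (Fin 2 → ℝ) ≃L[ℝ] Plane :=
  LinearEquiv.toContinuousLinearEquiv
    { toFun := fun t => t 0 • u₁ + t 1 • u₂
      map_add' := fun s t => by simp only [Pi.add_apply, add_smul]; abel
      map_smul' := fun c t => by simp only [Pi.smul_apply, smul_eq_mul, mul_smul, smul_add,
        RingHom.id_apply]
      invFun := fun x => ![det2 x u₂ / det2 u₁ u₂, det2 u₁ x / det2 u₁ u₂]
      left_inv := fun t => by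
        have hd' := hd
        simp only [det2] at hd'
        ext i
        fin_cases i
        · simp only [det2, PiLp.add_apply, PiLp.smul_apply, smul_eq_mul, Fin.zero_eta,
            Matrix.cons_val_zero]
          rw [div_eq_iff hd']; ring
        · simp only [det2, PiLp.add_apply, PiLp.smul_apply, smul_eq_mul, Fin.mk_one,
            Matrix.cons_val_one, Matrix.cons_val_fin_one]
          rw [div_eq_iff hd']; ring
      right_inv := fun x => by
        have hd' := hd
        simp only [det2] at hd'
        have hD := mul_inv_cancel₀ hd'
        ext i
        fin_cases i
        · simp only [det2, PiLp.add_apply, PiLp.smul_apply, smul_eq_mul, Fin.zero_eta,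
            Matrix.cons_val_zero, div_eq_mul_inv, Matrix.cons_val_one, Matrix.cons_val_fin_one]
          linear_combination x 0 * hD
        · simp only [det2, PiLp.add_apply, PiLp.smul_apply, smul_eq_mul, Fin.mk_one,
            Matrix.cons_val_zero, div_eq_mul_inv, Matrix.cons_val_one, Matrix.cons_val_fin_one]
          linear_combination x 1 * hD }

theorem cellEquiv_apply (hd : det2 u₁ u₂ ≠ 0) (t : Fin 2 → ℝ) :
    cellEquiv hd t = t 0 • u₁ + t 1 • u₂ := rfl

theorem mem_cell_iff (hd : det2 u₁ u₂ ≠ 0) (x : Plane) :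
    x ∈ cell u₁ u₂ ↔ ∀ i, (cellEquiv hd).symm x i ∈ Ioo (-(1 / 2) : ℝ) (1 / 2) := by
  constructor
  · rintro ⟨c₁, h₁, c₂, h₂, rfl⟩
    have : c₁ • u₁ + c₂ • u₂ = cellEquiv hd ![c₁, c₂] := rfl
    rw [this, ContinuousLinearEquiv.symm_apply_apply]
    intro i
    fin_cases i
    · exact h₁
    · exact h₂
  · intro h
    refine ⟨_, h 0, _, h 1, ?_⟩
    rw [← cellEquiv_apply hd, ContinuousLinearEquiv.apply_symm_apply]

theorem cell_eq_preimage (hd : det2 u₁ u₂ ≠ 0) :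
    cell u₁ u₂ = (cellEquiv hd).symm ⁻¹' (univ.pi fun _ => Ioo (-(1 / 2) : ℝ) (1 / 2)) := by
  ext x
  simp [mem_cell_iff hd]

theorem isOpen_cell (hd : det2 u₁ u₂ ≠ 0) : IsOpen (cell u₁ u₂) := by
  rw [cell_eq_preimage hd]
  exact (isOpen_set_pi finite_univ fun _ _ => isOpen_Ioo).preimage (cellEquiv hd).symm.continuous

theorem measurableSet_cell (hd : det2 u₁ u₂ ≠ 0) : MeasurableSet (cell u₁ u₂) :=
  (isOpen_cell hd).measurableSet

theorem exists_isCompact_cell_subset (hd : det2 u₁ u₂ ≠ 0) :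
    ∃ K : Set Plane, IsCompact K ∧ cell u₁ u₂ ⊆ K := by
  refine ⟨cellEquiv hd '' (univ.pi fun _ => Icc (-(1 / 2) : ℝ) (1 / 2)),
    (isCompact_univ_pi fun _ => isCompact_Icc).image (cellEquiv hd).continuous, fun x hx => ?_⟩
  rw [mem_cell_iff hd] at hx
  exact ⟨(cellEquiv hd).symm x, fun i _ => Ioo_subset_Icc_self (hx i),
    (cellEquiv hd).apply_symm_apply x⟩

theorem volume_cell_lt_top (hd : det2 u₁ u₂ ≠ 0) : volume (cell u₁ u₂) < ⊤ := by
  obtain ⟨K, hK, hsub⟩ := exists_isCompact_cell_subset hd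
  exact (measure_mono hsub).trans_lt hK.measure_lt_top

theorem volume_cell_pos (hd : det2 u₁ u₂ ≠ 0) : 0 < volume (cell u₁ u₂) :=
  (isOpen_cell hd).measure_pos _ ⟨0, (mem_cell_iff hd 0).2 fun i => by simp⟩

/-- The area of the cell. -/
def cellArea (u₁ u₂ : Plane) : ℝ := (volume (cell u₁ u₂)).toReal

theorem cellArea_pos (hd : det2 u₁ u₂ ≠ 0) : 0 < cellArea u₁ u₂ :=
  ENNReal.toReal_pos (volume_cell_pos hd).ne' (volume_cell_lt_top hd).ne

/-- The lattice vector with integer coordinates `m`. -/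
def latticeVec (u₁ u₂ : Plane) : (Fin 2 → ℤ) →+ Plane where
  toFun m := (m 0 : ℝ) • u₁ + (m 1 : ℝ) • u₂
  map_zero' := by simp
  map_add' m n := by simp only [Pi.add_apply, Int.cast_add, add_smul]; abel

theorem latticeVec_apply (m : Fin 2 → ℤ) :
    latticeVec u₁ u₂ m = (m 0 : ℝ) • u₁ + (m 1 : ℝ) • u₂ := rfl

/-- The lattice `ℤ u₁ ⊕ ℤ u₂`. -/
def lattice (u₁ u₂ : Plane) : AddSubgroup Plane := (latticeVec u₁ u₂).range

instance : Countable (lattice u₁ u₂) :=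
  (countable_range (latticeVec u₁ u₂)).to_subtype

theorem symm_latticeVec (hd : det2 u₁ u₂ ≠ 0) (m : Fin 2 → ℤ) (i : Fin 2) :
    (cellEquiv hd).symm (latticeVec u₁ u₂ m) i = m i := by
  have : latticeVec u₁ u₂ m = cellEquiv hd (fun i => (m i : ℝ)) := rfl
  rw [this, ContinuousLinearEquiv.symm_apply_apply]

/-- The index of the lattice cell containing a point. -/
def cellIndex (hd : det2 u₁ u₂ ≠ 0) (x : Plane) : Fin 2 → ℤ :=
  fun i => ⌊(cellEquiv hd).symm x i + 1 / 2⌋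

/-- Translation of a point to the half-open fundamental cell. -/
def foldCell (hd : det2 u₁ u₂ ≠ 0) (x : Plane) : Plane :=
  x - latticeVec u₁ u₂ (cellIndex hd x)

theorem symm_foldCell (hd : det2 u₁ u₂ ≠ 0) (x : Plane) (i : Fin 2) :
    (cellEquiv hd).symm (foldCell hd x) i = Int.fract ((cellEquiv hd).symm x i + 1 / 2) - 1 / 2 := by
  rw [foldCell, map_sub, Pi.sub_apply, symm_latticeVec, cellIndex, Int.fract]
  ring

theorem foldCell_add_latticeVec (hd : det2 u₁ u₂ ≠ 0) (x : Plane) (m : Fin 2 → ℤ) :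
    foldCell hd (x + latticeVec u₁ u₂ m) = foldCell hd x := by
  apply (cellEquiv hd).symm.injective
  ext i
  rw [symm_foldCell, symm_foldCell, map_add, Pi.add_apply, symm_latticeVec,
    add_right_comm, Int.fract_add_intCast]

theorem foldCell_of_mem (hd : det2 u₁ u₂ ≠ 0) {x : Plane} (hx : x ∈ cell u₁ u₂) :
    foldCell hd x = x := by
  rw [mem_cell_iff hd] at hx
  apply (cellEquiv hd).symm.injective
  ext i
  rw [symm_foldCell, Int.fract_eq_self.2]
  · ring
  · have := hx i
    constructor <;> linarith [this.1, this.2]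

theorem measurable_foldCell (hd : det2 u₁ u₂ ≠ 0) : Measurable (foldCell hd) := by
  have h : ∀ i, Measurable fun x => cellIndex hd x i := fun i => by
    have : Measurable fun x => (cellEquiv hd).symm x i :=
      ((continuous_apply i).comp (cellEquiv hd).symm.continuous).measurable
    exact (this.add_const _).floor
  refine measurable_id.sub ?_
  have h' : ∀ i, Measurable fun x => (cellIndex hd x i : ℝ) := fun i =>
    (measurable_from_top (f := fun n : ℤ => (n : ℝ))).comp (h i)
  exact ((h' 0).smul_const u₁).add ((h' 1).smul_const u₂)

theorem isAddFundamentalDomain_cell (hd : det2 u₁ u₂ ≠ 0) :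
    IsAddFundamentalDomain (lattice u₁ u₂) (cell u₁ u₂) volume := by
  refine IsAddFundamentalDomain.mk'' (measurableSet_cell hd).nullMeasurableSet ?_ ?_
    fun g => (measurePreserving_vadd g volume).quasiMeasurePreserving
  -- A point missed by all translates of the open cell lies on one of countably many lines, each a
  -- translate of the kernel of a nonzero functional.
  · have hnull : ∀ (i : Fin 2) (n : ℤ), ∀ᵐ x : Plane, (cellEquiv hd).symm x i + 1 / 2 ≠ n := by
      intro i n
      let f : Plane →L[ℝ] ℝ := (ContinuousLinearMap.proj i) ∘L
        ((cellEquiv hd).symm : Plane →L[ℝ] (Fin 2 → ℝ))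
      have hf : ∀ x, f x = (cellEquiv hd).symm x i := fun x => rfl
      have hne : (LinearMap.ker (f : Plane →ₗ[ℝ] ℝ)) ≠ ⊤ := by
        intro htop
        have : cellEquiv hd (Pi.single i 1) ∈ LinearMap.ker (f : Plane →ₗ[ℝ] ℝ) := by
          rw [htop]; trivial
        rw [LinearMap.mem_ker, ContinuousLinearMap.coe_coe, hf,
          ContinuousLinearEquiv.symm_apply_apply] at this
        simp at this
      have h0 := Measure.addHaar_submodule volume _ hne
      set y : Plane := cellEquiv hd (Pi.single i ((n : ℝ) - 1 / 2)) with hy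
      have hfy : f y = n - 1 / 2 := by
        rw [hf, hy, ContinuousLinearEquiv.symm_apply_apply]; simp
      rw [ae_iff]
      have hset : {x : Plane | ¬ ((cellEquiv hd).symm x i + 1 / 2 ≠ n)} =
          (fun x => x + -y) ⁻¹' (LinearMap.ker (f : Plane →ₗ[ℝ] ℝ) : Set Plane) := by
        ext x
        simp only [mem_ofPred_eq, not_not, mem_preimage, SetLike.mem_coe, LinearMap.mem_ker,
          ContinuousLinearMap.coe_coe, map_add, map_neg, hfy, ← hf]
        constructor <;> intro h <;> linarith
      rw [hset, measure_preimage_add_right]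
      exact h0
    have hnull' : ∀ᵐ x : Plane, ∀ (i : Fin 2) (n : ℤ), (cellEquiv hd).symm x i + 1 / 2 ≠ n :=
      ae_all_iff.2 fun i => ae_all_iff.2 (hnull i)
    filter_upwards [hnull'] with x hx
    refine ⟨⟨-latticeVec u₁ u₂ (cellIndex hd x), neg_mem ⟨_, rfl⟩⟩, ?_⟩
    have : (⟨-latticeVec u₁ u₂ (cellIndex hd x), neg_mem ⟨_, rfl⟩⟩ : lattice u₁ u₂) +ᵥ x =
        foldCell hd x := by
      show -latticeVec u₁ u₂ (cellIndex hd x) + x = _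
      rw [foldCell]; abel
    rw [this, mem_cell_iff hd]
    intro i
    rw [symm_foldCell]
    have h1 := Int.fract_lt_one ((cellEquiv hd).symm x i + 1 / 2)
    have h2 : 0 < Int.fract ((cellEquiv hd).symm x i + 1 / 2) := by
      refine lt_of_le_of_ne (Int.fract_nonneg _) fun h => ?_
      rw [eq_comm, Int.fract_eq_iff] at h
      obtain ⟨_, _, n, hn⟩ := h
      rw [sub_zero] at hn
      exact hx i n hn
    constructor <;> linarith
  · rintro ⟨_, m, rfl⟩ hm
    refine Disjoint.aedisjoint (disjoint_left.2 ?_)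
    rintro _ ⟨x, hx, rfl⟩ hy
    apply hm
    simp only [AddSubgroup.vadd_def, vadd_eq_add] at hy
    rw [mem_cell_iff hd] at hx hy
    have : m = 0 := by
      ext i
      have h1 := hx i
      have h2 := hy i
      rw [map_add, Pi.add_apply, symm_latticeVec] at h2
      have h3 : (m i : ℝ) < 1 := by linarith [h1.1, h2.2]
      have h4 : (-1 : ℝ) < m i := by linarith [h1.2, h2.1]
      have h5 : m i < 1 := by exact_mod_cast h3
      have h6 : -1 < m i := by exact_mod_cast h4
      simp only [Pi.zero_apply]
      omega
    subst this
    ext1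
    simp

end Lattice

/-! ### Transport of the cell to the standard torus. -/

section Torus

/-- The Haar probability measure on the unit circle. -/
@[reducible] def circleMeasureSpace : MeasureSpace UnitAddCircle := ⟨AddCircle.haarAddCircle⟩

attribute [local instance] circleMeasureSpace

variable {u₁ u₂ : Plane}

/-- The representative in the cell of a point of the torus. -/
def torusRep (hd : det2 u₁ u₂ ≠ 0) (s : UnitAddTorus (Fin 2)) : Plane :=
  cellEquiv hd (UnitAddTorus.measurableEquivPiIoc (fun _ => (-(1 / 2) : ℝ)) s).1

/-- Gives access to the completeness of the characters of the torus. The constant is the scaling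
factor of the linear coordinates; only that it is finite and nonzero matters. -/
theorem exists_measurePreserving_torusRep (hd : det2 u₁ u₂ ≠ 0) :
    ∃ c : ENNReal, c ≠ 0 ∧ c ≠ ⊤ ∧
      MeasurePreserving (torusRep hd) volume (c • volume.restrict (cell u₁ u₂)) := by
  have hmp := UnitAddTorus.measurePreserving_equivPiIoc (fun _ : Fin 2 => (-(1 / 2) : ℝ))
  have hbox : MeasurableSet {x : Fin 2 → ℝ | ∀ i, x i ∈ Ioc (-(1 / 2) : ℝ) (-(1 / 2) + 1)} :=
    MeasurableSet.univ_pi' fun _ => measurableSet_Ioc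
  have h2 := measurePreserving_subtype_coe (μa := (volume : Measure (Fin 2 → ℝ))) hbox
  have hE : (Measure.map (cellEquiv hd) (volume : Measure (Fin 2 → ℝ))).IsAddHaarMeasure :=
    (cellEquiv hd).isAddHaarMeasure_map volume
  obtain ⟨c, hc0, hct, hc⟩ : ∃ c : ENNReal, c ≠ 0 ∧ c ≠ ⊤ ∧
      Measure.map (cellEquiv hd) (volume : Measure (Fin 2 → ℝ)) = c • volume := by
    refine ⟨_, ?_, ?_, Measure.isAddLeftInvariant_eq_smul _ _⟩
    · exact_mod_cast (Measure.addHaarScalarFactor_pos_of_isAddHaarMeasure _ _).ne'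
    · exact ENNReal.coe_ne_top
  refine ⟨c, hc0, hct, ?_⟩
  have h3 : MeasurePreserving (cellEquiv hd) volume (c • (volume : Measure Plane)) :=
    ⟨(cellEquiv hd).continuous.measurable, hc⟩
  have h4 := h3.restrict_preimage (measurableSet_cell hd)
  rw [Measure.restrict_smul] at h4
  have hpre : (cellEquiv hd) ⁻¹' cell u₁ u₂ = univ.pi fun _ => Ioo (-(1 / 2) : ℝ) (1 / 2) := by
    rw [cell_eq_preimage hd, ← preimage_comp]
    simp
  -- The torus is represented by a half-open box and the cell is open; the two differ by a null set.
  have hae : (volume : Measure (Fin 2 → ℝ)).restrict ((cellEquiv hd) ⁻¹' cell u₁ u₂) =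
      volume.restrict {x : Fin 2 → ℝ | ∀ i, x i ∈ Ioc (-(1 / 2) : ℝ) (-(1 / 2) + 1)} := by
    have e : {x : Fin 2 → ℝ | ∀ i, x i ∈ Ioc (-(1 / 2) : ℝ) (-(1 / 2) + 1)} =
        univ.pi fun _ => Ioc (-(1 / 2) : ℝ) (1 / 2) := by
      ext x
      norm_num [Set.mem_pi]
    rw [hpre, e]
    refine Measure.restrict_congr_set ?_
    rw [volume_pi]
    exact Measure.univ_pi_Ioo_ae_eq_Icc.trans Measure.univ_pi_Ioc_ae_eq_Icc.symm
  rw [hae] at h4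
  exact (h4.comp h2).comp hmp

theorem torusRep_coe (hd : det2 u₁ u₂ ≠ 0) (s : UnitAddTorus (Fin 2)) :
    (fun i => (((cellEquiv hd).symm (torusRep hd s) i : ℝ) : UnitAddCircle)) = s := by
  rw [torusRep, ContinuousLinearEquiv.symm_apply_apply,
    ← UnitAddTorus.coe_symm_measurableEquivPiIoc_apply, MeasurableEquiv.symm_apply_apply]

end Torus

/-! ### Algebra of plane waves. -/

section PlaneWave

theorem norm_planeWave (k x : Plane) : ‖planeWave k x‖ = 1 := by
  rw [planeWave, mul_comm, Complex.norm_exp_ofReal_mul_I]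

theorem planeWave_ne_zero (k x : Plane) : planeWave k x ≠ 0 := Complex.exp_ne_zero _

theorem planeWave_add_left (k l x : Plane) :
    planeWave (k + l) x = planeWave k x * planeWave l x := by
  rw [planeWave, planeWave, planeWave, ← Complex.exp_add, inner_add_left]
  push_cast; ring_nf

theorem planeWave_add_right (k x y : Plane) :
    planeWave k (x + y) = planeWave k x * planeWave k y := by
  rw [planeWave, planeWave, planeWave, ← Complex.exp_add, inner_add_right]
  push_cast; ring_nf

theorem planeWave_zero_left (x : Plane) : planeWave 0 x = 1 := by simp [planeWave]

theorem planeWave_zero_right (k : Plane) : planeWave k 0 = 1 := by simp [planeWave]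

theorem conj_planeWave (k x : Plane) : conj (planeWave k x) = planeWave (-k) x := by
  rw [planeWave, planeWave, ← Complex.exp_conj, inner_neg_left]
  simp

theorem planeWave_neg_right (k x : Plane) : planeWave k (-x) = planeWave (-k) x := by
  rw [planeWave, planeWave, inner_neg_left, inner_neg_right]

theorem planeWave_neg_mul (k x : Plane) : planeWave (-k) x * planeWave k x = 1 := by
  rw [← planeWave_add_left, neg_add_cancel, planeWave_zero_left]

theorem contDiff_planeWave (k : Plane) : ContDiff ℝ ∞ (planeWave k) := by
  unfold planeWave
  have h : ContDiff ℝ ∞ fun x : Plane => ((inner ℝ k x : ℝ) : ℂ) :=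
    (Complex.ofRealCLM ∘L innerSL ℝ k).contDiff
  exact (contDiff_const.mul h).cexp

theorem continuous_planeWave (k : Plane) : Continuous (planeWave k) :=
  (contDiff_planeWave k).continuous

end PlaneWave

/-! ### The Fourier basis of the square integrable functions on the cell. -/

section CellSpace

variable {u₁ u₂ : Plane}

/-- The Hilbert space of square integrable functions on the cell. -/
abbrev L2Cell (u₁ u₂ : Plane) : Type := Lp ℂ 2 (volume.restrict (cell u₁ u₂))

instance instIsFiniteMeasureCell : IsFiniteMeasure (volume.restrict (cell u₁ u₂)) := by
  refine ⟨?_⟩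
  rw [Measure.restrict_apply_univ]
  have hK : IsCompact ((fun c : ℝ × ℝ => c.1 • u₁ + c.2 • u₂) ''
      (Icc (-(1 / 2) : ℝ) (1 / 2) ×ˢ Icc (-(1 / 2) : ℝ) (1 / 2))) :=
    (isCompact_Icc.prod isCompact_Icc).image (by fun_prop)
  refine (measure_mono ?_).trans_lt hK.measure_lt_top
  rintro _ ⟨c₁, h₁, c₂, h₂, rfl⟩
  exact ⟨(c₁, c₂), ⟨Ioo_subset_Icc_self h₁, Ioo_subset_Icc_self h₂⟩, rfl⟩

theorem inner_eq_integral (f g : L2Cell u₁ u₂) :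
    ⟪f, g⟫_ℂ = ∫ x in cell u₁ u₂, conj (f x) * g x := by
  rw [L2.inner_def]
  refine integral_congr_ae (Eventually.of_forall fun x => ?_)
  simp only [RCLike.inner_apply]
  ring

theorem inner_toLp (f : L2Cell u₁ u₂) {g : Plane → ℂ} (hg : MemLp g 2 (volume.restrict (cell u₁ u₂))) :
    ⟪hg.toLp g, f⟫_ℂ = ∫ x in cell u₁ u₂, conj (g x) * f x := by
  rw [inner_eq_integral]
  refine integral_congr_ae ?_
  filter_upwards [hg.coeFn_toLp] with x hx
  rw [hx]

/-- The dual lattice vector with integer coordinates `m`. -/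
def freq (u₁ u₂ : Plane) (m : Fin 2 → ℤ) : Plane :=
  (m 0 : ℝ) • dualFst u₁ u₂ + (m 1 : ℝ) • dualSnd u₁ u₂

theorem freq_zero : freq u₁ u₂ 0 = 0 := by simp [freq]

theorem freq_add (m n : Fin 2 → ℤ) : freq u₁ u₂ (m + n) = freq u₁ u₂ m + freq u₁ u₂ n := by
  simp only [freq, Pi.add_apply, Int.cast_add, add_smul]; abel

theorem freq_neg (m : Fin 2 → ℤ) : freq u₁ u₂ (-m) = -freq u₁ u₂ m := by
  simp only [freq, Pi.neg_apply, Int.cast_neg, neg_smul]; abel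

theorem inner_freq (hd : det2 u₁ u₂ ≠ 0) (m : Fin 2 → ℤ) (t : Fin 2 → ℝ) :
    inner ℝ (freq u₁ u₂ m) (cellEquiv hd t) = 2 * Real.pi * (m 0 * t 0 + m 1 * t 1) := by
  obtain ⟨h1, h2, h3, h4⟩ := dual_inner hd
  rw [freq, cellEquiv_apply]
  simp only [inner_add_left, inner_add_right, inner_smul_left, inner_smul_right, h1, h2, h3, h4,
    conj_trivial]
  ring

theorem planeWave_freq_eq_mFourier (hd : det2 u₁ u₂ ≠ 0) (m : Fin 2 → ℤ) (t : Fin 2 → ℝ) :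
    planeWave (freq u₁ u₂ m) (cellEquiv hd t) =
      UnitAddTorus.mFourier m (fun i => (t i : UnitAddCircle)) := by
  rw [planeWave, inner_freq]
  simp only [UnitAddTorus.mFourier, ContinuousMap.coe_mk, Fin.prod_univ_two, fourier_coe_apply,
    ← Complex.exp_add]
  congr 1
  push_cast
  ring

theorem planeWave_freq_latticeVec (hd : det2 u₁ u₂ ≠ 0) (m n : Fin 2 → ℤ) :
    planeWave (freq u₁ u₂ m) (latticeVec u₁ u₂ n) = 1 := by
  have : latticeVec u₁ u₂ n = cellEquiv hd (fun i => (n i : ℝ)) := rfl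
  rw [this, planeWave, inner_freq, Complex.exp_eq_one_iff]
  exact ⟨m 0 * n 0 + m 1 * n 1, by push_cast; ring⟩

/-- The normalized exponential with frequency `m` on the cell. -/
def fourierFun (u₁ u₂ : Plane) (m : Fin 2 → ℤ) (x : Plane) : ℂ :=
  (((Real.sqrt (cellArea u₁ u₂))⁻¹ : ℝ) : ℂ) * planeWave (freq u₁ u₂ m) x

theorem continuous_fourierFun (m : Fin 2 → ℤ) : Continuous (fourierFun u₁ u₂ m) :=
  continuous_const.mul (continuous_planeWave _)

theorem norm_fourierFun (m : Fin 2 → ℤ) (x : Plane) :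
    ‖fourierFun u₁ u₂ m x‖ = (Real.sqrt (cellArea u₁ u₂))⁻¹ := by
  rw [fourierFun, norm_mul, norm_planeWave, mul_one, Complex.norm_real, Real.norm_of_nonneg]
  positivity

theorem memLp_of_continuous_bounded {f : Plane → ℂ} (hf : Continuous f) {C : ℝ}
    (hC : ∀ x, ‖f x‖ ≤ C) : MemLp f 2 (volume.restrict (cell u₁ u₂)) :=
  MemLp.of_bound hf.aestronglyMeasurable C (Eventually.of_forall hC)

theorem memLp_fourierFun (m : Fin 2 → ℤ) :
    MemLp (fourierFun u₁ u₂ m) 2 (volume.restrict (cell u₁ u₂)) :=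
  memLp_of_continuous_bounded (continuous_fourierFun m) fun x => (norm_fourierFun m x).le

/-- The class in `L²` of the normalized exponential. -/
def fourierVec (u₁ u₂ : Plane) (m : Fin 2 → ℤ) : L2Cell u₁ u₂ := (memLp_fourierFun m).toLp _

attribute [local instance] circleMeasureSpace

theorem integral_mFourier (k : Fin 2 → ℤ) :
    ∫ s : UnitAddTorus (Fin 2), UnitAddTorus.mFourier k s = if k = 0 then 1 else 0 := by
  have h := (orthonormal_iff_ite.1 (UnitAddTorus.orthonormal_mFourier (d := Fin 2))) 0 k
  rw [ContinuousMap.inner_toLp] at h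
  simp only [UnitAddTorus.mFourier_zero] at h
  have e : (if k = 0 then (1 : ℂ) else 0) = if 0 = k then 1 else 0 := by
    simp only [eq_comm]
  rw [e, ← h]
  refine integral_congr_ae (Eventually.of_forall fun s => ?_)
  simp

theorem exists_integral_torusRep (hd : det2 u₁ u₂ ≠ 0) :
    ∃ c : ℂ, c ≠ 0 ∧ ∀ g : Plane → ℂ, AEStronglyMeasurable g (volume.restrict (cell u₁ u₂)) →
      ∫ s : UnitAddTorus (Fin 2), g (torusRep hd s) = c * ∫ x in cell u₁ u₂, g x := by
  obtain ⟨c, hc0, hct, hmp⟩ := exists_measurePreserving_torusRep hd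
  refine ⟨(c.toReal : ℂ), Complex.ofReal_ne_zero.2 (ENNReal.toReal_ne_zero.2 ⟨hc0, hct⟩),
    fun g hg => ?_⟩
  have hg' : AEStronglyMeasurable g (Measure.map (torusRep hd) volume) := by
    rw [hmp.map_eq]; exact hg.smul_measure c
  rw [← integral_map hmp.measurable.aemeasurable hg', hmp.map_eq, integral_smul_measure,
    Complex.real_smul]

theorem integral_planeWave_freq (hd : det2 u₁ u₂ ≠ 0) (k : Fin 2 → ℤ) :
    ∫ x in cell u₁ u₂, planeWave (freq u₁ u₂ k) x = if k = 0 then (cellArea u₁ u₂ : ℂ) else 0 := by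
  obtain ⟨c, hc0, hc⟩ := exists_integral_torusRep hd
  have key : ∀ k, c * ∫ x in cell u₁ u₂, planeWave (freq u₁ u₂ k) x =
      if k = 0 then 1 else 0 := fun k => by
    rw [← hc _ (continuous_planeWave _).aestronglyMeasurable, ← integral_mFourier k]
    refine integral_congr_ae (Eventually.of_forall fun s => ?_)
    simp only
    conv_rhs => rw [← torusRep_coe hd s]
    rw [← planeWave_freq_eq_mFourier hd, ContinuousLinearEquiv.apply_symm_apply]
  split_ifs with h
  · subst h
    simp only [freq_zero, planeWave_zero_left]
    simp [cellArea, Measure.real]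
  · have := key k
    rw [if_neg h] at this
    exact (mul_eq_zero.1 this).resolve_left hc0

theorem orthonormal_fourierVec (hd : det2 u₁ u₂ ≠ 0) : Orthonormal ℂ (fourierVec u₁ u₂) := by
  rw [orthonormal_iff_ite]
  intro m n
  have hA := cellArea_pos hd
  rw [fourierVec, inner_toLp]
  have h1 : ∫ x in cell u₁ u₂, conj (fourierFun u₁ u₂ m x) * fourierVec u₁ u₂ n x =
      ∫ x in cell u₁ u₂, ((cellArea u₁ u₂ : ℂ))⁻¹ * planeWave (freq u₁ u₂ (n - m)) x := by
    refine integral_congr_ae ?_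
    filter_upwards [(memLp_fourierFun (u₁ := u₁) (u₂ := u₂) n).coeFn_toLp] with x hx
    rw [fourierVec, hx, fourierFun, fourierFun, map_mul, Complex.conj_ofReal, conj_planeWave,
      sub_eq_add_neg, freq_add, freq_neg, planeWave_add_left]
    have : ((cellArea u₁ u₂ : ℂ))⁻¹ = (((Real.sqrt (cellArea u₁ u₂))⁻¹ : ℝ) : ℂ) *
        (((Real.sqrt (cellArea u₁ u₂))⁻¹ : ℝ) : ℂ) := by
      rw [← Complex.ofReal_mul, ← mul_inv, Real.mul_self_sqrt hA.le, Complex.ofReal_inv]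
    rw [this]; ring
  rw [h1, integral_const_mul, integral_planeWave_freq hd]
  have : (cellArea u₁ u₂ : ℂ) ≠ 0 := Complex.ofReal_ne_zero.2 hA.ne'
  by_cases h : m = n
  · subst h; simp [this]
  · rw [if_neg h, if_neg (by rwa [sub_eq_zero, eq_comm]), mul_zero]

/-- Pulled back to the torus, `f` has vanishing Fourier coefficients, so it is zero there, and the
transport preserves null sets up to a nonzero factor. -/
theorem eq_zero_of_inner_fourierVec (hd : det2 u₁ u₂ ≠ 0) (f : L2Cell u₁ u₂)
    (h : ∀ m, ⟪fourierVec u₁ u₂ m, f⟫_ℂ = 0) : f = 0 := by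
  obtain ⟨c, hc0, hct, hmp⟩ := exists_measurePreserving_torusRep hd
  obtain ⟨c', hc0', hc'⟩ := exists_integral_torusRep hd
  have hF : MemLp (f ∘ torusRep hd) 2 volume :=
    ((Lp.memLp f).smul_measure hct).comp_measurePreserving hmp
  have hcoef : ∀ m, UnitAddTorus.mFourierCoeff (f ∘ torusRep hd) m = 0 := fun m => by
    have e : ∀ s, UnitAddTorus.mFourier (-m) s • (f ∘ torusRep hd) s =
        (fun x => conj (planeWave (freq u₁ u₂ m) x) * f x) (torusRep hd s) := fun s => by
      simp only [Function.comp_apply, smul_eq_mul]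
      congr 1
      conv_lhs => rw [← torusRep_coe hd s]
      rw [← planeWave_freq_eq_mFourier hd, ContinuousLinearEquiv.apply_symm_apply, conj_planeWave,
        freq_neg]
    have hmeas : AEStronglyMeasurable (fun x => conj (planeWave (freq u₁ u₂ m) x) * f x)
        (volume.restrict (cell u₁ u₂)) :=
      (Complex.continuous_conj.comp (continuous_planeWave _)).aestronglyMeasurable.mul
        (Lp.aestronglyMeasurable f)
    have hcell : ∫ x in cell u₁ u₂, conj (planeWave (freq u₁ u₂ m) x) * f x = 0 := by
      have hm := h m
      rw [fourierVec, inner_toLp] at hm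
      simp only [fourierFun, map_mul, Complex.conj_ofReal, mul_assoc] at hm
      rw [integral_const_mul] at hm
      have hA : (((Real.sqrt (cellArea u₁ u₂))⁻¹ : ℝ) : ℂ) ≠ 0 :=
        Complex.ofReal_ne_zero.2 (inv_ne_zero (Real.sqrt_pos.2 (cellArea_pos hd)).ne')
      exact (mul_eq_zero.1 hm).resolve_left hA
    have htor := hc' _ hmeas
    rw [hcell, mul_zero] at htor
    exact (integral_congr_ae (Eventually.of_forall e)).trans htor
  have h0 : hF.toLp _ = 0 := by
    refine UnitAddTorus.mFourierBasis.repr.injective (lp.ext (funext fun m => ?_))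
    rw [UnitAddTorus.mFourierBasis_repr, map_zero]
    have : UnitAddTorus.mFourierCoeff (hF.toLp _) m =
        UnitAddTorus.mFourierCoeff (f ∘ torusRep hd) m := by
      refine integral_congr_ae ?_
      filter_upwards [hF.coeFn_toLp] with s hs
      rw [hs]
    rw [this, hcoef]; rfl
  have h1 : ∀ᵐ s, f (torusRep hd s) = 0 := by
    filter_upwards [hF.coeFn_toLp, Lp.coeFn_zero ℂ 2 (volume : Measure (UnitAddTorus (Fin 2)))]
      with s hs1 hs2
    rw [h0] at hs1
    have : (f ∘ torusRep hd) s = 0 := by rw [← hs1, hs2]; rfl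
    exact this
  have hmeas : MeasurableSet {x | f x = 0} :=
    (Lp.stronglyMeasurable f).measurable (measurableSet_singleton 0)
  rw [← ae_map_iff (p := fun x => f x = 0) hmp.measurable.aemeasurable hmeas, hmp.map_eq,
    Measure.ae_ennreal_smul_measure_iff hc0] at h1
  exact (Lp.eq_zero_iff_ae_eq_zero).2 h1

/-- The Fourier basis of `L²` of the cell. -/
def fourierBasis (hd : det2 u₁ u₂ ≠ 0) : HilbertBasis (Fin 2 → ℤ) ℂ (L2Cell u₁ u₂) :=
  HilbertBasis.mkOfOrthogonalEqBot (orthonormal_fourierVec hd) (by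
    rw [Submodule.eq_bot_iff]
    intro f hf
    refine eq_zero_of_inner_fourierVec hd f fun m => ?_
    exact hf _ (Submodule.subset_span ⟨m, rfl⟩))

theorem fourierBasis_apply (hd : det2 u₁ u₂ ≠ 0) (m : Fin 2 → ℤ) :
    fourierBasis hd m = fourierVec u₁ u₂ m := by
  rw [fourierBasis, HilbertBasis.coe_mkOfOrthogonalEqBot]

theorem fourierBasis_repr (hd : det2 u₁ u₂ ≠ 0) (f : L2Cell u₁ u₂) (m : Fin 2 → ℤ) :
    (fourierBasis hd).repr f m = ∫ x in cell u₁ u₂, conj (fourierFun u₁ u₂ m x) * f x := by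
  rw [HilbertBasis.repr_apply_apply, fourierBasis_apply, fourierVec, inner_toLp]

/-- Multiplication by a bounded continuous function on `L²` of the cell. -/
def mulOp (u₁ u₂ : Plane) : (Plane →ᵇ ℂ) →L[ℂ] L2Cell u₁ u₂ →L[ℂ] L2Cell u₁ u₂ :=
  ((ContinuousLinearMap.mul ℂ ℂ).holderL (volume.restrict (cell u₁ u₂)) ⊤ 2 2) ∘L
    (BoundedContinuousFunction.toLp ⊤ (volume.restrict (cell u₁ u₂)) ℂ)

theorem coeFn_mulOp (φ : Plane →ᵇ ℂ) (f : L2Cell u₁ u₂) :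
    mulOp u₁ u₂ φ f =ᵐ[volume.restrict (cell u₁ u₂)] fun x => φ x * f x := by
  have h1 := (ContinuousLinearMap.mul ℂ ℂ).coeFn_holder (r := 2)
    (BoundedContinuousFunction.toLp ⊤ (volume.restrict (cell u₁ u₂)) ℂ φ) f
  have h2 := BoundedContinuousFunction.coeFn_toLp ⊤ (volume.restrict (cell u₁ u₂)) ℂ φ
  filter_upwards [h1, h2] with x h1 h2
  rw [h2] at h1
  exact h1

end CellSpace

/-! ### Quasi-periodic extension and unfolding of integrals. -/

section Extension

variable {u₁ u₂ : Plane}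

/-- The quasi-periodic function with quasi-momentum `k` whose periodic part is given on the cell. -/
def quasiExt (hd : det2 u₁ u₂ ≠ 0) (k : Plane) (F : L2Cell u₁ u₂) (x : Plane) : ℂ :=
  planeWave k x * F (foldCell hd x)

theorem measurable_quasiExt (hd : det2 u₁ u₂ ≠ 0) (k : Plane) (F : L2Cell u₁ u₂) :
    Measurable (quasiExt hd k F) :=
  (continuous_planeWave k).measurable.mul
    ((Lp.stronglyMeasurable F).measurable.comp (measurable_foldCell hd))

theorem quasiExt_of_mem (hd : det2 u₁ u₂ ≠ 0) (k : Plane) (F : L2Cell u₁ u₂) {x : Plane}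
    (hx : x ∈ cell u₁ u₂) : quasiExt hd k F x = planeWave k x * F x := by
  rw [quasiExt, foldCell_of_mem hd hx]

theorem quasiExt_add_latticeVec (hd : det2 u₁ u₂ ≠ 0) (k : Plane) (F : L2Cell u₁ u₂) (x : Plane)
    (m : Fin 2 → ℤ) : quasiExt hd k F (x + latticeVec u₁ u₂ m) =
      planeWave k (latticeVec u₁ u₂ m) * quasiExt hd k F x := by
  rw [quasiExt, quasiExt, foldCell_add_latticeVec, planeWave_add_right]; ring

theorem latticeVec_fst : latticeVec u₁ u₂ ![1, 0] = u₁ := by simp [latticeVec_apply]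

theorem latticeVec_snd : latticeVec u₁ u₂ ![0, 1] = u₂ := by simp [latticeVec_apply]

theorem ae_cell_quasiExt (hd : det2 u₁ u₂ ≠ 0) (k : Plane) (F : L2Cell u₁ u₂) :
    ∀ᵐ x ∂volume.restrict (cell u₁ u₂), quasiExt hd k F x = planeWave k x * F x := by
  filter_upwards [ae_restrict_mem (measurableSet_cell hd)] with x hx
  exact quasiExt_of_mem hd k F hx

theorem memLp_planeWave_mul (k : Plane) {f : Plane → ℂ}
    (hf : MemLp f 2 (volume.restrict (cell u₁ u₂))) :
    MemLp (fun x => planeWave k x * f x) 2 (volume.restrict (cell u₁ u₂)) := by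
  refine hf.of_le ((continuous_planeWave k).aestronglyMeasurable.mul hf.aestronglyMeasurable)
    (Eventually.of_forall fun x => ?_)
  rw [norm_mul, norm_planeWave, one_mul]

theorem memL2k_quasiExt (hd : det2 u₁ u₂ ≠ 0) (k : Plane) (F : L2Cell u₁ u₂) :
    MemL2k u₁ u₂ k (quasiExt hd k F) where
  aestronglyMeasurable := (measurable_quasiExt hd k F).aestronglyMeasurable
  quasi_fst := Eventually.of_forall fun x => by
    have := quasiExt_add_latticeVec hd k F x ![1, 0]
    rwa [latticeVec_fst] at this
  quasi_snd := Eventually.of_forall fun x => by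
    have := quasiExt_add_latticeVec hd k F x ![0, 1]
    rwa [latticeVec_snd] at this
  memLp := (memLp_planeWave_mul k (Lp.memLp F)).ae_eq
    (by filter_upwards [ae_cell_quasiExt hd k F] with x hx using hx.symm)

theorem ae_comp_add_right {p : Plane → Prop} (h : ∀ᵐ x, p x) (v : Plane) : ∀ᵐ x, p (x + v) :=
  (measurePreserving_add_right volume v).quasiMeasurePreserving.ae h

/-- The translations `v` with the almost everywhere relation form a subgroup containing both
generators. -/
theorem MemL2k.ae_latticeVec {k : Plane} {f : Plane → ℂ} (hf : MemL2k u₁ u₂ k f)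
    (m : Fin 2 → ℤ) :
    ∀ᵐ x, f (x + latticeVec u₁ u₂ m) = planeWave k (latticeVec u₁ u₂ m) * f x := by
  let A : AddSubgroup Plane :=
    { carrier := {v | ∀ᵐ x, f (x + v) = planeWave k v * f x}
      zero_mem' := by
        refine Eventually.of_forall (f := ae volume) fun x => ?_
        rw [add_zero, planeWave_zero_right, one_mul]
      add_mem' := fun {v w} hv hw => by
        filter_upwards [hv, ae_comp_add_right hw v] with x h1 h2
        rw [← add_assoc, h2, h1, planeWave_add_right]; ring
      neg_mem' := fun {v} hv => by
        filter_upwards [ae_comp_add_right hv (-v)] with x h1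
        rw [neg_add_cancel_right] at h1
        rw [h1, ← mul_assoc, ← planeWave_add_right, neg_add_cancel, planeWave_zero_right, one_mul] }
  have h1 : u₁ ∈ A := hf.quasi_fst
  have h2 : u₂ ∈ A := hf.quasi_snd
  have : latticeVec u₁ u₂ m ∈ A := by
    rw [latticeVec_apply, Int.cast_smul_eq_zsmul, Int.cast_smul_eq_zsmul]
    exact A.add_mem (A.zsmul_mem h1 _) (A.zsmul_mem h2 _)
  exact this

/-- The periodic part on the cell of a quasi-periodic function. -/
def cellClass {k : Plane} {f : Plane → ℂ} (hf : MemL2k u₁ u₂ k f) : L2Cell u₁ u₂ :=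
  (memLp_planeWave_mul (-k) hf.memLp).toLp _

theorem coeFn_cellClass {k : Plane} {f : Plane → ℂ} (hf : MemL2k u₁ u₂ k f) :
    cellClass hf =ᵐ[volume.restrict (cell u₁ u₂)] fun x => planeWave (-k) x * f x :=
  (memLp_planeWave_mul (-k) hf.memLp).coeFn_toLp

/-- Countably many lattice translates carry almost every point into the cell, where both functions
change by the same nonzero phase. -/
theorem MemL2k.ae_eq_of_ae_eq_cell (hd : det2 u₁ u₂ ≠ 0) {k : Plane} {f g : Plane → ℂ}
    (hf : MemL2k u₁ u₂ k f) (hg : MemL2k u₁ u₂ k g)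
    (h : f =ᵐ[volume.restrict (cell u₁ u₂)] g) : f =ᵐ[volume] g := by
  have h1 : ∀ᵐ x, x ∈ cell u₁ u₂ → f x = g x := (ae_restrict_iff' (measurableSet_cell hd)).1 h
  have h2 : ∀ᵐ x, ∀ m, x + latticeVec u₁ u₂ m ∈ cell u₁ u₂ →
      f (x + latticeVec u₁ u₂ m) = g (x + latticeVec u₁ u₂ m) :=
    ae_all_iff.2 fun m => ae_comp_add_right h1 _
  have h3 := ae_all_iff.2 hf.ae_latticeVec
  have h4 := ae_all_iff.2 hg.ae_latticeVec
  filter_upwards [h2, h3, h4, (isAddFundamentalDomain_cell hd).ae_covers] with x h2 h3 h4 h5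
  obtain ⟨⟨_, m, rfl⟩, hm⟩ := h5
  have hm' : x + latticeVec u₁ u₂ m ∈ cell u₁ u₂ := by
    rw [add_comm]; exact hm
  have := h2 m hm'
  rw [h3, h4] at this
  exact mul_left_cancel₀ (planeWave_ne_zero _ _) this

theorem ae_eq_quasiExt (hd : det2 u₁ u₂ ≠ 0) {k : Plane} {f : Plane → ℂ}
    (hf : MemL2k u₁ u₂ k f) : f =ᵐ[volume] quasiExt hd k (cellClass hf) := by
  refine hf.ae_eq_of_ae_eq_cell hd (memL2k_quasiExt hd k _) ?_
  filter_upwards [ae_cell_quasiExt hd k (cellClass hf), coeFn_cellClass hf] with x h1 h2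
  rw [h1, h2, ← mul_assoc, mul_comm (planeWave k x), planeWave_neg_mul, one_mul]

theorem cellClass_quasiExt (hd : det2 u₁ u₂ ≠ 0) (k : Plane) (F : L2Cell u₁ u₂) :
    cellClass (memL2k_quasiExt hd k F) = F := by
  refine Lp.ext ?_
  filter_upwards [coeFn_cellClass (memL2k_quasiExt hd k F), ae_cell_quasiExt hd k F] with x h1 h2
  rw [h1, h2, ← mul_assoc, planeWave_neg_mul, one_mul]

theorem finite_lattice_meeting (hd : det2 u₁ u₂ ≠ 0) {ψ : Plane → ℂ} (hc : HasCompactSupport ψ) :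
    {g : lattice u₁ u₂ | ∃ x ∈ cell u₁ u₂, ψ (g +ᵥ x) ≠ 0}.Finite := by
  obtain ⟨M, hM⟩ := (hc.isCompact.image (cellEquiv hd).symm.continuous).isBounded.exists_norm_le
  have hfin : (Icc (fun _ : Fin 2 => -(⌈M⌉ + 1)) (fun _ => ⌈M⌉ + 1)).Finite := finite_Icc _ _
  refine (hfin.image fun m => (⟨latticeVec u₁ u₂ m, m, rfl⟩ : lattice u₁ u₂)).subset ?_
  rintro ⟨_, m, rfl⟩ ⟨x, hx, hψ⟩
  refine ⟨m, ?_, rfl⟩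
  have hmem : latticeVec u₁ u₂ m + x ∈ tsupport ψ := subset_tsupport _ hψ
  have hb := hM _ ⟨_, hmem, rfl⟩
  have hcoord : ∀ i, |(m i : ℝ)| ≤ M + 1 / 2 := fun i => by
    have h1 := (norm_le_pi_norm ((cellEquiv hd).symm (latticeVec u₁ u₂ m + x)) i).trans hb
    rw [map_add, Pi.add_apply, symm_latticeVec, Real.norm_eq_abs] at h1
    have h2 := (mem_cell_iff hd x).1 hx i
    rw [abs_le] at h1 ⊢
    constructor <;> linarith [h1.1, h1.2, h2.1, h2.2]
  have hceil := Int.le_ceil M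
  constructor <;> intro i <;> have := abs_le.1 (hcoord i)
  · have : ((-(⌈M⌉ + 1) : ℤ) : ℝ) ≤ m i := by push_cast; linarith [this.1]
    exact_mod_cast this
  · have : (m i : ℝ) ≤ ((⌈M⌉ + 1 : ℤ) : ℝ) := by push_cast; linarith [this.2]
    exact_mod_cast this

/-- Integration of a quasi-periodic function against a continuous function with compact support is
a bounded functional of the periodic part. -/
theorem exists_unfold (hd : det2 u₁ u₂ ≠ 0) (k : Plane) {ψ : Plane → ℂ} (hψ : Continuous ψ)
    (hc : HasCompactSupport ψ) :
    ∃ G : L2Cell u₁ u₂, ∀ F : L2Cell u₁ u₂, Integrable (fun x => quasiExt hd k F x * ψ x) ∧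
      ∫ x, quasiExt hd k F x * ψ x = ⟪G, F⟫_ℂ := by
  obtain ⟨C, hC⟩ := hc.exists_bound_of_continuous hψ
  set s := (finite_lattice_meeting hd hc).toFinset with hs
  have hsn : ∀ g ∉ s, ∀ x ∈ cell u₁ u₂, ψ (g +ᵥ x) = 0 := fun g hg x hx => by
    by_contra h
    exact hg ((finite_lattice_meeting hd hc).mem_toFinset.2 ⟨x, hx, h⟩)
  have hquasi : ∀ (F : L2Cell u₁ u₂) (g : lattice u₁ u₂) (x : Plane),
      quasiExt hd k F (g +ᵥ x) = planeWave k g * quasiExt hd k F x := by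
    rintro F ⟨_, m, rfl⟩ x
    have : (⟨latticeVec u₁ u₂ m, m, rfl⟩ : lattice u₁ u₂) +ᵥ x = x + latticeVec u₁ u₂ m :=
      add_comm _ _
    rw [this, quasiExt_add_latticeVec]
  have hvadd : ∀ g : lattice u₁ u₂, Continuous fun x : Plane => g +ᵥ x := fun g =>
    continuous_const_vadd g
  let w : lattice u₁ u₂ → Plane → ℂ := fun g x =>
    conj (planeWave k g * planeWave k x * ψ (g +ᵥ x))
  have hw : ∀ g, MemLp (w g) 2 (volume.restrict (cell u₁ u₂)) := fun g => by
    refine memLp_of_continuous_bounded (C := C) ?_ fun x => ?_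
    · exact Complex.continuous_conj.comp ((continuous_const.mul (continuous_planeWave k)).mul
        (hψ.comp (hvadd g)))
    · simp only [w, RCLike.norm_conj, norm_mul, norm_planeWave, one_mul]
      exact hC _
  have hprod : ∀ (F : L2Cell u₁ u₂) (g : lattice u₁ u₂) (x : Plane), x ∈ cell u₁ u₂ →
      quasiExt hd k F (g +ᵥ x) * ψ (g +ᵥ x) = conj (w g x) * F x := fun F g x hx => by
    rw [hquasi, quasiExt_of_mem hd k F hx]
    simp only [w, Complex.conj_conj]
    ring
  have hint : ∀ F : L2Cell u₁ u₂, Integrable (fun x => quasiExt hd k F x * ψ x) := fun F => by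
    refine ⟨(measurable_quasiExt hd k F).aestronglyMeasurable.mul hψ.aestronglyMeasurable, ?_⟩
    rw [HasFiniteIntegral, (isAddFundamentalDomain_cell hd).lintegral_eq_tsum'',
      tsum_eq_sum (s := s)]
    · refine ENNReal.sum_lt_top.2 fun g _ => ?_
      have hi : Integrable (fun x => conj (w g x) * F x) (volume.restrict (cell u₁ u₂)) :=
        (hw g).star.integrable_mul (Lp.memLp F)
      refine lt_of_le_of_lt (le_of_eq ?_) hi.2
      refine setLIntegral_congr_fun (measurableSet_cell hd) fun x hx => ?_
      simp only
      rw [hprod F g x hx]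
    · intro g hg
      rw [setLIntegral_congr_fun (g := fun _ => 0) (measurableSet_cell hd)
        fun x hx => by simp only; rw [hsn g hg x hx, mul_zero, enorm_zero]]
      simp
  -- Only finitely many translates of the cell meet the support of `ψ`; each contributes one term to
  -- the representing vector.
  refine ⟨∑ g ∈ s, (hw g).toLp _, fun F => ⟨hint F, ?_⟩⟩
  rw [(isAddFundamentalDomain_cell hd).integral_eq_tsum'' _ (hint F), tsum_eq_sum (s := s),
    sum_inner]
  · refine Finset.sum_congr rfl fun g _ => ?_
    rw [inner_toLp]
    exact setIntegral_congr_fun (measurableSet_cell hd) fun x hx => hprod F g x hx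
  · intro g hg
    rw [setIntegral_congr_fun (g := fun _ => 0) (measurableSet_cell hd)
      fun x hx => by simp only; rw [hsn g hg x hx, mul_zero]]
    simp

/-- The extension of a basis vector is an honest smooth plane wave, so that its distributional
derivatives are found by integration by parts. -/
theorem memL2k_planeWave (hd : det2 u₁ u₂ ≠ 0) (k : Plane) (m : Fin 2 → ℤ) :
    quasiExt hd k (fourierVec u₁ u₂ m) =ᵐ[volume]
      fun x => (((Real.sqrt (cellArea u₁ u₂))⁻¹ : ℝ) : ℂ) * planeWave (k + freq u₁ u₂ m) x := by
  have hcont : Continuous fun x =>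
      (((Real.sqrt (cellArea u₁ u₂))⁻¹ : ℝ) : ℂ) * planeWave (k + freq u₁ u₂ m) x :=
    continuous_const.mul (continuous_planeWave _)
  have hq : ∀ (n : Fin 2 → ℤ) x, planeWave (k + freq u₁ u₂ m) (x + latticeVec u₁ u₂ n) =
      planeWave k (latticeVec u₁ u₂ n) * planeWave (k + freq u₁ u₂ m) x := fun n x => by
    rw [planeWave_add_right, planeWave_add_left k _ (latticeVec u₁ u₂ n),
      planeWave_freq_latticeVec hd]; ring
  refine (memL2k_quasiExt hd k _).ae_eq_of_ae_eq_cell hd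
    ⟨hcont.aestronglyMeasurable, ?_, ?_, ?_⟩ ?_
  · refine Eventually.of_forall fun x => ?_
    have := hq ![1, 0] x
    rw [latticeVec_fst] at this
    rw [this]; ring
  · refine Eventually.of_forall fun x => ?_
    have := hq ![0, 1] x
    rw [latticeVec_snd] at this
    rw [this]; ring
  · refine memLp_of_continuous_bounded (C := (Real.sqrt (cellArea u₁ u₂))⁻¹) hcont fun x => ?_
    rw [norm_mul, norm_planeWave, mul_one, Complex.norm_real, Real.norm_of_nonneg (by positivity)]
  · filter_upwards [ae_cell_quasiExt hd k (fourierVec u₁ u₂ m),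
      (memLp_fourierFun (u₁ := u₁) (u₂ := u₂) m).coeFn_toLp] with x h1 h2
    rw [h1, fourierVec, h2, fourierFun, planeWave_add_left]; ring

end Extension

/-! ### Derivatives of test functions against plane waves. -/

section IntegrationByParts

theorem IsTestFunction.continuous_wordDeriv {U : Set Plane} {φ : Plane → ℂ}
    (hφ : IsTestFunction U φ) {n : ℕ} (w : Fin n → Fin 2) : Continuous (wordDeriv w φ) := by
  have h := hφ.smooth.continuous_iteratedFDeriv (m := n) (by exact_mod_cast le_top)
  exact (ContinuousMultilinearMap.apply ℝ (fun _ : Fin n => Plane) ℂ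
    (fun i => basisVec (w i))).continuous.comp h

theorem wordDeriv_zero (w : Fin 0 → Fin 2) (φ : Plane → ℂ) : wordDeriv w φ = φ := by
  funext x; simp [wordDeriv]

theorem wordDeriv_succ {φ : Plane → ℂ} (hφ : ContDiff ℝ ∞ φ) {n : ℕ} (w : Fin (n + 1) → Fin 2)
    (x : Plane) :
    wordDeriv w φ x = fderiv ℝ (wordDeriv (Fin.tail w) φ) x (basisVec (w 0)) := by
  have hdiff : DifferentiableAt ℝ (iteratedFDeriv ℝ n φ) x :=
    (hφ.differentiable_iteratedFDeriv (m := n) (by exact_mod_cast WithTop.coe_lt_top n)) x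
  have h1 : HasFDerivAt (wordDeriv (Fin.tail w) φ)
      ((ContinuousMultilinearMap.apply ℝ (fun _ : Fin n => Plane) ℂ
        (fun i => basisVec (Fin.tail w i))) ∘L (fderiv ℝ (iteratedFDeriv ℝ n φ) x)) x :=
    (ContinuousMultilinearMap.apply ℝ (fun _ : Fin n => Plane) ℂ
        (fun i => basisVec (Fin.tail w i))).hasFDerivAt.comp x hdiff.hasFDerivAt
  rw [h1.fderiv, wordDeriv, iteratedFDeriv_succ_apply_left]
  rfl

theorem IsTestFunction.contDiff_wordDeriv {U : Set Plane} {φ : Plane → ℂ}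
    (hφ : IsTestFunction U φ) {n : ℕ} (w : Fin n → Fin 2) : ContDiff ℝ ∞ (wordDeriv w φ) := by
  have h : ContDiff ℝ ∞ (iteratedFDeriv ℝ n φ) :=
    hφ.smooth.iteratedFDeriv_right (i := n) (m := ∞) (by exact_mod_cast le_top)
  exact (ContinuousMultilinearMap.apply ℝ (fun _ : Fin n => Plane) ℂ
    (fun i => basisVec (w i))).contDiff.comp h

theorem support_wordDeriv_subset (φ : Plane → ℂ) {n : ℕ} (w : Fin n → Fin 2) :
    Function.support (wordDeriv w φ) ⊆ tsupport φ := by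
  intro x hx
  refine support_iteratedFDeriv_subset (𝕜 := ℝ) n (f := φ) ?_
  intro h0
  apply hx
  rw [wordDeriv, h0]; rfl

theorem IsTestFunction.wordDeriv {U : Set Plane} {φ : Plane → ℂ}
    (hφ : IsTestFunction U φ) {n : ℕ} (w : Fin n → Fin 2) : IsTestFunction U (wordDeriv w φ) where
  smooth := hφ.contDiff_wordDeriv w
  compact := hφ.compact.mono' (support_wordDeriv_subset φ w)
  support := (closure_minimal (support_wordDeriv_subset φ w) (isClosed_tsupport φ)).trans hφ.support

theorem fderiv_planeWave (κ x v : Plane) :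
    fderiv ℝ (planeWave κ) x v = Complex.I * (inner ℝ κ v : ℝ) * planeWave κ x := by
  have h1 : HasFDerivAt (fun x : Plane => ((inner ℝ κ x : ℝ) : ℂ))
      (Complex.ofRealCLM ∘L innerSL ℝ κ) x := (Complex.ofRealCLM ∘L innerSL ℝ κ).hasFDerivAt
  have h2 : HasFDerivAt (planeWave κ) _ x := (h1.const_mul Complex.I).cexp
  rw [h2.fderiv]
  simp [planeWave]; ring

theorem inner_basisVec (κ : Plane) (i : Fin 2) : inner ℝ κ (basisVec i) = κ i := by
  rw [basisVec, EuclideanSpace.inner_single_right]; simp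

theorem integral_planeWave_mul_wordDeriv {U : Set Plane} (κ : Plane) {n : ℕ}
    (w : Fin n → Fin 2) {φ : Plane → ℂ} (hφ : IsTestFunction U φ) :
    ∫ x, planeWave κ x * wordDeriv w φ x =
      (-1) ^ n * ((∏ j, Complex.I * (κ (w j) : ℂ)) * ∫ x, planeWave κ x * φ x) := by
  induction n with
  | zero => simp [wordDeriv_zero]
  | succ n ih =>
    have ht := hφ.wordDeriv (Fin.tail w)
    have hint : ∀ (g : Plane → ℂ), Continuous g → HasCompactSupport g →
        Integrable (fun x => planeWave κ x * g x) := fun g hg hgc =>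
      ((continuous_planeWave κ).mul hg).integrable_of_hasCompactSupport hgc.mul_left
    have e1 : ∀ x, planeWave κ x * wordDeriv w φ x =
        planeWave κ x * fderiv ℝ (wordDeriv (Fin.tail w) φ) x (basisVec (w 0)) := fun x => by
      rw [wordDeriv_succ hφ.smooth]
    have e2 : wordDeriv w φ = fun x => fderiv ℝ (wordDeriv (Fin.tail w) φ) x (basisVec (w 0)) :=
      funext fun x => wordDeriv_succ hφ.smooth w x
    have hw := hφ.wordDeriv w
    rw [integral_congr_ae (Eventually.of_forall e1),
      integral_mul_fderiv_eq_neg_fderiv_mul_of_integrable]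
    · simp only [fderiv_planeWave, inner_basisVec, mul_assoc]
      rw [integral_const_mul, integral_const_mul, ih, Fin.prod_univ_succ]
      simp only [Fin.tail, pow_succ]
      ring
    · simp only [fderiv_planeWave, mul_assoc]
      exact ((hint _ ht.smooth.continuous ht.compact).const_mul _).const_mul _
    · simpa only [e2] using hint _ hw.smooth.continuous hw.compact
    · exact hint _ ht.smooth.continuous ht.compact
    · exact fun x _ => ((contDiff_planeWave κ).differentiable (by simp)) x
    · exact fun x _ => (ht.smooth.differentiable (by simp)) x

theorem laplacian_eq_wordDeriv (φ : Plane → ℂ) (x : Plane) :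
    Laplacian.laplacian φ x = ∑ i : Fin 2, wordDeriv ![i, i] φ x := by
  rw [InnerProductSpace.laplacian_eq_iteratedFDeriv_orthonormalBasis φ
    (EuclideanSpace.basisFun (Fin 2) ℝ)]
  simp only [wordDeriv]
  refine Finset.sum_congr rfl fun i _ => ?_
  congr 1
  ext j
  fin_cases j <;> simp [basisVec]

theorem integral_planeWave_mul_laplacian {U : Set Plane} (κ : Plane) {φ : Plane → ℂ}
    (hφ : IsTestFunction U φ) :
    ∫ x, planeWave κ x * -(Laplacian.laplacian φ x) =
      ((‖κ‖ ^ 2 : ℝ) : ℂ) * ∫ x, planeWave κ x * φ x := by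
  have hint : ∀ i : Fin 2, Integrable (fun x => planeWave κ x * wordDeriv ![i, i] φ x) := fun i =>
    ((continuous_planeWave κ).mul (hφ.continuous_wordDeriv _)).integrable_of_hasCompactSupport
      (hφ.wordDeriv _).compact.mul_left
  have e : ∀ x, planeWave κ x * -(Laplacian.laplacian φ x) =
      -(planeWave κ x * wordDeriv ![0, 0] φ x + planeWave κ x * wordDeriv ![1, 1] φ x) := fun x => by
    rw [laplacian_eq_wordDeriv, Fin.sum_univ_two]; ring
  rw [integral_congr_ae (Eventually.of_forall e), integral_neg, integral_add (hint 0) (hint 1),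
    integral_planeWave_mul_wordDeriv κ _ hφ, integral_planeWave_mul_wordDeriv κ _ hφ,
    EuclideanSpace.norm_sq_eq]
  simp only [Fin.prod_univ_two, Fin.sum_univ_two, Matrix.cons_val_zero, Matrix.cons_val_one,
    Matrix.cons_val_fin_one, Real.norm_eq_abs, sq_abs]
  push_cast
  linear_combination (-(κ 0 : ℂ) ^ 2 - (κ 1 : ℂ) ^ 2) * (∫ x, planeWave κ x * φ x) * Complex.I_sq

end IntegrationByParts

theorem HasSum.of_eq {ι : Type*} {f g : ι → ℂ} {a : ℂ} (hs : HasSum f a) (h : ∀ m, f m = g m) :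
    HasSum g a := (funext h : f = g) ▸ hs

/-! ### Weak equations and weak derivatives in Fourier coefficients. -/

section WeakEquation

variable {u₁ u₂ : Plane}

/-- The integrals of a test function against the normalized plane waves of quasi-momentum `k`. -/
def waveCoeff (u₁ u₂ k : Plane) (ψ : Plane → ℂ) (m : Fin 2 → ℤ) : ℂ :=
  (((Real.sqrt (cellArea u₁ u₂))⁻¹ : ℝ) : ℂ) * ∫ x, planeWave (k + freq u₁ u₂ m) x * ψ x

/-- Parseval applied to the vector of `exists_unfold`: integrals over the plane become sums over
dual lattice frequencies. -/
theorem hasSum_waveCoeff (hd : det2 u₁ u₂ ≠ 0) (k : Plane) {ψ : Plane → ℂ} (hψ : Continuous ψ)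
    (hc : HasCompactSupport ψ) (F : L2Cell u₁ u₂) :
    HasSum (fun m => waveCoeff u₁ u₂ k ψ m * (fourierBasis hd).repr F m)
      (∫ x, quasiExt hd k F x * ψ x) := by
  obtain ⟨G, hG⟩ := exists_unfold hd k hψ hc
  rw [(hG F).2]
  refine HasSum.of_eq ((fourierBasis hd).hasSum_inner_mul_inner G F) fun m => ?_
  symm
  rw [HilbertBasis.repr_apply_apply]
  congr 1
  rw [fourierBasis_apply, ← (hG _).2, waveCoeff, ← integral_const_mul]
  refine integral_congr_ae ?_
  filter_upwards [memL2k_planeWave hd k m] with x hx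
  rw [hx]; ring

theorem integral_planeWave_convolution {f g : Plane → ℂ} (hf : Integrable f) (hg : Integrable g)
    (κ : Plane) :
    ∫ x, planeWave κ x * convolution f g (ContinuousLinearMap.mul ℝ ℂ) volume x =
      (∫ x, planeWave κ x * f x) * ∫ x, planeWave κ x * g x := by
  have hmul : ∀ {h : Plane → ℂ}, Integrable h → Integrable fun x => planeWave κ x * h x :=
    fun {h} hh => hh.bdd_mul (c := 1) (continuous_planeWave κ).aestronglyMeasurable
      (Eventually.of_forall fun x => (norm_planeWave κ x).le)
  have h := integral_convolution (ContinuousLinearMap.mul ℝ ℂ) (hmul hf) (hmul hg)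
    (μ := volume) (ν := volume)
  rw [ContinuousLinearMap.mul_apply'] at h
  rw [← h]
  refine integral_congr_ae (Eventually.of_forall fun x => ?_)
  simp only [convolution, ContinuousLinearMap.mul_apply']
  rw [← integral_const_mul]
  refine integral_congr_ae (Eventually.of_forall fun t => ?_)
  have : planeWave κ x = planeWave κ t * planeWave κ (x - t) := by
    rw [← planeWave_add_right, add_sub_cancel]
  simp only [this]; ring

/-- Such a test function isolates one Fourier coefficient. It is a modulation of the convolution of
the cell's indicator with a bump `η`: the transform of the indicator vanishes at all nonzero dual
lattice vectors, convolution keeps these zeros, and at the origin one gets the area times `∫ η > 0`.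
-/
theorem exists_dual_testFunction (hd : det2 u₁ u₂ ≠ 0) (k : Plane) (m₀ : Fin 2 → ℤ) :
    ∃ φ, IsTestFunction univ φ ∧ waveCoeff u₁ u₂ k φ m₀ ≠ 0 ∧
      ∀ m, m ≠ m₀ → waveCoeff u₁ u₂ k φ m = 0 := by
  obtain ⟨η, -, hηc, hηs, hηr, hη0⟩ :=
    exists_contDiff_tsupport_subset (n := ⊤) (univ_mem : (univ : Set Plane) ∈ 𝓝 0)
  have hηpos : 0 < ∫ x, η x := hηs.continuous.integral_pos_of_hasCompactSupport_nonneg_nonzero hηc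
    (fun x => (hηr ⟨x, rfl⟩).1) (by rw [hη0]; exact one_ne_zero)
  let g : Plane → ℂ := fun x => (η x : ℂ)
  have hgs : ContDiff ℝ ∞ g := Complex.ofRealCLM.contDiff.comp hηs
  have hgc : HasCompactSupport g := hηc.comp_left (g := fun r : ℝ => (r : ℂ)) Complex.ofReal_zero
  have hgi : Integrable g := hgs.continuous.integrable_of_hasCompactSupport hgc
  let f : Plane → ℂ := (cell u₁ u₂).indicator 1
  have hfi : Integrable f := (integrable_indicator_iff (measurableSet_cell hd)).2
    (integrableOn_const (C := (1 : ℂ)) (volume_cell_lt_top hd).ne)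
  obtain ⟨K, hK, hcK⟩ := exists_isCompact_cell_subset hd
  have hfc : HasCompactSupport f := HasCompactSupport.intro hK fun x hx =>
    indicator_of_notMem (fun h => hx (hcK h)) _
  let χ := convolution f g (ContinuousLinearMap.mul ℝ ℂ) volume
  have hχs : ContDiff ℝ ∞ χ := hgc.contDiff_convolution_right _ hfi.locallyIntegrable hgs
  have hχc : HasCompactSupport χ := hfc.convolution _ hgc
  have hχ : ∀ m : Fin 2 → ℤ, ∫ x, planeWave (freq u₁ u₂ m) x * χ x =
      (if m = 0 then (cellArea u₁ u₂ : ℂ) else 0) * ∫ x, planeWave (freq u₁ u₂ m) x * g x := by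
    intro m
    rw [integral_planeWave_convolution hfi hgi, ← integral_planeWave_freq hd m,
      ← integral_indicator (measurableSet_cell hd)]
    congr 1
    refine integral_congr_ae (Eventually.of_forall fun x => ?_)
    by_cases hx : x ∈ cell u₁ u₂ <;> simp [f, hx]
  have hw : ∀ m : Fin 2 → ℤ,
      waveCoeff u₁ u₂ k (fun x => planeWave (-(k + freq u₁ u₂ m₀)) x * χ x) m =
      (((Real.sqrt (cellArea u₁ u₂))⁻¹ : ℝ) : ℂ) *
        ((if m - m₀ = 0 then (cellArea u₁ u₂ : ℂ) else 0) *
          ∫ x, planeWave (freq u₁ u₂ (m - m₀)) x * g x) := by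
    intro m
    rw [waveCoeff, ← hχ]
    congr 1
    refine integral_congr_ae (Eventually.of_forall fun x => ?_)
    simp only
    rw [← mul_assoc, ← planeWave_add_left]
    congr 2
    rw [sub_eq_add_neg, freq_add, freq_neg]; abel
  refine ⟨fun x => planeWave (-(k + freq u₁ u₂ m₀)) x * χ x,
    ⟨(contDiff_planeWave _).mul hχs, hχc.mul_left, subset_univ _⟩, ?_, fun m hm => ?_⟩
  · have hA := cellArea_pos hd
    rw [hw, sub_self, if_pos rfl, freq_zero]
    simp only [planeWave_zero_left, one_mul]
    rw [show (∫ x, g x) = ((∫ x, η x : ℝ) : ℂ) from integral_ofReal]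
    have h1 : (Real.sqrt (cellArea u₁ u₂))⁻¹ ≠ 0 := inv_ne_zero (Real.sqrt_pos.2 hA).ne'
    exact mul_ne_zero (Complex.ofReal_ne_zero.2 h1)
      (mul_ne_zero (Complex.ofReal_ne_zero.2 hA.ne') (Complex.ofReal_ne_zero.2 hηpos.ne'))
  · rw [hw, if_neg (sub_ne_zero.2 hm)]; ring

theorem waveCoeff_laplacian (k : Plane) {φ : Plane → ℂ} {U : Set Plane} (hφ : IsTestFunction U φ)
    (m : Fin 2 → ℤ) : waveCoeff u₁ u₂ k (fun x => -(Laplacian.laplacian φ x)) m =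
      ((‖k + freq u₁ u₂ m‖ ^ 2 : ℝ) : ℂ) * waveCoeff u₁ u₂ k φ m := by
  rw [waveCoeff, integral_planeWave_mul_laplacian _ hφ, waveCoeff]; ring

theorem quasiExt_mulOp (hd : det2 u₁ u₂ ≠ 0) (k : Plane) (Vb : Plane →ᵇ ℂ)
    (hV : ∀ x m, Vb (x + latticeVec u₁ u₂ m) = Vb x) (F : L2Cell u₁ u₂) :
    quasiExt hd k (mulOp u₁ u₂ Vb F) =ᵐ[volume] fun x => Vb x * quasiExt hd k F x := by
  have hq := memL2k_quasiExt hd k F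
  have hper : ∀ m x, Vb (x + latticeVec u₁ u₂ m) * quasiExt hd k F (x + latticeVec u₁ u₂ m) =
      planeWave k (latticeVec u₁ u₂ m) * (Vb x * quasiExt hd k F x) := fun m x => by
    rw [hV, quasiExt_add_latticeVec]; ring
  refine (memL2k_quasiExt hd k _).ae_eq_of_ae_eq_cell hd
    ⟨Vb.continuous.aestronglyMeasurable.mul hq.aestronglyMeasurable, ?_, ?_, ?_⟩ ?_
  · refine Eventually.of_forall fun x => ?_
    have := hper ![1, 0] x
    rwa [latticeVec_fst] at this
  · refine Eventually.of_forall fun x => ?_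
    have := hper ![0, 1] x
    rwa [latticeVec_snd] at this
  · refine (hq.memLp.const_mul (‖Vb‖ : ℂ)).of_le
      (Vb.continuous.aestronglyMeasurable.mul hq.memLp.aestronglyMeasurable)
      (Eventually.of_forall fun x => ?_)
    rw [norm_mul, norm_mul, Complex.norm_real, norm_norm]
    gcongr
    exact Vb.norm_coe_le_norm x
  · filter_upwards [ae_cell_quasiExt hd k (mulOp u₁ u₂ Vb F), ae_cell_quasiExt hd k F,
      coeFn_mulOp Vb F] with x h1 h2 h3
    rw [h1, h2, h3]; ring

/-- Weak solutions of the eigenvalue equation in terms of Fourier coefficients. -/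
theorem isWeakSolution_quasiExt_iff (hd : det2 u₁ u₂ ≠ 0) (k : Plane) {V : Plane → ℝ}
    (Vb : Plane →ᵇ ℂ) (hVb : ∀ x, Vb x = V x) (hV : ∀ x m, Vb (x + latticeVec u₁ u₂ m) = Vb x)
    (E : ℝ) (F : L2Cell u₁ u₂) :
    IsWeakSolution V E (quasiExt hd k F) 0 ↔
      ∀ m, ((‖k + freq u₁ u₂ m‖ ^ 2 : ℝ) : ℂ) * (fourierBasis hd).repr F m +
        (fourierBasis hd).repr (mulOp u₁ u₂ Vb F) m = (E : ℂ) * (fourierBasis hd).repr F m := by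
  -- The weak form is the sum over frequencies of the coefficient of `φ` times the defect of the
  -- Fourier equation.
  have key : ∀ φ, IsTestFunction univ φ →
      HasSum (fun m => waveCoeff u₁ u₂ k φ m *
        (((‖k + freq u₁ u₂ m‖ ^ 2 : ℝ) : ℂ) * (fourierBasis hd).repr F m +
        (fourierBasis hd).repr (mulOp u₁ u₂ Vb F) m - (E : ℂ) * (fourierBasis hd).repr F m))
      (∫ x, quasiExt hd k F x *
        (-(Laplacian.laplacian φ x) + (V x : ℂ) * φ x - (E : ℂ) * φ x)) := by
    intro φ hφ
    have hlap : Laplacian.laplacian φ = fun x => wordDeriv ![0, 0] φ x + wordDeriv ![1, 1] φ x := by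
      funext x; rw [laplacian_eq_wordDeriv, Fin.sum_univ_two]
    have hlc : Continuous fun x => -(Laplacian.laplacian φ x) := by
      rw [hlap]
      exact ((hφ.continuous_wordDeriv _).add (hφ.continuous_wordDeriv _)).neg
    have hls : HasCompactSupport fun x => -(Laplacian.laplacian φ x) := by
      rw [hlap]
      exact ((hφ.wordDeriv _).compact.add (hφ.wordDeriv _).compact).neg
    have h1 := hasSum_waveCoeff hd k hlc hls F
    have h2 := hasSum_waveCoeff hd k hφ.smooth.continuous hφ.compact (mulOp u₁ u₂ Vb F)
    have h3 := (hasSum_waveCoeff hd k hφ.smooth.continuous hφ.compact F).mul_left (E : ℂ)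
    have hi : ∀ (ψ : Plane → ℂ), Continuous ψ → HasCompactSupport ψ → ∀ F : L2Cell u₁ u₂,
        Integrable fun x => quasiExt hd k F x * ψ x := fun ψ h h' F => by
      obtain ⟨G, hG⟩ := exists_unfold hd k h h'
      exact (hG F).1
    have i1 := hi _ hlc hls F
    have i2 := hi _ hφ.smooth.continuous hφ.compact (mulOp u₁ u₂ Vb F)
    have i3 := (hi _ hφ.smooth.continuous hφ.compact F).const_mul (E : ℂ)
    have h := (h1.add h2).sub h3
    rw [← integral_const_mul, ← integral_add i1 i2, ← integral_sub (f := fun a => quasiExt hd k F a * -Laplacian.laplacian φ a +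
        quasiExt hd k (mulOp u₁ u₂ Vb F) a * φ a) (i1.add i2) i3] at h
    have e : ∫ x, quasiExt hd k F x *
        (-(Laplacian.laplacian φ x) + (V x : ℂ) * φ x - (E : ℂ) * φ x) = ∫ x, (quasiExt hd k F x * -Laplacian.laplacian φ x +
        quasiExt hd k (mulOp u₁ u₂ Vb F) x * φ x - (E : ℂ) * (quasiExt hd k F x * φ x)) := by
      refine integral_congr_ae ?_
      filter_upwards [quasiExt_mulOp hd k Vb hV F] with x hx
      rw [hx, hVb]; ring
    rw [e]
    refine HasSum.of_eq h fun m => ?_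
    rw [waveCoeff_laplacian k hφ]; ring
  constructor
  · intro h m₀
    obtain ⟨φ, hφ, h0, hm⟩ := exists_dual_testFunction hd k m₀
    have h1 := key φ hφ
    rw [h φ hφ] at h1
    simp only [Pi.zero_apply, zero_mul, integral_zero] at h1
    have h2 := hasSum_single (f := fun m => waveCoeff u₁ u₂ k φ m *
        (((‖k + freq u₁ u₂ m‖ ^ 2 : ℝ) : ℂ) * (fourierBasis hd).repr F m +
        (fourierBasis hd).repr (mulOp u₁ u₂ Vb F) m - (E : ℂ) * (fourierBasis hd).repr F m)) m₀
      fun m hne => by rw [hm m hne, zero_mul]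
    exact sub_eq_zero.1 ((mul_eq_zero.1 (h2.unique h1)).resolve_left h0)
  · intro h φ hφ
    have h1 := key φ hφ
    simp only [h, sub_self, mul_zero] at h1
    rw [h1.unique hasSum_zero]
    simp

theorem IsWeakSolution.congr {V : Plane → ℝ} {E : ℝ} {f g h : Plane → ℂ} (hfg : f =ᵐ[volume] g) :
    IsWeakSolution V E f h ↔ IsWeakSolution V E g h := by
  refine forall₂_congr fun φ _ => ?_
  rw [integral_congr_ae (g := fun x =>
    g x * (-(Laplacian.laplacian φ x) + (V x : ℂ) * φ x - (E : ℂ) * φ x))]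
  filter_upwards [hfg] with x hx
  rw [hx]

theorem setIntegral_mul_testFunction {U : Set Plane} {ψ : Plane → ℂ} (hs : tsupport ψ ⊆ U)
    (f : Plane → ℂ) : ∫ x in U, f x * ψ x = ∫ x, f x * ψ x := by
  refine setIntegral_eq_integral_of_forall_compl_eq_zero fun x hx => ?_
  rw [image_eq_zero_of_notMem_tsupport (fun h => hx (hs h)), mul_zero]

theorem isWeakDeriv_quasiExt (hd : det2 u₁ u₂ ≠ 0) (k : Plane) (U : Set Plane) {n : ℕ}
    (w : Fin n → Fin 2) {F G : L2Cell u₁ u₂}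
    (h : ∀ m, (fourierBasis hd).repr G m =
      (∏ j, Complex.I * ((k + freq u₁ u₂ m) (w j) : ℂ)) * (fourierBasis hd).repr F m) :
    IsWeakDeriv U w (quasiExt hd k F) (quasiExt hd k G) := by
  intro φ hφ
  rw [setIntegral_mul_testFunction (hφ.wordDeriv w).support, setIntegral_mul_testFunction hφ.support]
  have h1 := hasSum_waveCoeff hd k (hφ.continuous_wordDeriv w) (hφ.wordDeriv w).compact F
  have h2 := (hasSum_waveCoeff hd k hφ.smooth.continuous hφ.compact G).mul_left ((-1 : ℂ) ^ n)
  refine h1.unique ?_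
  refine HasSum.of_eq h2 fun m => ?_
  symm
  rw [waveCoeff, integral_planeWave_mul_wordDeriv _ w hφ, waveCoeff, h]
  ring

theorem locallyIntegrable_quasiExt (hd : det2 u₁ u₂ ≠ 0) (k : Plane) (F : L2Cell u₁ u₂) :
    LocallyIntegrable (quasiExt hd k F) volume := by
  refine locallyIntegrable_iff.2 fun K hK => ?_
  obtain ⟨ψ, h1, -, hc, -⟩ := exists_continuous_one_zero_of_isCompact hK isClosed_empty
    (disjoint_empty K)
  obtain ⟨G, hG⟩ := exists_unfold hd k (ψ := fun x => (ψ x : ℂ))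
    (Complex.continuous_ofReal.comp ψ.continuous)
    (hc.comp_left (g := fun r : ℝ => (r : ℂ)) Complex.ofReal_zero)
  refine ((hG F).1.integrableOn (s := K)).congr_fun (fun x hx => ?_) hK.measurableSet
  simp only
  rw [h1 hx, Pi.one_apply, Complex.ofReal_one, mul_one]

theorem IsWeakDeriv.ae_eq {n : ℕ} {w : Fin n → Fin 2} {f g₁ g₂ : Plane → ℂ}
    (h₁ : IsWeakDeriv univ w f g₁) (h₂ : IsWeakDeriv univ w f g₂)
    (i₁ : LocallyIntegrable g₁ volume) (i₂ : LocallyIntegrable g₂ volume) : g₁ =ᵐ[volume] g₂ := by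
  refine ae_eq_of_integral_contDiff_smul_eq i₁ i₂ fun g hg hgc => ?_
  have ht : IsTestFunction univ fun x => (g x : ℂ) :=
    ⟨Complex.ofRealCLM.contDiff.comp hg,
      hgc.comp_left (g := fun r : ℝ => (r : ℂ)) Complex.ofReal_zero, subset_univ _⟩
  have h := (h₁ _ ht).symm.trans (h₂ _ ht)
  simp only [setIntegral_univ] at h
  have h' := mul_left_cancel₀ (pow_ne_zero n (by norm_num : (-1 : ℂ) ≠ 0)) h
  simpa only [Complex.real_smul, mul_comm] using h'

/-- `weakPartial` is a choice; uniqueness of weak derivatives identifies it with any explicit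
candidate. -/
theorem weakPartial_ae_eq {f g : Plane → ℂ} {i : Fin 2} (hg : LocallyIntegrable g volume)
    (h : IsWeakDeriv univ (fun _ : Fin 1 => i) f g) : weakPartial i f =ᵐ[volume] g := by
  have hex : ∃ g, LocallyIntegrable g volume ∧ IsWeakDeriv univ (fun _ : Fin 1 => i) f g :=
    ⟨g, hg, h⟩
  rw [weakPartial, dif_pos hex]
  exact hex.choose_spec.2.ae_eq h hex.choose_spec.1 hg

theorem IsWeakDeriv.congr_left {n : ℕ} {U : Set Plane} {w : Fin n → Fin 2} {f f' g : Plane → ℂ}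
    (h : IsWeakDeriv U w f g) (hf : f =ᵐ[volume.restrict U] f') : IsWeakDeriv U w f' g := by
  intro φ hφ
  rw [← h φ hφ]
  refine integral_congr_ae ?_
  filter_upwards [hf] with x hx
  rw [hx]

theorem IsWeakDeriv.congr_right {n : ℕ} {U : Set Plane} {w : Fin n → Fin 2} {f g g' : Plane → ℂ}
    (h : IsWeakDeriv U w f g) (hg : g =ᵐ[volume.restrict U] g') : IsWeakDeriv U w f g' := by
  intro φ hφ
  rw [h φ hφ]
  congr 1
  refine integral_congr_ae ?_
  filter_upwards [hg] with x hx
  rw [hx]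

end WeakEquation

/-! ### Abstract Bloch fibers: resolvents, modes and the velocity operator. -/

theorem re_inner_diagOp_nonneg {ι H : Type*} [TopologicalSpace ι] [DiscreteTopology ι]
    [NormedAddCommGroup H] [InnerProductSpace ℂ H] (e : HilbertBasis ι ℂ H) {d : ι →ᵇ ℂ}
    {r : ι → ℝ} (hd : ∀ i, d i = r i) (hr : ∀ i, 0 ≤ r i) (x : H) :
    0 ≤ (⟪diagOp e d x, x⟫_ℂ).re := by
  have h := Complex.hasSum_re (e.hasSum_inner_mul_inner (diagOp e d x) x)
  refine h.nonneg fun i => ?_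
  rw [← inner_conj_symm (diagOp e d x) (e i), ← e.repr_apply_apply, ← e.repr_apply_apply,
    repr_diagOp, hd, map_mul, Complex.conj_ofReal, mul_assoc, Complex.re_ofReal_mul,
    ← Complex.normSq_eq_conj_mul_self, Complex.ofReal_re]
  exact mul_nonneg (hr i) (Complex.normSq_nonneg _)

/-- The fibers `-Δ + W` of a periodic Schrödinger operator in a Fourier basis with frequencies
`K`, shifted by a constant `c`. -/
structure Fibers (ι H : Type*) [NormedAddCommGroup H] [InnerProductSpace ℂ H] where
  /-- The Fourier basis. -/
  e : HilbertBasis ι ℂ H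
  /-- The frequencies. -/
  K : ι → Plane
  /-- The potential. -/
  W : H →L[ℂ] H
  /-- The energy shift. -/
  c : ℝ
  tendsto : Tendsto (fun m => ‖K m‖) cofinite atTop
  symm : (W : H →ₗ[ℂ] H).IsSymmetric
  one_le : 1 ≤ c
  norm_lt : ‖W‖ < c

namespace Fibers

variable {ι H : Type*} [TopologicalSpace ι] [DiscreteTopology ι]
  [NormedAddCommGroup H] [InnerProductSpace ℂ H] (D : Fibers ι H)

theorem c_pos : 0 < D.c := zero_lt_one.trans_le D.one_le

/-- The symbol of the shifted kinetic energy. -/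
def symbol (k : Plane) (m : ι) : ℝ := ‖k + D.K m‖ ^ 2 + D.c

theorem c_le_symbol (k : Plane) (m : ι) : D.c ≤ D.symbol k m :=
  le_add_of_nonneg_left (sq_nonneg _)

theorem symbol_pos (k : Plane) (m : ι) : 0 < D.symbol k m := D.c_pos.trans_le (D.c_le_symbol k m)

theorem inv_symbol_le (k : Plane) (m : ι) : (D.symbol k m)⁻¹ ≤ D.c⁻¹ :=
  inv_anti₀ D.c_pos (D.c_le_symbol k m)

/-- The inverse of the symbol. -/
def res (k : Plane) : ι →ᵇ ℂ :=
  BoundedContinuousFunction.ofNormedAddCommGroupDiscrete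
    (fun m => (((D.symbol k m)⁻¹ : ℝ) : ℂ)) D.c⁻¹ (fun m => by
      rw [Complex.norm_real, Real.norm_of_nonneg (inv_pos.2 (D.symbol_pos k m)).le]
      exact D.inv_symbol_le k m)

theorem res_apply (k : Plane) (m : ι) : D.res k m = (((D.symbol k m)⁻¹ : ℝ) : ℂ) := rfl

theorem norm_res_le (k : Plane) : ‖D.res k‖ ≤ D.c⁻¹ :=
  (BoundedContinuousFunction.norm_le (inv_pos.2 D.c_pos).le).2 fun m => by
    rw [res_apply, Complex.norm_real, Real.norm_of_nonneg (inv_pos.2 (D.symbol_pos k m)).le]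
    exact D.inv_symbol_le k m

theorem tendsto_symbol (k : Plane) : Tendsto (D.symbol k) cofinite atTop := by
  refine tendsto_atTop_add_const_right _ _ ((tendsto_pow_atTop two_ne_zero).comp ?_)
  refine tendsto_atTop_mono (fun m => ?_) (tendsto_atTop_add_const_right _ (-‖k‖) D.tendsto)
  have := norm_sub_le (k + D.K m) k
  rw [add_sub_cancel_left] at this
  linarith

theorem tendsto_res (k : Plane) : Tendsto (D.res k) cofinite (𝓝 0) := by
  have := (Complex.continuous_ofReal.tendsto 0).comp (tendsto_inv_atTop_zero.comp (D.tendsto_symbol k))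
  rw [Complex.ofReal_zero] at this
  exact this

/-- The two symbols differ by at most `|k| (2|K| + |k|)`. Since `2|K| ≤ |K|² + 1` and both symbols
are at least `1`, their product absorbs the growth in `K`. This is norm continuity of the free
resolvent at `k = 0`. -/
theorem norm_res_sub_le (k : Plane) : ‖D.res k - D.res 0‖ ≤ ‖k‖ * (1 + ‖k‖) := by
  refine (BoundedContinuousFunction.norm_le (by positivity)).2 fun m => ?_
  have hx := D.symbol_pos k m
  have hy := D.symbol_pos 0 m
  have h1 := D.one_le.trans (D.c_le_symbol k m)
  have h2 := D.one_le.trans (D.c_le_symbol 0 m)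
  rw [BoundedContinuousFunction.sub_apply, res_apply, res_apply, ← Complex.ofReal_sub,
    Complex.norm_real, inv_sub_inv hx.ne' hy.ne', norm_div, norm_mul, Real.norm_of_nonneg hx.le,
    Real.norm_of_nonneg hy.le, div_le_iff₀ (mul_pos hx hy), Real.norm_eq_abs]
  have h3 : D.symbol 0 m = ‖D.K m‖ ^ 2 + D.c := by rw [symbol, zero_add]
  have h4 : D.symbol k m = ‖k + D.K m‖ ^ 2 + D.c := rfl
  have h5 : |‖k + D.K m‖ - ‖D.K m‖| ≤ ‖k‖ := by
    have := abs_norm_sub_norm_le (k + D.K m) (D.K m)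
    rwa [add_sub_cancel_right] at this
  have h6 : D.symbol 0 m - D.symbol k m =
      -((‖k + D.K m‖ - ‖D.K m‖) * (‖k + D.K m‖ + ‖D.K m‖)) := by rw [h3, h4]; ring
  rw [h6, abs_neg, abs_mul, abs_of_nonneg (by positivity : 0 ≤ ‖k + D.K m‖ + ‖D.K m‖)]
  have h7 : ‖k + D.K m‖ ≤ ‖k‖ + ‖D.K m‖ := norm_add_le _ _
  have h8 : ‖k + D.K m‖ + ‖D.K m‖ ≤ D.symbol 0 m + ‖k‖ := by
    have := D.one_le
    nlinarith [sq_nonneg (‖D.K m‖ - 1)]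
  calc |‖k + D.K m‖ - ‖D.K m‖| * (‖k + D.K m‖ + ‖D.K m‖)
      ≤ ‖k‖ * (D.symbol 0 m + ‖k‖) := by gcongr
    _ ≤ ‖k‖ * ((1 + ‖k‖) * D.symbol 0 m) := by
        gcongr
        nlinarith [norm_nonneg k]
    _ ≤ ‖k‖ * ((1 + ‖k‖) * (D.symbol k m * D.symbol 0 m)) := by
        gcongr
        exact le_mul_of_one_le_left hy.le h1
    _ = _ := by ring

/-- The free resolvent. -/
def R (k : Plane) : H →L[ℂ] H := diagOp D.e (D.res k)

theorem norm_R_le (k : Plane) : ‖D.R k‖ ≤ D.c⁻¹ := (norm_diagOp_le _ _).trans (D.norm_res_le k)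

theorem repr_R (k : Plane) (x : H) (m : ι) :
    D.e.repr (D.R k x) m = (((D.symbol k m)⁻¹ : ℝ) : ℂ) * D.e.repr x m := by
  rw [R, repr_diagOp, res_apply]

theorem R_symm (k : Plane) (x y : H) : ⟪D.R k x, y⟫_ℂ = ⟪x, D.R k y⟫_ℂ :=
  diagOp_symm _ (fun _ => by rw [res_apply, Complex.conj_ofReal]) x y

theorem norm_W_mul_lt : ‖D.W‖ * D.c⁻¹ < 1 := by
  rw [← div_eq_mul_inv, div_lt_one D.c_pos]
  exact D.norm_lt

theorem W_symm (x y : H) : ⟪D.W x, y⟫_ℂ = ⟪x, D.W y⟫_ℂ := D.symm x y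

/-- Coefficientwise `1/s ≥ c/s²`, since the symbol `s` is at least `c`. -/
theorem c_mul_norm_sq_le (k : Plane) (x : H) : D.c * ‖D.R k x‖ ^ 2 ≤ (⟪D.R k x, x⟫_ℂ).re := by
  have h := re_inner_diagOp_nonneg D.e (d := D.res k - (D.c : ℂ) • (D.res k * D.res k))
    (r := fun m => (D.symbol k m)⁻¹ - D.c * ((D.symbol k m)⁻¹ * (D.symbol k m)⁻¹))
    (fun m => by
      simp only [BoundedContinuousFunction.sub_apply, BoundedContinuousFunction.smul_apply,
        BoundedContinuousFunction.mul_apply, res_apply, smul_eq_mul]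
      push_cast; ring) (fun m => by
      have h1 := inv_pos.2 (D.symbol_pos k m)
      have h2 : D.c * (D.symbol k m)⁻¹ ≤ 1 := by
        rw [← div_eq_mul_inv, div_le_one (D.symbol_pos k m)]
        exact D.c_le_symbol k m
      have := mul_le_mul_of_nonneg_right h2 h1.le
      linarith) x
  rw [map_sub, map_smul, diagOp_mul, sub_apply, smul_apply, mul_apply_eq_comp,
    inner_sub_left, inner_smul_left, Complex.sub_re, Complex.conj_ofReal, Complex.re_ofReal_mul] at h
  have h2 : (⟪D.R k (D.R k x), x⟫_ℂ).re = ‖D.R k x‖ ^ 2 := by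
    rw [R_symm, ← inner_self_eq_norm_sq (𝕜 := ℂ)]; rfl
  rw [← h2]
  exact sub_nonneg.1 h

/-- The velocity operator in direction `l` divided by the symbol at zero quasi-momentum. -/
def drift (l : Plane) : ι →ᵇ ℂ :=
  BoundedContinuousFunction.ofNormedAddCommGroupDiscrete
    (fun m => ((2 * inner ℝ l (D.K m) * (D.symbol 0 m)⁻¹ : ℝ) : ℂ)) ‖l‖ (fun m => by
      have hy := D.symbol_pos 0 m
      have h3 : D.symbol 0 m = ‖D.K m‖ ^ 2 + D.c := by rw [symbol, zero_add]
      have h4 := abs_real_inner_le_norm l (D.K m)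
      rw [Complex.norm_real, ← div_eq_mul_inv, norm_div, Real.norm_of_nonneg hy.le,
        div_le_iff₀ hy, Real.norm_eq_abs, abs_mul, abs_two]
      have := D.one_le
      calc 2 * |inner ℝ l (D.K m)| ≤ ‖l‖ * (2 * ‖D.K m‖) := by linarith
        _ ≤ ‖l‖ * D.symbol 0 m := by
          gcongr
          nlinarith [sq_nonneg (‖D.K m‖ - 1)])

theorem drift_apply (l : Plane) (m : ι) :
    D.drift l m = ((2 * inner ℝ l (D.K m) * (D.symbol 0 m)⁻¹ : ℝ) : ℂ) := rfl

variable [CompleteSpace H]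

/-- Neumann series: `‖W R‖ ≤ ‖W‖ / c < 1`. -/
theorem isUnit (k : Plane) : IsUnit (1 + D.W * D.R k) := by
  have h : ‖-(D.W * D.R k)‖ < 1 := by
    rw [norm_neg]
    refine lt_of_le_of_lt ((norm_mul_le _ _).trans ?_) D.norm_W_mul_lt
    gcongr
    exact D.norm_R_le k
  have := isUnit_one_sub_of_norm_lt_one h
  rwa [sub_neg_eq_add] at this

/-- The perturbation factor of the resolvent. -/
def U (k : Plane) : H →L[ℂ] H := Ring.inverse (1 + D.W * D.R k)

theorem U_add (k : Plane) (x : H) : D.U k (x + D.W (D.R k x)) = x := by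
  have := Ring.inverse_mul_cancel _ (D.isUnit k)
  exact congrArg (fun T : H →L[ℂ] H => T x) this

theorem add_U (k : Plane) (x : H) : D.U k x + D.W (D.R k (D.U k x)) = x := by
  have := Ring.mul_inverse_cancel _ (D.isUnit k)
  exact congrArg (fun T : H →L[ℂ] H => T x) this

/-- The resolvent `(-Δ + W + c)⁻¹` on the fiber at quasi-momentum `k`. -/
def S (k : Plane) : H →L[ℂ] H := D.R k * D.U k

theorem S_apply (k : Plane) (x : H) : D.S k x = D.R k (D.U k x) := rfl

theorem S_add_R (k : Plane) (x : H) : D.S k x + D.R k (D.W (D.S k x)) = D.R k x := by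
  rw [S_apply, ← map_add, add_U]

theorem S_compact (k : Plane) : IsCompactOperator (D.S k) :=
  (diagOp_isCompact D.e (D.tendsto_res k)).comp_clm (D.U k)

/-- Substituting `x = (1 + W R) U x` and the same for `y` turns both sides into one expression in `U
x` and `U y`. -/
theorem S_symm (k : Plane) : (D.S k : H →ₗ[ℂ] H).IsSymmetric := by
  intro x y
  change ⟪D.S k x, y⟫_ℂ = ⟪x, D.S k y⟫_ℂ
  rw [S_apply, S_apply]
  conv_lhs => rw [← D.add_U k y]
  conv_rhs => rw [← D.add_U k x]
  rw [inner_add_left, inner_add_right, R_symm, W_symm]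

/-- With `u = U x` the form is `⟪R u, u⟫ + ⟪R u, W R u⟫`; the first term is at least `c ‖R u‖²` and
dominates the potential because `c > ‖W‖`. -/
theorem norm_sq_le_re_inner_S (k : Plane) (x : H) :
    (D.c - ‖D.W‖) * ‖D.S k x‖ ^ 2 ≤ (⟪D.S k x, x⟫_ℂ).re := by
  have h := D.c_mul_norm_sq_le k (D.U k x)
  have h2 : ⟪D.S k x, x⟫_ℂ = ⟪D.S k x, D.U k x⟫_ℂ + ⟪D.S k x, D.W (D.S k x)⟫_ℂ := by
    rw [← inner_add_right, S_apply, add_U]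
  have h3 : |(⟪D.S k x, D.W (D.S k x)⟫_ℂ).re| ≤ ‖D.W‖ * ‖D.S k x‖ ^ 2 := by
    refine (Complex.abs_re_le_norm _).trans ((norm_inner_le_norm _ _).trans ?_)
    have := D.W.le_opNorm (D.S k x)
    nlinarith [norm_nonneg (D.S k x)]
  rw [h2, Complex.add_re]
  rw [← S_apply] at h
  linarith [(abs_le.1 h3).1]

theorem S_injective (k : Plane) {x : H} (h : D.S k x = 0) : x = 0 := by
  have h1 : D.U k x = 0 := by
    refine repr_ext D.e fun m => ?_
    have := D.repr_R k (D.U k x) m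
    rw [← S_apply, h, map_zero, lp.coeFn_zero, Pi.zero_apply] at this
    rw [map_zero, lp.coeFn_zero, Pi.zero_apply]
    exact (mul_eq_zero.1 this.symm).resolve_left
      (Complex.ofReal_ne_zero.2 (inv_pos.2 (D.symbol_pos k m)).ne')
  rw [← D.add_U k x, h1]; simp

theorem re_inner_S_pos (k : Plane) {x : H} (hx : x ≠ 0) : 0 < (⟪D.S k x, x⟫_ℂ).re := by
  refine lt_of_lt_of_le ?_ (D.norm_sq_le_re_inner_S k x)
  have h : D.S k x ≠ 0 := fun h => hx (D.S_injective k h)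
  have := sub_pos.2 D.norm_lt
  positivity

theorem continuousAt_S (l : Plane) : ContinuousAt (fun t : ℝ => D.S (t • l)) 0 := by
  have hres : ContinuousAt (fun t : ℝ => D.res (t • l)) 0 := by
    rw [ContinuousAt, zero_smul, tendsto_iff_norm_sub_tendsto_zero]
    refine squeeze_zero (fun _ => norm_nonneg _) (fun t => D.norm_res_sub_le (t • l)) ?_
    have : Continuous fun t : ℝ => ‖t • l‖ * (1 + ‖t • l‖) := by fun_prop
    simpa using this.tendsto 0
  have hR : ContinuousAt (fun t : ℝ => D.R (t • l)) 0 :=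
    (diagOp D.e).continuous.continuousAt.comp hres
  refine hR.mul ?_
  have h1 : ContinuousAt (fun t : ℝ => 1 + D.W * D.R (t • l)) 0 :=
    continuousAt_const.add (continuousAt_const.mul hR)
  obtain ⟨u, hu⟩ := D.isUnit ((0 : ℝ) • l)
  have h2 := NormedRing.inverse_continuousAt u
  rw [hu] at h2
  exact ContinuousAt.comp (f := fun t : ℝ => 1 + D.W * D.R (t • l)) h2 h1

/-- The eigenvalue equation on the fiber at quasi-momentum `k` in Fourier coefficients. -/
def IsMode (k : Plane) (E : ℝ) (g : H) : Prop :=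
  ∀ m, ((‖k + D.K m‖ ^ 2 : ℝ) : ℂ) * D.e.repr g m + D.e.repr (D.W g) m = (E : ℂ) * D.e.repr g m

/-- Both sides amount to `(1 + R W) g = (E + c) R g`. To return to `S`, note that `g - (E + c) S g`
is annihilated by `1 + R W`, which is injective as `‖R W‖ < 1`. -/
theorem isMode_iff (k : Plane) (E : ℝ) (g : H) :
    D.IsMode k E g ↔ ((E + D.c : ℝ) : ℂ) • D.S k g = g := by
  have hs : ∀ m, ((D.symbol k m : ℝ) : ℂ) ≠ 0 := fun m =>
    Complex.ofReal_ne_zero.2 (D.symbol_pos k m).ne'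
  have h1 : D.IsMode k E g ↔ g + D.R k (D.W g) = ((E + D.c : ℝ) : ℂ) • D.R k g := by
    constructor
    · intro h
      refine repr_ext D.e fun m => ?_
      have := h m
      rw [map_add, map_smul, lp.coeFn_add, lp.coeFn_smul, Pi.add_apply, Pi.smul_apply, repr_R,
        repr_R, Complex.ofReal_inv, smul_eq_mul]
      have hsm := hs m
      have e1 : ((D.symbol k m : ℝ) : ℂ) = ((‖k + D.K m‖ ^ 2 : ℝ) : ℂ) + (D.c : ℂ) := by
        rw [symbol, Complex.ofReal_add]
      field_simp
      rw [e1]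
      push_cast at this ⊢
      linear_combination this
    · intro h m
      have := congrArg (fun y => D.e.repr y m) h
      simp only [map_add, map_smul, lp.coeFn_add, lp.coeFn_smul, Pi.add_apply, Pi.smul_apply,
        repr_R, Complex.ofReal_inv, smul_eq_mul] at this
      have hsm := hs m
      have e1 : ((D.symbol k m : ℝ) : ℂ) = ((‖k + D.K m‖ ^ 2 : ℝ) : ℂ) + (D.c : ℂ) := by
        rw [symbol, Complex.ofReal_add]
      field_simp at this
      rw [e1] at this
      push_cast at this ⊢
      linear_combination this
  rw [h1]
  constructor
  · intro h
    have h2 : (g - ((E + D.c : ℝ) : ℂ) • D.S k g) +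
        D.R k (D.W (g - ((E + D.c : ℝ) : ℂ) • D.S k g)) = 0 := by
      have h3 := D.S_add_R k g
      simp only [map_sub, map_smul]
      have h4 : ((E + D.c : ℝ) : ℂ) • D.R k g =
        ((E + D.c : ℝ) : ℂ) • D.S k g + ((E + D.c : ℝ) : ℂ) • D.R k (D.W (D.S k g)) := by
        rw [← smul_add, h3]
      rw [h4] at h
      rw [← sub_eq_zero] at h
      rw [← h]; abel
    set z := g - ((E + D.c : ℝ) : ℂ) • D.S k g with hz
    have h5 : ‖z‖ ≤ ‖D.W‖ * D.c⁻¹ * ‖z‖ := by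
      have h6 : z = -(D.R k (D.W z)) := eq_neg_of_add_eq_zero_left h2
      calc ‖z‖ = ‖D.R k (D.W z)‖ := by conv_lhs => rw [h6, norm_neg]
        _ ≤ D.c⁻¹ * (‖D.W‖ * ‖z‖) := (D.R k).le_of_opNorm_le_of_le (D.norm_R_le k) (D.W.le_opNorm z)
        _ = _ := by ring
    have h7 : ‖z‖ = 0 := by nlinarith [norm_nonneg z, D.norm_W_mul_lt]
    exact (sub_eq_zero.1 (norm_eq_zero.1 h7)).symm
  · intro h
    have h3 := D.S_add_R k g
    rw [← h3, smul_add, h]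
    congr 1
    rw [← map_smul, ← map_smul, h]

theorem IsMode.energy_pos {D : Fibers ι H} {k : Plane} {E : ℝ} {g : H} (h : D.IsMode k E g)
    (hg : g ≠ 0) : 0 < E + D.c := by
  have h1 := (D.isMode_iff k E g).1 h
  have h2 := D.re_inner_S_pos k hg
  have h3 : (E + D.c) * (⟪D.S k g, g⟫_ℂ).re = ‖g‖ ^ 2 := by
    rw [← inner_self_eq_norm_sq (𝕜 := ℂ), ← Complex.re_ofReal_mul]
    conv_rhs => rw [← h1]
    conv_rhs => rw [inner_smul_left, Complex.conj_ofReal, h1]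
    rfl
  have h4 : 0 < ‖g‖ ^ 2 := by positivity
  rw [← h3] at h4
  exact (mul_pos_iff_of_pos_right h2).1 h4

/-- The relative velocity operator. -/
def B (l : Plane) : H →L[ℂ] H := diagOp D.e (D.drift l) * D.U 0

theorem B_apply (l : Plane) (x : H) : D.B l x = diagOp D.e (D.drift l) (D.U 0 x) := rfl

/-- `B` is the real multiplier `2 l·K` applied after `S 0`, so this is the symmetry of that
multiplier at `S 0 x`; no symmetry of `B` itself is claimed. -/
theorem inner_B_S (l : Plane) (x : H) : ⟪D.B l x, D.S 0 x⟫_ℂ = ⟪D.S 0 x, D.B l x⟫_ℂ := by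
  rw [B_apply, S_apply]
  have h1 := diagOp_symm D.e (d := D.drift l)
    (fun m => by rw [drift_apply, Complex.conj_ofReal]) (D.U 0 x) (D.R 0 (D.U 0 x))
  rw [h1, R_symm]
  have h2 := DFunLike.congr_fun (diagOp_comm D.e (D.drift l) (D.res 0)).eq (D.U 0 x)
  exact congrArg (fun y => ⟪D.U 0 x, y⟫_ℂ) h2

theorem repr_U_zero {E : ℝ} {g : H} (h : D.IsMode 0 E g) (m : ι) :
    ((E + D.c : ℝ) : ℂ) * D.e.repr (D.U 0 g) m = ((D.symbol 0 m : ℝ) : ℂ) * D.e.repr g m := by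
  have h1 := congrArg (fun y => D.e.repr y m) ((D.isMode_iff 0 E g).1 h)
  simp only [map_smul, lp.coeFn_smul, Pi.smul_apply, smul_eq_mul, S_apply, repr_R] at h1
  rw [← h1, Complex.ofReal_inv]
  have : ((D.symbol 0 m : ℝ) : ℂ) ≠ 0 := Complex.ofReal_ne_zero.2 (D.symbol_pos 0 m).ne'
  field_simp

/-- On a mode `(E + c) S g = g`, so `(E + c) B l` acts as `-2i l·∇`, whose multiplier is `2 l·K`. -/
theorem repr_B {E : ℝ} {g : H} (h : D.IsMode 0 E g) (l : Plane) (m : ι) :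
    ((E + D.c : ℝ) : ℂ) * D.e.repr (D.B l g) m =
      ((2 * inner ℝ l (D.K m) : ℝ) : ℂ) * D.e.repr g m := by
  have h1 := D.repr_U_zero h m
  rw [B_apply, repr_diagOp, drift_apply]
  have : ((D.symbol 0 m : ℝ) : ℂ) ≠ 0 := Complex.ofReal_ne_zero.2 (D.symbol_pos 0 m).ne'
  rw [mul_left_comm, h1]
  push_cast
  field_simp

/-- Solutions of the relative equation give modes at nonzero quasi-momentum. -/
theorem isMode_of_equation {l : Plane} {t E ν : ℝ} {h : H}
    (hh : h - ((E + D.c : ℝ) : ℂ) • D.S 0 h + (t : ℂ) • D.B l h +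
      ((t ^ 2 * ‖l‖ ^ 2 - t * ν : ℝ) : ℂ) • D.S 0 h = 0) :
    D.IsMode (t • l) (E + t * ν) (D.S 0 h) := by
  intro m
  have h1 := congrArg (fun y => D.e.repr y m) hh
  have h2 : D.e.repr h m = D.e.repr (D.U 0 h) m + D.e.repr (D.W (D.S 0 h)) m := by
    rw [S_apply, ← Pi.add_apply, ← lp.coeFn_add, ← map_add, add_U]
  have h3 : D.e.repr (D.U 0 h) m = ((D.symbol 0 m : ℝ) : ℂ) * D.e.repr (D.S 0 h) m := by
    have : ((D.symbol 0 m : ℝ) : ℂ) ≠ 0 := Complex.ofReal_ne_zero.2 (D.symbol_pos 0 m).ne'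
    rw [S_apply, repr_R, Complex.ofReal_inv]
    field_simp
  have h4 : D.e.repr (D.B l h) m = ((2 * inner ℝ l (D.K m) : ℝ) : ℂ) * D.e.repr (D.S 0 h) m := by
    rw [B_apply, repr_diagOp, drift_apply, S_apply, repr_R]
    push_cast; ring
  simp only [map_add, map_sub, map_smul, map_zero, lp.coeFn_add, lp.coeFn_sub, lp.coeFn_smul,
    lp.coeFn_zero, Pi.add_apply, Pi.sub_apply, Pi.smul_apply, Pi.zero_apply, smul_eq_mul] at h1
  rw [h2, h3, h4] at h1
  -- The cross term of the square is the velocity, and `t² |l|²` is the scalar second order term of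
  -- the equation.
  have h5 : ‖t • l + D.K m‖ ^ 2 + D.c =
      D.symbol 0 m + t * (2 * inner ℝ l (D.K m)) + t ^ 2 * ‖l‖ ^ 2 := by
    rw [symbol, zero_add, norm_add_sq_real, norm_smul, mul_pow, Real.norm_eq_abs, sq_abs,
      real_inner_smul_left]
    ring
  have h6 : (((‖t • l + D.K m‖ ^ 2 : ℝ) : ℂ)) = ((D.symbol 0 m : ℝ) : ℂ) +
      (t : ℂ) * ((2 * inner ℝ l (D.K m) : ℝ) : ℂ) + (t : ℂ) ^ 2 * ((‖l‖ ^ 2 : ℝ) : ℂ) - D.c := by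
    rw [← eq_sub_iff_add_eq] at h5
    rw [h5]; push_cast; ring
  rw [h6]
  push_cast at h1 ⊢
  linear_combination h1

end Fibers

/-! ### Projections on sets of Fourier indices. -/

section Sector

variable {ι H : Type*} [TopologicalSpace ι] [DiscreteTopology ι]
  [NormedAddCommGroup H] [InnerProductSpace ℂ H] (e : HilbertBasis ι ℂ H)

/-- The indicator sequence of a set of indices. -/
def sectorSymbol (s : Set ι) : ι →ᵇ ℂ :=
  BoundedContinuousFunction.ofNormedAddCommGroupDiscrete (s.indicator 1) 1 (fun m => by
    by_cases h : m ∈ s <;> simp [h])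

theorem sectorSymbol_apply (s : Set ι) (m : ι) : sectorSymbol s m = s.indicator 1 m := rfl

/-- The orthogonal projection on the vectors with coefficients supported in `s`. -/
def sectorProj (s : Set ι) : H →L[ℂ] H := diagOp e (sectorSymbol s)

theorem repr_sectorProj (s : Set ι) (x : H) (m : ι) :
    e.repr (sectorProj e s x) m = s.indicator 1 m * e.repr x m := by
  rw [sectorProj, repr_diagOp, sectorSymbol_apply]

theorem sectorProj_eq_self_iff (s : Set ι) (x : H) :
    sectorProj e s x = x ↔ ∀ m ∉ s, e.repr x m = 0 := by
  constructor
  · intro h m hm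
    rw [← h, repr_sectorProj, indicator_of_notMem hm, zero_mul]
  · intro h
    refine repr_ext e fun m => ?_
    rw [repr_sectorProj]
    by_cases hm : m ∈ s
    · simp [hm]
    · rw [h m hm, mul_zero]

theorem sectorProj_idem (s : Set ι) (x : H) :
    sectorProj e s (sectorProj e s x) = sectorProj e s x :=
  (sectorProj_eq_self_iff e s _).2 fun m hm => by
    rw [repr_sectorProj, indicator_of_notMem hm, zero_mul]

theorem sectorProj_symm (s : Set ι) (x y : H) :
    ⟪sectorProj e s x, y⟫_ℂ = ⟪x, sectorProj e s y⟫_ℂ :=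
  diagOp_symm e (fun m => by by_cases h : m ∈ s <;> simp [sectorSymbol_apply, h]) x y

theorem inner_eq_zero_of_disjoint {s t : Set ι} (hst : Disjoint s t) {x y : H}
    (hx : sectorProj e s x = x) (hy : sectorProj e t y = y) : ⟪x, y⟫_ℂ = 0 := by
  rw [← e.tsum_inner_mul_inner]
  refine (tsum_congr fun m => ?_).trans tsum_zero
  rw [← inner_conj_symm, ← e.repr_apply_apply, ← e.repr_apply_apply]
  by_cases hm : m ∈ s
  · rw [(sectorProj_eq_self_iff e t y).1 hy m (disjoint_left.1 hst hm), mul_zero]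
  · rw [(sectorProj_eq_self_iff e s x).1 hx m hm, map_zero, zero_mul]

/-- The hypothesis says that `W` has no matrix elements between `s` and its complement. -/
theorem commute_sectorProj {W : H →L[ℂ] H} (hW : ∀ x y, ⟪W x, y⟫_ℂ = ⟪x, W y⟫_ℂ) (s : Set ι)
    (h : ∀ m n, m ∈ s → n ∉ s → ⟪W (e n), e m⟫_ℂ = 0 ∧ ⟪W (e m), e n⟫_ℂ = 0) (x : H) :
    W (sectorProj e s x) = sectorProj e s (W x) := by
  refine repr_ext e fun n => ?_
  rw [repr_sectorProj, e.repr_apply_apply, e.repr_apply_apply, ← hW, ← hW,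
    ← e.tsum_inner_mul_inner, ← e.tsum_inner_mul_inner, ← tsum_mul_left]
  refine tsum_congr fun m => ?_
  rw [← e.repr_apply_apply, ← e.repr_apply_apply, repr_sectorProj]
  by_cases hm : m ∈ s <;> by_cases hn : n ∈ s
  · simp [hm, hn]
  · simp [(h m n hm hn).1]
  · simp [(h n m hn hm).2]
  · simp [hm, hn]

end Sector

/-! ### Branches of modes inside an invariant sector. -/

namespace Fibers

variable {ι H : Type*} [TopologicalSpace ι] [DiscreteTopology ι]
  [NormedAddCommGroup H] [InnerProductSpace ℂ H] [CompleteSpace H] (D : Fibers ι H)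

theorem sectorProj_U {s : Set ι}
    (hW : ∀ x, D.W (sectorProj D.e s x) = sectorProj D.e s (D.W x)) (k : Plane) (x : H) :
    D.U k (sectorProj D.e s x) = sectorProj D.e s (D.U k x) := by
  conv_lhs => rw [← D.add_U k x]
  have h1 : D.R k (sectorProj D.e s (D.U k x)) = sectorProj D.e s (D.R k (D.U k x)) :=
    DFunLike.congr_fun (diagOp_comm D.e (D.res k) (sectorSymbol s)).eq (D.U k x)
  rw [map_add, ← hW, ← h1, U_add]

theorem sectorProj_S {s : Set ι}
    (hW : ∀ x, D.W (sectorProj D.e s x) = sectorProj D.e s (D.W x)) (k : Plane) (x : H) :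
    D.S k (sectorProj D.e s x) = sectorProj D.e s (D.S k x) := by
  rw [S_apply, S_apply, D.sectorProj_U hW]
  exact DFunLike.congr_fun (diagOp_comm D.e (D.res k) (sectorSymbol s)).eq (D.U k x)

theorem sectorProj_B {s : Set ι}
    (hW : ∀ x, D.W (sectorProj D.e s x) = sectorProj D.e s (D.W x)) (l : Plane) (x : H) :
    D.B l (sectorProj D.e s x) = sectorProj D.e s (D.B l x) := by
  rw [B_apply, B_apply, D.sectorProj_U hW]
  exact DFunLike.congr_fun (diagOp_comm D.e (D.drift l) (sectorSymbol s)).eq (D.U 0 x)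

/-- An analytic branch of modes emanating from one of two orthonormal modes spanning the kernel in
a sector, if the velocity operator separates them. -/
theorem exists_branch {s : Set ι}
    (hW : ∀ x, D.W (sectorProj D.e s x) = sectorProj D.e s (D.W x)) {a b : H}
    (has : sectorProj D.e s a = a) (hbs : sectorProj D.e s b = b)
    (ha1 : ⟪a, a⟫_ℂ = 1) (hb1 : ⟪b, b⟫_ℂ = 1) (hab : ⟪a, b⟫_ℂ = 0) {E : ℝ}
    (ha : D.IsMode 0 E a) (hb : D.IsMode 0 E b)
    (hker : ∀ x, D.IsMode 0 E x → sectorProj D.e s x = x → ∃ α β : ℂ, x = α • a + β • b)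
    {l : Plane} {νa νb : ℝ} (hne : νa ≠ νb)
    (hBa : ((E + D.c : ℝ) : ℂ) * ⟪a, D.B l a⟫_ℂ = νa)
    (hBb : ((E + D.c : ℝ) : ℂ) * ⟪b, D.B l b⟫_ℂ = νb) (hBab : ⟪b, D.B l a⟫_ℂ = 0) :
    ∃ (ν : ℝ → ℝ) (h : ℝ → H), AnalyticAt ℝ ν 0 ∧ AnalyticAt ℝ h 0 ∧ ν 0 = νa ∧
      D.S 0 (h 0) = a ∧ ∀ᶠ t in 𝓝 0, D.IsMode (t • l) (E + t * ν t) (D.S 0 (h t)) ∧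
        sectorProj D.e s (D.S 0 (h t)) = D.S 0 (h t) := by
  have ha0 : a ≠ 0 := fun h0 => by rw [h0, inner_zero_left] at ha1; exact zero_ne_one ha1
  have hκ : 0 < E + D.c := ha.energy_pos ha0
  have ha' := (D.isMode_iff 0 E a).1 ha
  have hb' := (D.isMode_iff 0 E b).1 hb
  set P := sectorProj D.e s with hP
  have hSP : ∀ x, D.S 0 (P x) = P (D.S 0 x) := D.sectorProj_S hW 0
  have hBP : ∀ x, D.B l (P x) = P (D.B l x) := D.sectorProj_B hW l
  -- Composing with the projection `P` cuts the kernel down to the span of `a` and `b`, as the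
  -- perturbation lemma requires.
  obtain ⟨ν, h, hν, hh, hν0, hh0, heq⟩ := exists_analytic_branch (S := D.S 0 * P) (B := D.B l * P)
    ((D.S_compact 0).comp_clm P)
    (fun x y => by
      change ⟪D.S 0 (P x), y⟫_ℂ = ⟪x, D.S 0 (P y)⟫_ℂ
      rw [hSP y, ← sectorProj_symm]
      exact D.S_symm 0 (P x) y)
    (fun x => D.inner_B_S l (P x)) ha1 hb1 hab hκ
    (by rw [mul_apply_eq_comp, has, ha']) (by rw [mul_apply_eq_comp, hbs, hb'])
    (fun x hx => by
      rw [mul_apply_eq_comp] at hx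
      have hPx : P x = x := by
        conv_lhs => rw [← hx]
        rw [map_smul, ← hSP, sectorProj_idem, hx]
      rw [hPx] at hx
      exact hker x ((D.isMode_iff 0 E x).2 hx) hPx)
    hne (by rw [mul_apply_eq_comp, has, hBa]) (by rw [mul_apply_eq_comp, hbs, hBb])
    (by rw [mul_apply_eq_comp, has, hBab]) (‖l‖ ^ 2)
  refine ⟨ν, h, hν, hh, hν0, ?_, ?_⟩
  · rw [hh0, map_smul, ha']
  · filter_upwards [heq] with t ht
    simp only [mul_apply_eq_comp] at ht
    -- All other terms of the equation lie in the range of `P`, hence so does `h t`.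
    have hPh : P (h t) = h t := by
      have h1 : h t = P (((E + D.c : ℝ) : ℂ) • D.S 0 (h t) - (t : ℂ) • D.B l (h t) -
          ((t ^ 2 * ‖l‖ ^ 2 - t * ν t : ℝ) : ℂ) • D.S 0 (h t)) := by
        rw [hSP, hBP] at ht
        simp only [map_sub, map_smul]
        rw [← sub_eq_zero, ← ht]; abel
      rw [h1, hP, sectorProj_idem]
    rw [hPh] at ht
    exact ⟨D.isMode_of_equation ht, by rw [← hSP, hPh]⟩

end Fibers

/-! ### Effect of symmetries on Fourier coefficients. -/

section Symmetry

variable {u₁ u₂ : Plane}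

/-- A periodic function has the same integral over every fundamental domain; translates of the cell
and its images under lattice-preserving isometries are such domains. -/
theorem setIntegral_cell_eq (hd : det2 u₁ u₂ ≠ 0) {G : Plane → ℂ}
    (hG : ∀ x n, G (x + latticeVec u₁ u₂ n) = G x) {t : Set Plane}
    (ht : IsAddFundamentalDomain (lattice u₁ u₂) t volume) :
    ∫ x in cell u₁ u₂, G x = ∫ x in t, G x := by
  refine (isAddFundamentalDomain_cell hd).setIntegral_eq ht ?_
  rintro ⟨_, m, rfl⟩ x
  have : (⟨latticeVec u₁ u₂ m, m, rfl⟩ : lattice u₁ u₂) +ᵥ x = x + latticeVec u₁ u₂ m :=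
    add_comm _ _
  rw [this, hG]

theorem setIntegral_cell_comp_add (hd : det2 u₁ u₂ ≠ 0) {G : Plane → ℂ}
    (hG : ∀ x n, G (x + latticeVec u₁ u₂ n) = G x) (v : Plane) :
    ∫ x in cell u₁ u₂, G (x + v) = ∫ x in cell u₁ u₂, G x := by
  have ht := (isAddFundamentalDomain_cell hd).vadd_of_comm v
  rw [setIntegral_cell_eq hd hG ht, ← image_vadd,
    (measurePreserving_vadd v volume).setIntegral_image_emb (measurableEmbedding_const_vadd v)]
  simp only [vadd_eq_add, add_comm]

theorem image_cell (T : Plane ≃ₗᵢ[ℝ] Plane) : T '' cell u₁ u₂ = cell (T u₁) (T u₂) := by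
  ext y
  constructor
  · rintro ⟨_, ⟨c₁, h₁, c₂, h₂, rfl⟩, rfl⟩
    exact ⟨c₁, h₁, c₂, h₂, by simp⟩
  · rintro ⟨c₁, h₁, c₂, h₂, rfl⟩
    exact ⟨_, ⟨c₁, h₁, c₂, h₂, rfl⟩, by simp⟩

theorem setIntegral_cell_comp_isometry (hd : det2 u₁ u₂ ≠ 0) {G : Plane → ℂ}
    (hG : ∀ x n, G (x + latticeVec u₁ u₂ n) = G x) (T : Plane ≃ₗᵢ[ℝ] Plane)
    (hdT : det2 (T u₁) (T u₂) ≠ 0) (hT : lattice (T u₁) (T u₂) = lattice u₁ u₂) :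
    ∫ x in cell u₁ u₂, G (T x) = ∫ x in cell u₁ u₂, G x := by
  have ht : IsAddFundamentalDomain (lattice u₁ u₂) (T '' cell u₁ u₂) volume := by
    rw [image_cell, ← hT]
    exact isAddFundamentalDomain_cell hdT
  rw [setIntegral_cell_eq hd hG ht, T.measurePreserving.setIntegral_image_emb
    T.toHomeomorph.measurableEmbedding]

theorem ae_comp_isometry {p : Plane → Prop} (h : ∀ᵐ x, p x) (T : Plane ≃ₗᵢ[ℝ] Plane) :
    ∀ᵐ x, p (T x) := T.measurePreserving.quasiMeasurePreserving.ae h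

theorem setIntegral_cell_comp_neg (hd : det2 u₁ u₂ ≠ 0) {G : Plane → ℂ}
    (hG : ∀ x n, G (x + latticeVec u₁ u₂ n) = G x) :
    ∫ x in cell u₁ u₂, G (-x) = ∫ x in cell u₁ u₂, G x := by
  refine setIntegral_cell_comp_isometry hd hG (LinearIsometryEquiv.neg ℝ) ?_ ?_
  · simpa [det2] using hd
  · ext x
    constructor
    · rintro ⟨m, rfl⟩
      exact ⟨-m, by simp [latticeVec_apply]⟩
    · rintro ⟨m, rfl⟩
      exact ⟨-m, by simp [latticeVec_apply]⟩

theorem fourierFun_add_latticeVec (hd : det2 u₁ u₂ ≠ 0) (m n : Fin 2 → ℤ) (x : Plane) :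
    fourierFun u₁ u₂ m (x + latticeVec u₁ u₂ n) = fourierFun u₁ u₂ m x := by
  rw [fourierFun, fourierFun, planeWave_add_right, planeWave_freq_latticeVec hd, mul_one]

theorem quasiExt_zero_add_latticeVec (hd : det2 u₁ u₂ ≠ 0) (F : L2Cell u₁ u₂) (x : Plane)
    (n : Fin 2 → ℤ) : quasiExt hd 0 F (x + latticeVec u₁ u₂ n) = quasiExt hd 0 F x := by
  rw [quasiExt_add_latticeVec, planeWave_zero_left, one_mul]

theorem repr_cellClass (hd : det2 u₁ u₂ ≠ 0) {f : Plane → ℂ} (hf : MemL2k u₁ u₂ 0 f)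
    (m : Fin 2 → ℤ) : (fourierBasis hd).repr (cellClass hf) m =
      ∫ x in cell u₁ u₂, conj (fourierFun u₁ u₂ m x) * f x := by
  rw [fourierBasis_repr]
  refine integral_congr_ae ?_
  filter_upwards [coeFn_cellClass hf] with x hx
  rw [hx, neg_zero, planeWave_zero_left, one_mul]

theorem repr_eq_integral_quasiExt (hd : det2 u₁ u₂ ≠ 0) (F : L2Cell u₁ u₂) (m : Fin 2 → ℤ) :
    (fourierBasis hd).repr F m =
      ∫ x in cell u₁ u₂, conj (fourierFun u₁ u₂ m x) * quasiExt hd 0 F x := by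
  rw [fourierBasis_repr]
  refine integral_congr_ae ?_
  filter_upwards [ae_cell_quasiExt hd 0 F] with x hx
  rw [hx, planeWave_zero_left, one_mul]

theorem periodic_conj_fourierFun_mul (hd : det2 u₁ u₂ ≠ 0) (F : L2Cell u₁ u₂) (m : Fin 2 → ℤ)
    (x : Plane) (n : Fin 2 → ℤ) :
    conj (fourierFun u₁ u₂ m (x + latticeVec u₁ u₂ n)) *
      quasiExt hd 0 F (x + latticeVec u₁ u₂ n) =
    conj (fourierFun u₁ u₂ m x) * quasiExt hd 0 F x := by
  rw [fourierFun_add_latticeVec hd, quasiExt_zero_add_latticeVec]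

/-- Shifting the cell integral by `v` multiplies the character by its phase. Hence the coefficients
of `f` vanish off the frequencies with phase `ξ`. -/
theorem repr_of_translation (hd : det2 u₁ u₂ ≠ 0) {f : Plane → ℂ} (hf : MemL2k u₁ u₂ 0 f)
    {v : Plane} {ξ : ℂ} (h : ∀ᵐ x, f (x + v) = ξ * f x) (m : Fin 2 → ℤ) :
    planeWave (freq u₁ u₂ m) v * (fourierBasis hd).repr (cellClass hf) m =
      ξ * (fourierBasis hd).repr (cellClass hf) m := by
  have hq := ae_eq_quasiExt hd hf
  rw [repr_eq_integral_quasiExt, ← integral_const_mul, ← integral_const_mul,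
    ← setIntegral_cell_comp_add hd (v := v)]
  · refine integral_congr_ae (ae_restrict_of_ae ?_)
    filter_upwards [h, hq, ae_comp_add_right hq v] with x h1 h2 h3
    rw [← h3, h1, ← h2, fourierFun, fourierFun, planeWave_add_right]
    simp only [map_mul]
    have := planeWave_neg_mul (freq u₁ u₂ m) v
    rw [← conj_planeWave] at this
    linear_combination (conj (((Real.sqrt (cellArea u₁ u₂))⁻¹ : ℝ) : ℂ) *
      conj (planeWave (freq u₁ u₂ m) x) * ξ * f x) * this
  · intro x n
    rw [periodic_conj_fourierFun_mul]

theorem repr_of_isometry (hd : det2 u₁ u₂ ≠ 0) {f : Plane → ℂ} (hf : MemL2k u₁ u₂ 0 f)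
    (T : Plane ≃ₗᵢ[ℝ] Plane) (hdT : det2 (T u₁) (T u₂) ≠ 0)
    (hT : lattice (T u₁) (T u₂) = lattice u₁ u₂) {ξ : ℂ} (h : ∀ᵐ x, f (T x) = ξ * f x)
    {m n : Fin 2 → ℤ} (hmn : freq u₁ u₂ n = T (freq u₁ u₂ m)) :
    (fourierBasis hd).repr (cellClass hf) n = ξ * (fourierBasis hd).repr (cellClass hf) m := by
  have hq := ae_eq_quasiExt hd hf
  rw [repr_eq_integral_quasiExt, repr_eq_integral_quasiExt, ← integral_const_mul,
    ← setIntegral_cell_comp_isometry hd (periodic_conj_fourierFun_mul hd _ n) T hdT hT]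
  refine integral_congr_ae (ae_restrict_of_ae ?_)
  filter_upwards [h, hq, ae_comp_isometry hq T] with x h1 h2 h3
  rw [← h3, h1, ← h2, fourierFun, fourierFun, hmn, planeWave, planeWave, T.inner_map_map]
  ring

theorem repr_conj (hd : det2 u₁ u₂ ≠ 0) {f : Plane → ℂ} (hf : MemL2k u₁ u₂ 0 f)
    (hf' : MemL2k u₁ u₂ 0 fun x => conj (f x)) (m : Fin 2 → ℤ) :
    (fourierBasis hd).repr (cellClass hf') m =
      conj ((fourierBasis hd).repr (cellClass hf) (-m)) := by
  rw [repr_cellClass, repr_cellClass, ← integral_conj]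
  refine integral_congr_ae (Eventually.of_forall fun x => ?_)
  simp only [fourierFun, freq_neg, map_mul, conj_planeWave, neg_neg,
    Complex.conj_ofReal]

theorem repr_comp_neg (hd : det2 u₁ u₂ ≠ 0) {f : Plane → ℂ} (hf : MemL2k u₁ u₂ 0 f)
    (hf' : MemL2k u₁ u₂ 0 fun x => f (-x)) (m : Fin 2 → ℤ) :
    (fourierBasis hd).repr (cellClass hf') m = (fourierBasis hd).repr (cellClass hf) (-m) := by
  have hq := ae_eq_quasiExt hd hf
  rw [repr_cellClass, repr_eq_integral_quasiExt hd (cellClass hf) (-m)]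
  refine Eq.trans ?_
    (setIntegral_cell_comp_neg hd (periodic_conj_fourierFun_mul hd (cellClass hf) (-m)))
  refine integral_congr_ae (ae_restrict_of_ae ?_)
  filter_upwards [ae_comp_isometry hq (LinearIsometryEquiv.neg ℝ)] with x h1
  simp only [LinearIsometryEquiv.coe_neg] at h1
  rw [h1, fourierFun, fourierFun, freq_neg, planeWave_neg_right, neg_neg]

end Symmetry

/-! ### The rotation on the lattice and on its dual. -/

section Rotation

/-- The rotation `R*` as a linear isometry. -/
def rotIso : Plane ≃ₗᵢ[ℝ] Plane :=
  LinearIsometry.toLinearIsometryEquiv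
    { toFun := rot
      map_add' := fun x y => by
        ext i; fin_cases i <;> simp [rot] <;> ring
      map_smul' := fun c x => by
        ext i; fin_cases i <;> simp [rot] <;> ring
      norm_map' := fun x => by
        have h3 : Real.sqrt 3 ^ 2 = 3 := Real.sq_sqrt (by norm_num)
        rw [← sq_eq_sq₀ (norm_nonneg _) (norm_nonneg _), EuclideanSpace.norm_sq_eq,
          EuclideanSpace.norm_sq_eq]
        simp only [rot, LinearMap.coe_mk, AddHom.coe_mk, Fin.sum_univ_two, Matrix.cons_val_zero,
          Matrix.cons_val_one, Matrix.cons_val_fin_one, Real.norm_eq_abs, sq_abs]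
        linear_combination ((x 0) ^ 2 + (x 1) ^ 2) / 4 * h3 } rfl

theorem rotIso_apply (x : Plane) : rotIso x = rot x := rfl

/-- This is `1 + R* + R*² = 0`, which makes rotation invariant linear quantities vanish. -/
theorem rot_rot (x : Plane) : rotIso (rotIso x) = -x - rotIso x := by
  have h3 : Real.sqrt 3 ^ 2 = 3 := Real.sq_sqrt (by norm_num)
  ext i
  fin_cases i
  · simp only [rotIso_apply, rot, PiLp.sub_apply, PiLp.neg_apply, Fin.zero_eta,
      Matrix.cons_val_zero, Matrix.cons_val_one, Matrix.cons_val_fin_one]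
    linear_combination -(x 0) / 4 * h3
  · simp only [rotIso_apply, rot, PiLp.sub_apply, PiLp.neg_apply, Fin.mk_one,
      Matrix.cons_val_zero, Matrix.cons_val_one, Matrix.cons_val_fin_one]
    linear_combination -(x 1) / 4 * h3

variable {u₁ u₂ : Plane}

theorem det2_ne_zero_of_rot (hu : u₁ ≠ 0) (h : u₂ = -rot u₁) : det2 u₁ u₂ ≠ 0 := by
  have h1 : det2 u₁ u₂ = -(Real.sqrt 3 / 2 * ‖u₁‖ ^ 2) := by
    rw [h, EuclideanSpace.norm_sq_eq]
    simp only [det2, rot, PiLp.neg_apply, Fin.sum_univ_two, Matrix.cons_val_zero,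
      Matrix.cons_val_one, Matrix.cons_val_fin_one, Real.norm_eq_abs, sq_abs]
    ring
  rw [h1]
  have : 0 < ‖u₁‖ := norm_pos_iff.2 hu
  exact neg_ne_zero.2 (by positivity)

theorem rotIso_fst (h : u₂ = -rot u₁) : rotIso u₁ = -u₂ := by rw [h, neg_neg]; rfl

theorem rotIso_snd (h : u₂ = -rot u₁) : rotIso u₂ = u₁ - u₂ := by
  have h1 : u₂ = -rotIso u₁ := h
  rw [h1, map_neg, rot_rot]; abel

theorem det2_rotIso (hd : det2 u₁ u₂ ≠ 0) (h : u₂ = -rot u₁) :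
    det2 (rotIso u₁) (rotIso u₂) ≠ 0 := by
  rw [rotIso_fst h, rotIso_snd h]
  convert hd using 1
  simp only [det2, PiLp.neg_apply, PiLp.sub_apply]; ring

theorem lattice_rotIso (h : u₂ = -rot u₁) : lattice (rotIso u₁) (rotIso u₂) = lattice u₁ u₂ := by
  rw [rotIso_fst h, rotIso_snd h]
  ext x
  constructor
  · rintro ⟨m, rfl⟩
    refine ⟨![m 1, -m 0 - m 1], ?_⟩
    simp only [latticeVec_apply, Matrix.cons_val_zero, Matrix.cons_val_one,
      Matrix.cons_val_fin_one]
    push_cast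
    module
  · rintro ⟨m, rfl⟩
    refine ⟨![-m 1 - m 0, m 0], ?_⟩
    simp only [latticeVec_apply, Matrix.cons_val_zero, Matrix.cons_val_one,
      Matrix.cons_val_fin_one]
    push_cast
    module

/-- The action of the rotation on the indices of the dual lattice. -/
def rotIndex : (Fin 2 → ℤ) ≃ (Fin 2 → ℤ) where
  toFun m := ![m 1 - m 0, -m 0]
  invFun m := ![-m 1, m 0 - m 1]
  left_inv m := by ext i; fin_cases i <;> simp
  right_inv m := by ext i; fin_cases i <;> simp

theorem eq_of_inner_eq (hd : det2 u₁ u₂ ≠ 0) {x y : Plane} (h1 : inner ℝ x u₁ = inner ℝ y u₁)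
    (h2 : inner ℝ x u₂ = inner ℝ y u₂) : x = y := by
  refine ext_inner_right ℝ fun z => ?_
  obtain ⟨t, rfl⟩ := (cellEquiv hd).surjective z
  rw [cellEquiv_apply, inner_add_right, inner_add_right, inner_smul_right, inner_smul_right,
    inner_smul_right, inner_smul_right, h1, h2]

theorem inner_freq_fst (hd : det2 u₁ u₂ ≠ 0) (m : Fin 2 → ℤ) :
    inner ℝ (freq u₁ u₂ m) u₁ = 2 * Real.pi * m 0 := by
  have := inner_freq hd m ![1, 0]
  rw [cellEquiv_apply] at this
  simpa using this

theorem inner_freq_snd (hd : det2 u₁ u₂ ≠ 0) (m : Fin 2 → ℤ) :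
    inner ℝ (freq u₁ u₂ m) u₂ = 2 * Real.pi * m 1 := by
  have := inner_freq hd m ![0, 1]
  rw [cellEquiv_apply] at this
  simpa using this

/-- A vector is determined by its pairings with `u₁ = R*(u₂ - u₁)` and `u₂ = R*(-u₁)`, and the
isometry can be cancelled in these pairings. -/
theorem freq_rotIndex (hd : det2 u₁ u₂ ≠ 0) (h : u₂ = -rot u₁) (m : Fin 2 → ℤ) :
    freq u₁ u₂ (rotIndex m) = rotIso (freq u₁ u₂ m) := by
  have h1 : u₁ = rotIso (u₂ - u₁) := by rw [map_sub, rotIso_fst h, rotIso_snd h]; abel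
  have h2 : u₂ = rotIso (-u₁) := by rw [map_neg, rotIso_fst h, neg_neg]
  refine eq_of_inner_eq hd ?_ ?_
  · have e : inner ℝ (rotIso (freq u₁ u₂ m)) u₁ =
        inner ℝ (rotIso (freq u₁ u₂ m)) (rotIso (u₂ - u₁)) := by rw [← h1]
    rw [e, rotIso.inner_map_map, inner_sub_right, inner_freq_fst hd, inner_freq_fst hd,
      inner_freq_snd hd]
    simp only [rotIndex, Equiv.coe_fn_mk, Matrix.cons_val_zero]
    push_cast; ring
  · have e : inner ℝ (rotIso (freq u₁ u₂ m)) u₂ =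
        inner ℝ (rotIso (freq u₁ u₂ m)) (rotIso (-u₁)) := by rw [← h2]
    rw [e, rotIso.inner_map_map, inner_neg_right, inner_freq_snd hd, inner_freq_fst hd]
    simp only [rotIndex, Equiv.coe_fn_mk, Matrix.cons_val_one, Matrix.cons_val_fin_one]
    push_cast; ring

end Rotation

/-! ### The Schrödinger operator on the cell as an instance of `Fibers`. -/

section CellFibers

variable {u₁ u₂ : Plane}

/-- The integer coordinates of a frequency are its pairings with `u₁`, `u₂` divided by `2π`, so a
bounded set of frequencies is finite. -/
theorem tendsto_norm_freq (hd : det2 u₁ u₂ ≠ 0) :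
    Tendsto (fun m => ‖freq u₁ u₂ m‖) cofinite atTop := by
  refine tendsto_atTop.2 fun M => ?_
  rw [eventually_cofinite]
  set N : ℤ := ⌈M * (‖u₁‖ + ‖u₂‖)⌉ with hN
  refine (finite_Icc (fun _ : Fin 2 => -N) (fun _ => N)).subset fun m hm => ?_
  simp only [mem_ofPred_eq, not_le] at hm
  have hM := Int.le_ceil (M * (‖u₁‖ + ‖u₂‖))
  have h1 := abs_real_inner_le_norm (freq u₁ u₂ m) u₁
  have h2 := abs_real_inner_le_norm (freq u₁ u₂ m) u₂
  rw [inner_freq_fst hd, abs_mul, abs_of_pos (by positivity)] at h1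
  rw [inner_freq_snd hd, abs_mul, abs_of_pos (by positivity)] at h2
  have h3 := Real.pi_gt_three
  have key : ∀ r v : ℝ, 2 * Real.pi * |r| ≤ ‖freq u₁ u₂ m‖ * v → 0 ≤ v → v ≤ ‖u₁‖ + ‖u₂‖ →
      |r| ≤ (N : ℝ) := fun r v h hv hv' => by
    refine le_trans ?_ hM
    calc |r| ≤ 2 * Real.pi * |r| := by nlinarith [abs_nonneg r]
      _ ≤ ‖freq u₁ u₂ m‖ * v := h
      _ ≤ M * (‖u₁‖ + ‖u₂‖) := by
        have := (norm_nonneg (freq u₁ u₂ m)).trans hm.le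
        gcongr
  have k0 := abs_le.1 (key _ _ h1 (norm_nonneg _) (le_add_of_nonneg_right (norm_nonneg _)))
  have k1 := abs_le.1 (key _ _ h2 (norm_nonneg _) (le_add_of_nonneg_left (norm_nonneg _)))
  constructor <;> intro i <;> fin_cases i
  · exact_mod_cast k0.1
  · exact_mod_cast k1.1
  · exact_mod_cast k0.2
  · exact_mod_cast k1.2

theorem mulOp_symm {Vb : Plane →ᵇ ℂ} (hreal : ∀ x, conj (Vb x) = Vb x) :
    (mulOp u₁ u₂ Vb : L2Cell u₁ u₂ →ₗ[ℂ] L2Cell u₁ u₂).IsSymmetric := by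
  intro f g
  change ⟪mulOp u₁ u₂ Vb f, g⟫_ℂ = ⟪f, mulOp u₁ u₂ Vb g⟫_ℂ
  rw [inner_eq_integral, inner_eq_integral]
  refine integral_congr_ae ?_
  filter_upwards [coeFn_mulOp Vb f, coeFn_mulOp Vb g] with x h1 h2
  rw [h1, h2, map_mul, hreal]; ring

/-- The fibers of the Schrödinger operator with potential `Vb` on the cell. -/
def cellFibers (hd : det2 u₁ u₂ ≠ 0) {Vb : Plane →ᵇ ℂ} (hreal : ∀ x, conj (Vb x) = Vb x) :
    Fibers (Fin 2 → ℤ) (L2Cell u₁ u₂) where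
  e := fourierBasis hd
  K := freq u₁ u₂
  W := mulOp u₁ u₂ Vb
  c := ‖mulOp u₁ u₂ Vb‖ + 1
  tendsto := tendsto_norm_freq hd
  symm := mulOp_symm hreal
  one_le := le_add_of_nonneg_left (norm_nonneg _)
  norm_lt := lt_add_one _

theorem periodic_latticeVec {α : Type*} {f : Plane → α} (h1 : ∀ x, f (x + u₁) = f x)
    (h2 : ∀ x, f (x + u₂) = f x) (x : Plane) (m : Fin 2 → ℤ) :
    f (x + latticeVec u₁ u₂ m) = f x := by
  let A : AddSubgroup Plane :=
    { carrier := {v | ∀ x, f (x + v) = f x}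
      zero_mem' := fun x => by rw [add_zero]
      add_mem' := fun {v w} hv hw x => by rw [← add_assoc, hw, hv]
      neg_mem' := fun {v} hv x => by
        have := hv (x + -v)
        rw [neg_add_cancel_right] at this
        exact this.symm }
  have : latticeVec u₁ u₂ m ∈ A := by
    rw [latticeVec_apply, Int.cast_smul_eq_zsmul, Int.cast_smul_eq_zsmul]
    exact A.add_mem (A.zsmul_mem h1 _) (A.zsmul_mem h2 _)
  exact this x

theorem exists_boundedContinuous (hd : det2 u₁ u₂ ≠ 0) {V : Plane → ℝ} (hV : Continuous V)
    (h1 : ∀ x, V (x + u₁) = V x) (h2 : ∀ x, V (x + u₂) = V x) :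
    ∃ Vb : Plane →ᵇ ℂ, ∀ x, Vb x = V x := by
  obtain ⟨C, hC⟩ := ((isCompact_univ_pi fun _ : Fin 2 =>
    isCompact_Icc (a := (-(1 / 2) : ℝ)) (b := 1 / 2)).image
      (cellEquiv hd).continuous).exists_bound_of_continuousOn hV.continuousOn
  refine ⟨BoundedContinuousFunction.ofNormedAddCommGroup (fun x => (V x : ℂ))
    (Complex.continuous_ofReal.comp hV) C fun x => ?_, fun x => rfl⟩
  rw [Complex.norm_real]
  have h := periodic_latticeVec h1 h2 (foldCell hd x) (cellIndex hd x)
  rw [foldCell, sub_add_cancel] at h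
  rw [h]
  refine hC _ ⟨(cellEquiv hd).symm (foldCell hd x), fun i _ => ?_,
    (cellEquiv hd).apply_symm_apply _⟩
  rw [symm_foldCell]
  have h3 := Int.fract_lt_one ((cellEquiv hd).symm x i + 1 / 2)
  have h4 := Int.fract_nonneg ((cellEquiv hd).symm x i + 1 / 2)
  constructor <;> linarith

/-- Translating by `v` multiplies this matrix element by a phase different from `1`. Thus the extra
period `v₁` of the potential makes the folding sectors invariant. -/
theorem inner_mulOp_eq_zero (hd : det2 u₁ u₂ ≠ 0) {Vb : Plane →ᵇ ℂ}
    (hV : ∀ x m, Vb (x + latticeVec u₁ u₂ m) = Vb x) {v : Plane} (hv : ∀ x, Vb (x + v) = Vb x)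
    {m n : Fin 2 → ℤ} (hmn : planeWave (freq u₁ u₂ n) v ≠ planeWave (freq u₁ u₂ m) v) :
    ⟪mulOp u₁ u₂ Vb (fourierBasis hd n), fourierBasis hd m⟫_ℂ = 0 := by
  set G : Plane → ℂ := fun x => conj (Vb x * fourierFun u₁ u₂ n x) * fourierFun u₁ u₂ m x with hG
  have h1 : ⟪mulOp u₁ u₂ Vb (fourierBasis hd n), fourierBasis hd m⟫_ℂ =
      ∫ x in cell u₁ u₂, G x := by
    rw [fourierBasis_apply, fourierBasis_apply, inner_eq_integral]
    refine integral_congr_ae ?_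
    filter_upwards [coeFn_mulOp Vb (fourierVec u₁ u₂ n),
      (memLp_fourierFun (u₁ := u₁) (u₂ := u₂) n).coeFn_toLp,
      (memLp_fourierFun (u₁ := u₁) (u₂ := u₂) m).coeFn_toLp] with x h1 h2 h3
    rw [h1, fourierVec, fourierVec, h2, h3]
  have hper : ∀ x k, G (x + latticeVec u₁ u₂ k) = G x := fun x k => by
    simp only [hG, hV, fourierFun_add_latticeVec hd]
  have h2 := setIntegral_cell_comp_add hd hper v
  have h3 : ∀ x, G (x + v) =
      (conj (planeWave (freq u₁ u₂ n) v) * planeWave (freq u₁ u₂ m) v) * G x := fun x => by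
    simp only [hG, hv, fourierFun, planeWave_add_right, map_mul]
    ring
  simp only [h3, integral_const_mul] at h2
  rw [h1]
  by_contra h0
  have h4 := mul_right_cancel₀ h0 (h2.trans (one_mul _).symm)
  apply hmn
  have h5 := planeWave_neg_mul (freq u₁ u₂ n) v
  rw [conj_planeWave] at h4
  calc planeWave (freq u₁ u₂ n) v
      = planeWave (freq u₁ u₂ n) v *
        (planeWave (-freq u₁ u₂ n) v * planeWave (freq u₁ u₂ m) v) := by rw [h4, mul_one]
    _ = planeWave (-freq u₁ u₂ n) v * planeWave (freq u₁ u₂ n) v * planeWave (freq u₁ u₂ m) v := by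
        ring
    _ = _ := by rw [h5, one_mul]

/-- The indices of the plane waves with prescribed phase under the translation by `v`. -/
def phaseSector (u₁ u₂ v : Plane) (ξ : ℂ) : Set (Fin 2 → ℤ) :=
  {m | planeWave (freq u₁ u₂ m) v = ξ}

theorem disjoint_phaseSector {v : Plane} {ξ ξ' : ℂ} (h : ξ ≠ ξ') :
    Disjoint (phaseSector u₁ u₂ v ξ) (phaseSector u₁ u₂ v ξ') :=
  disjoint_left.2 fun _ h1 h2 => h (h1.symm.trans h2)

theorem mulOp_sectorProj (hd : det2 u₁ u₂ ≠ 0) {Vb : Plane →ᵇ ℂ}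
    (hreal : ∀ x, conj (Vb x) = Vb x) (hV : ∀ x m, Vb (x + latticeVec u₁ u₂ m) = Vb x)
    {v : Plane} (hv : ∀ x, Vb (x + v) = Vb x) (ξ : ℂ) (F : L2Cell u₁ u₂) :
    mulOp u₁ u₂ Vb (sectorProj (fourierBasis hd) (phaseSector u₁ u₂ v ξ) F) =
      sectorProj (fourierBasis hd) (phaseSector u₁ u₂ v ξ) (mulOp u₁ u₂ Vb F) := by
  refine commute_sectorProj _ (fun x y => mulOp_symm hreal x y) _ (fun m n hm hn => ?_) F
  have hne : planeWave (freq u₁ u₂ n) v ≠ planeWave (freq u₁ u₂ m) v := fun h =>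
    hn (h.trans hm)
  exact ⟨inner_mulOp_eq_zero hd hV hv hne, inner_mulOp_eq_zero hd hV hv hne.symm⟩

theorem cellInner_eq_inner {k : Plane} {f g : Plane → ℂ} (hf : MemL2k u₁ u₂ k f)
    (hg : MemL2k u₁ u₂ k g) : cellInner u₁ u₂ f g = ⟪cellClass hf, cellClass hg⟫_ℂ := by
  rw [inner_eq_integral, cellInner]
  refine integral_congr_ae ?_
  filter_upwards [coeFn_cellClass hf, coeFn_cellClass hg] with x h1 h2
  rw [h1, h2, map_mul, conj_planeWave, neg_neg]
  linear_combination (-conj (f x) * g x) * planeWave_neg_mul k x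

section Dictionary

variable (hd : det2 u₁ u₂ ≠ 0) {V : Plane → ℝ} {Vb : Plane →ᵇ ℂ} (hVb : ∀ x, Vb x = V x)
  (hreal : ∀ x, conj (Vb x) = Vb x) (hV : ∀ x m, Vb (x + latticeVec u₁ u₂ m) = Vb x)
include hVb hV

/-- From here on weak eigenmodes on the plane can be handled as modes of the abstract fibers. -/
theorem isEigenmode_quasiExt_iff (k : Plane) (E : ℝ) (F : L2Cell u₁ u₂) :
    IsEigenmode u₁ u₂ V k E (quasiExt hd k F) ↔ (cellFibers hd hreal).IsMode k E F := by
  have h := isWeakSolution_quasiExt_iff hd k Vb hVb hV E F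
  exact ⟨fun h1 => h.1 h1.equation, fun h1 => ⟨memL2k_quasiExt hd k F, h.2 h1⟩⟩

theorem IsEigenmode.isMode {k : Plane} {E : ℝ} {f : Plane → ℂ}
    (h : IsEigenmode u₁ u₂ V k E f) : (cellFibers hd hreal).IsMode k E (cellClass h.mem) := by
  refine (isEigenmode_quasiExt_iff hd hVb hreal hV k E _).1 ⟨memL2k_quasiExt hd k _, ?_⟩
  exact (IsWeakSolution.congr (ae_eq_quasiExt hd h.mem)).1 h.equation

end Dictionary

end CellFibers

/-! ### Matrix elements of the velocity and splitting of a pair. -/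

namespace Fibers

variable {ι H : Type*} [TopologicalSpace ι] [DiscreteTopology ι]
  [NormedAddCommGroup H] [InnerProductSpace ℂ H] [CompleteSpace H] (D : Fibers ι H)

theorem drift_add (l l' : Plane) : D.drift (l + l') = D.drift l + D.drift l' := by
  ext m
  simp only [drift_apply, BoundedContinuousFunction.add_apply, inner_add_left]
  push_cast; ring

theorem drift_smul (r : ℝ) (l : Plane) : D.drift (r • l) = (r : ℂ) • D.drift l := by
  ext m
  simp only [drift_apply, BoundedContinuousFunction.smul_apply, real_inner_smul_left, smul_eq_mul]
  push_cast; ring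

theorem B_add (l l' : Plane) (x : H) : D.B (l + l') x = D.B l x + D.B l' x := by
  simp only [B_apply, drift_add, map_add, add_apply]

theorem B_smul (r : ℝ) (l : Plane) (x : H) : D.B (r • l) x = (r : ℂ) • D.B l x := by
  simp only [B_apply, drift_smul, map_smul, smul_apply]

/-- The Fourier series of `⟪x, -2i l·∇ y⟫`; the symmetry arguments reindex it. -/
theorem mul_inner_B {E : ℝ} {y : H} (hy : D.IsMode 0 E y) (l : Plane) (x : H) :
    ((E + D.c : ℝ) : ℂ) * ⟪x, D.B l y⟫_ℂ =
      ∑' m, ((2 * inner ℝ l (D.K m) : ℝ) : ℂ) * (conj (D.e.repr x m) * D.e.repr y m) := by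
  rw [← D.e.tsum_inner_mul_inner, ← tsum_mul_left]
  refine tsum_congr fun m => ?_
  rw [← inner_conj_symm x, ← D.e.repr_apply_apply, ← D.e.repr_apply_apply]
  linear_combination conj (D.e.repr x m) * D.repr_B hy l m

theorem isMode_smul {k : Plane} {E : ℝ} {x : H} (hx : D.IsMode k E x) (a : ℂ) :
    D.IsMode k E (a • x) := by
  rw [isMode_iff] at hx ⊢
  rw [map_smul, smul_comm, hx]

theorem isMode_add {k : Plane} {E : ℝ} {x y : H} (hx : D.IsMode k E x) (hy : D.IsMode k E y) :
    D.IsMode k E (x + y) := by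
  rw [isMode_iff] at hx hy ⊢
  rw [map_add, smul_add, hx, hy]

/-- A two by two matrix with zero diagonal and real off-diagonal entry `σ` has eigenvectors `(x ±
y)/√2` with eigenvalues `±σ`. The sign `ε` selects the one that is continued; the other plays the
role of `b` in `exists_branch`. -/
theorem exists_branch_of_pair {s : Set ι}
    (hW : ∀ x, D.W (sectorProj D.e s x) = sectorProj D.e s (D.W x)) {x y : H}
    (hxs : sectorProj D.e s x = x) (hys : sectorProj D.e s y = y)
    (hx1 : ⟪x, x⟫_ℂ = 1) (hy1 : ⟪y, y⟫_ℂ = 1) (hxy : ⟪x, y⟫_ℂ = 0) {E : ℝ}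
    (hx : D.IsMode 0 E x) (hy : D.IsMode 0 E y)
    (hker : ∀ z, D.IsMode 0 E z → sectorProj D.e s z = z → ∃ α β : ℂ, z = α • x + β • y)
    {l : Plane} {σ : ℝ} (hσ : σ ≠ 0) (hxx : ((E + D.c : ℝ) : ℂ) * ⟪x, D.B l x⟫_ℂ = 0)
    (hyy : ((E + D.c : ℝ) : ℂ) * ⟪y, D.B l y⟫_ℂ = 0)
    (hBxy : ((E + D.c : ℝ) : ℂ) * ⟪x, D.B l y⟫_ℂ = σ)
    (hByx : ((E + D.c : ℝ) : ℂ) * ⟪y, D.B l x⟫_ℂ = σ) {ε : ℝ} (hε : ε * ε = 1) :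
    ∃ (ν : ℝ → ℝ) (h : ℝ → H), AnalyticAt ℝ ν 0 ∧ AnalyticAt ℝ h 0 ∧ ν 0 = ε * σ ∧
      D.S 0 (h 0) = ((1 / Real.sqrt 2 : ℝ) : ℂ) • (x + (ε : ℂ) • y) ∧
      ∀ᶠ t in 𝓝 0, D.IsMode (t • l) (E + t * ν t) (D.S 0 (h t)) ∧
        sectorProj D.e s (D.S 0 (h t)) = D.S 0 (h t) := by
  have hyx : ⟪y, x⟫_ℂ = 0 := by rw [← inner_conj_symm, hxy, map_zero]
  have hx0 : x ≠ 0 := fun h0 => by rw [h0, inner_zero_left] at hx1; exact zero_ne_one hx1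
  have hκ : ((E + D.c : ℝ) : ℂ) ≠ 0 := Complex.ofReal_ne_zero.2 (hx.energy_pos hx0).ne'
  have hr : (((1 / Real.sqrt 2 : ℝ)) : ℂ) * ((1 / Real.sqrt 2 : ℝ) : ℂ) = 1 / 2 := by
    rw [← Complex.ofReal_mul, div_mul_div_comm, Real.mul_self_sqrt (by norm_num)]
    push_cast; norm_num
  set r : ℂ := ((1 / Real.sqrt 2 : ℝ) : ℂ) with hrdef
  have hrr : conj r = r := Complex.conj_ofReal _
  have hεε : (ε : ℂ) * ε = 1 := by rw [← Complex.ofReal_mul, hε, Complex.ofReal_one]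
  have hBxx : ⟪x, D.B l x⟫_ℂ = 0 := (mul_eq_zero.1 hxx).resolve_left hκ
  have hByy : ⟪y, D.B l y⟫_ℂ = 0 := (mul_eq_zero.1 hyy).resolve_left hκ
  have hBB : ⟪x, D.B l y⟫_ℂ = ⟪y, D.B l x⟫_ℂ := mul_left_cancel₀ hκ (hBxy.trans hByx.symm)
  refine D.exists_branch hW (a := r • (x + (ε : ℂ) • y)) (b := r • (x - (ε : ℂ) • y))
    (νa := ε * σ) (νb := -(ε * σ)) ?_ ?_ ?_ ?_ ?_ ?_ ?_ ?_ ?_ ?_ ?_ ?_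
  · simp only [map_smul, map_add, hxs, hys]
  · simp only [map_smul, map_sub, hxs, hys]
  · simp only [inner_smul_left, inner_smul_right, inner_add_left, inner_add_right, hx1, hy1, hxy,
      hyx, Complex.conj_ofReal, hrr]
    linear_combination 2 * hr + r * r * hεε
  · simp only [inner_smul_left, inner_smul_right, inner_sub_left, inner_sub_right, hx1, hy1, hxy,
      hyx, Complex.conj_ofReal, hrr]
    linear_combination 2 * hr + r * r * hεε
  · simp only [inner_smul_left, inner_smul_right, inner_add_left, inner_sub_right, hx1, hy1, hxy,
      hyx, Complex.conj_ofReal, hrr]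
    linear_combination - r * r * hεε
  · exact D.isMode_smul (D.isMode_add hx (D.isMode_smul hy _)) _
  · have := D.isMode_smul (D.isMode_add hx (D.isMode_smul hy (-(ε : ℂ)))) r
    rwa [neg_smul, ← sub_eq_add_neg] at this
  · intro z hz hzs
    obtain ⟨α, β, rfl⟩ := hker z hz hzs
    refine ⟨r * (α + β * ε), r * (α - β * ε), ?_⟩
    have e1 : α = r * (α + β * ε) * r + r * (α - β * ε) * r := by
      linear_combination (-2 * α) * hr
    have e2 : β = r * (α + β * ε) * r * ε - r * (α - β * ε) * r * ε := by
      linear_combination (-2 * β * ε * ε) * hr - β * hεε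
    calc α • x + β • y = (r * (α + β * ε) * r + r * (α - β * ε) * r) • x +
          (r * (α + β * ε) * r * ε - r * (α - β * ε) * r * ε) • y := by rw [← e1, ← e2]
      _ = _ := by module
  · intro h
    have h1 : ε * σ = 0 := by linarith
    rcases mul_eq_zero.1 h1 with h2 | h2
    · rw [h2] at hε; norm_num at hε
    · exact hσ h2
  · simp only [map_smul, map_add, inner_smul_left, inner_smul_right, inner_add_left,
      inner_add_right, hBxx, hByy, Complex.conj_ofReal, hrr]
    rw [Complex.ofReal_mul]
    linear_combination (r * r * ε) * hBxy + (r * r * ε) * hByx + (2 * ε * σ) * hr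
  · simp only [map_smul, map_sub, inner_smul_left, inner_smul_right, inner_sub_left,
      inner_sub_right, hBxx, hByy, Complex.conj_ofReal, hrr]
    rw [Complex.ofReal_neg, Complex.ofReal_mul]
    linear_combination (-r * r * ε) * hBxy - (r * r * ε) * hByx - (2 * ε * σ) * hr
  · simp only [map_smul, map_add, inner_smul_left, inner_smul_right, inner_sub_left,
      inner_add_right, hBxx, hByy, Complex.conj_ofReal, hrr]
    linear_combination (r * r * ε) * hBB

end Fibers

theorem HilbertBasis.inner_eq_tsum {ι H : Type*} [NormedAddCommGroup H] [InnerProductSpace ℂ H]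
    (e : HilbertBasis ι ℂ H) (x y : H) : ⟪x, y⟫_ℂ = ∑' m, conj (e.repr x m) * e.repr y m := by
  rw [← e.tsum_inner_mul_inner]
  refine tsum_congr fun m => ?_
  rw [← inner_conj_symm x, ← e.repr_apply_apply, ← e.repr_apply_apply]

/-- Reindexing the inner product by `ρ` multiplies it by `conj ξ * ζ`. -/
theorem inner_eq_zero_of_symmetry {ι H : Type*} [NormedAddCommGroup H] [InnerProductSpace ℂ H]
    (e : HilbertBasis ι ℂ H) (ρ : ι ≃ ι) {x y : H} {ξ ζ : ℂ}
    (hx : ∀ m, e.repr x (ρ m) = ξ * e.repr x m) (hy : ∀ m, e.repr y (ρ m) = ζ * e.repr y m)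
    (h : conj ξ * ζ ≠ 1) : ⟪x, y⟫_ℂ = 0 := by
  have h1 : ⟪x, y⟫_ℂ = conj ξ * ζ * ⟪x, y⟫_ℂ := by
    conv_lhs => rw [HilbertBasis.inner_eq_tsum e, ← ρ.tsum_eq]
    rw [HilbertBasis.inner_eq_tsum e, ← tsum_mul_left]
    refine tsum_congr fun m => ?_
    rw [hx, hy, map_mul]; ring
  by_contra h0
  exact h (mul_right_cancel₀ h0 (h1.symm.trans (one_mul _).symm))

namespace Fibers

variable {ι H : Type*} [TopologicalSpace ι] [DiscreteTopology ι]
  [NormedAddCommGroup H] [InnerProductSpace ℂ H] [CompleteSpace H] (D : Fibers ι H)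

/-- The value is linear in `l` and unchanged when `l` is rotated. Summing over `l`, `R* l`, `R*² l`,
whose total is zero, gives three times the value. -/
theorem inner_B_eq_zero_of_rotation (ρ : ι ≃ ι) (hρ : ∀ m, D.K (ρ m) = rotIso (D.K m)) {x : H}
    {ξ : ℂ} (hξ : conj ξ * ξ = 1) (hx : ∀ m, D.e.repr x (ρ m) = ξ * D.e.repr x m) {E : ℝ}
    (hm : D.IsMode 0 E x) (l : Plane) : ((E + D.c : ℝ) : ℂ) * ⟪x, D.B l x⟫_ℂ = 0 := by
  have h1 : ∀ l, ((E + D.c : ℝ) : ℂ) * ⟪x, D.B (rotIso l) x⟫_ℂ =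
      ((E + D.c : ℝ) : ℂ) * ⟪x, D.B l x⟫_ℂ := fun l => by
    rw [D.mul_inner_B hm, D.mul_inner_B hm, ← ρ.tsum_eq]
    refine tsum_congr fun m => ?_
    rw [hρ, rotIso.inner_map_map, hx, map_mul]
    linear_combination (((2 * inner ℝ l (D.K m) : ℝ) : ℂ) * conj (D.e.repr x m) * D.e.repr x m) * hξ
  have h2 : l + rotIso l + rotIso (rotIso l) = (0 : ℝ) • l := by rw [rot_rot]; module
  have h3 := congrArg (fun v => ((E + D.c : ℝ) : ℂ) * ⟪x, D.B v x⟫_ℂ) h2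
  simp only [B_add, B_smul, inner_add_right, inner_smul_right, Complex.ofReal_zero, zero_mul,
    mul_add, mul_zero] at h3
  rw [h1, h1, h1] at h3
  linear_combination h3 / 3

theorem mul_inner_B_symm {x y : H} {E : ℝ} (hx : D.IsMode 0 E x) (hy : D.IsMode 0 E y)
    (l : Plane) : ((E + D.c : ℝ) : ℂ) * ⟪y, D.B l x⟫_ℂ =
      conj (((E + D.c : ℝ) : ℂ) * ⟪x, D.B l y⟫_ℂ) := by
  rw [D.mul_inner_B hx, D.mul_inner_B hy, Complex.conj_tsum]
  refine tsum_congr fun m => ?_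
  rw [map_mul, map_mul, Complex.conj_ofReal, Complex.conj_conj]; ring

theorem inner_eq_zero_of_isMode {k : Plane} {E E' : ℝ} {x y : H} (hx : D.IsMode k E x)
    (hy : D.IsMode k E' y) (hE : E ≠ E') : ⟪x, y⟫_ℂ = 0 := by
  rw [isMode_iff] at hx hy
  have hs : ⟪D.S k x, y⟫_ℂ = ⟪x, D.S k y⟫_ℂ := D.S_symm k x y
  have h1 : ⟪x, y⟫_ℂ = ((E + D.c : ℝ) : ℂ) * ⟪D.S k x, y⟫_ℂ := by
    conv_lhs => rw [← hx]
    rw [inner_smul_left, Complex.conj_ofReal]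
  have h2 : ⟪x, y⟫_ℂ = ((E' + D.c : ℝ) : ℂ) * ⟪D.S k x, y⟫_ℂ := by
    conv_lhs => rw [← hy]
    rw [inner_smul_right, hs]
  have h3 : (((E - E' : ℝ)) : ℂ) * ⟪D.S k x, y⟫_ℂ = 0 := by
    push_cast at h1 h2 ⊢
    linear_combination h2 - h1
  rw [h1, (mul_eq_zero.1 h3).resolve_left (Complex.ofReal_ne_zero.2 (sub_ne_zero.2 hE)), mul_zero]

end Fibers

/-! ### The cube root of unity. -/

section Tau

theorem tau_eq : tau = ((-(1 / 2) : ℝ) : ℂ) + ((Real.sqrt 3 / 2 : ℝ) : ℂ) * Complex.I := by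
  have h : (2 * Real.pi / 3 : ℂ) = ((Real.pi - Real.pi / 3 : ℝ) : ℂ) := by push_cast; ring
  rw [tau, h, Complex.exp_mul_I, ← Complex.ofReal_cos, ← Complex.ofReal_sin, Real.cos_pi_sub,
    Real.sin_pi_sub, Real.cos_pi_div_three, Real.sin_pi_div_three]

theorem conj_tau_mul_tau : conj tau * tau = 1 := by
  have h3 : ((Real.sqrt 3 / 2 : ℝ) : ℂ) * ((Real.sqrt 3 / 2 : ℝ) : ℂ) = 3 / 4 := by
    rw [← Complex.ofReal_mul, div_mul_div_comm, Real.mul_self_sqrt (by norm_num)]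
    push_cast; norm_num
  rw [tau_eq]
  simp only [map_add, map_mul, Complex.conj_ofReal, Complex.conj_I]
  set s := ((Real.sqrt 3 / 2 : ℝ) : ℂ)
  push_cast
  linear_combination h3 - s * s * Complex.I_sq

theorem conj_tau_ne_tau : conj tau ≠ tau := by
  intro h
  have h1 : tau.im = Real.sqrt 3 / 2 := by
    rw [tau_eq, Complex.add_im, Complex.ofReal_im, Complex.im_ofReal_mul, Complex.I_im]; ring
  have h2 := Complex.conj_eq_iff_im.1 h
  have h3 : 0 < Real.sqrt 3 := Real.sqrt_pos.2 (by norm_num)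
  linarith

theorem conj_tau_mul_conj_tau_ne_one : conj tau * conj tau ≠ 1 := by
  intro h
  apply conj_tau_ne_tau
  calc conj tau = conj tau * (conj tau * tau) := by rw [conj_tau_mul_tau, mul_one]
    _ = conj tau * conj tau * tau := by ring
    _ = tau := by rw [h, one_mul]

end Tau

/-! ### Weak gradients of modes and the velocity operator. -/

section Gradient

variable {u₁ u₂ : Plane} (hd : det2 u₁ u₂ ≠ 0) {Vb : Plane →ᵇ ℂ}
  (hreal : ∀ x, conj (Vb x) = Vb x)

/-- The derivative has multiplier `i K_i`, which is `i/2` times the multiplier `2 e_i·K` realized on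
modes by `(E + c) B`. -/
theorem weakPartial_ae_eq_quasiExt {f : Plane → ℂ} (hf : MemL2k u₁ u₂ 0 f) {E : ℝ}
    (hm : (cellFibers hd hreal).IsMode 0 E (cellClass hf)) (i : Fin 2) :
    weakPartial i f =ᵐ[volume] quasiExt hd 0 ((Complex.I / 2 *
      ((E + (cellFibers hd hreal).c : ℝ) : ℂ)) •
        (cellFibers hd hreal).B (basisVec i) (cellClass hf)) := by
  set D := cellFibers hd hreal
  refine weakPartial_ae_eq (locallyIntegrable_quasiExt hd 0 _) ?_
  have h : IsWeakDeriv univ (fun _ : Fin 1 => i) (quasiExt hd 0 (cellClass hf))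
      (quasiExt hd 0 ((Complex.I / 2 * ((E + D.c : ℝ) : ℂ)) •
        D.B (basisVec i) (cellClass hf))) := by
    refine isWeakDeriv_quasiExt hd 0 univ _ fun m => ?_
    have h1 := D.repr_B hm (basisVec i) m
    have h2 : inner ℝ (basisVec i) (D.K m) = freq u₁ u₂ m i := by
      rw [real_inner_comm, inner_basisVec]; rfl
    rw [h2] at h1
    rw [map_smul, lp.coeFn_smul, Pi.smul_apply, smul_eq_mul, Fin.prod_univ_one, zero_add]
    change _ * D.e.repr _ m = _ * D.e.repr _ m
    push_cast at h1 ⊢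
    linear_combination (Complex.I / 2) * h1
  exact h.congr_left (ae_restrict_of_ae (ae_eq_quasiExt hd hf).symm)

theorem cellInner_weakPartial {f g : Plane → ℂ} (hf : MemL2k u₁ u₂ 0 f)
    (hg : MemL2k u₁ u₂ 0 g) {E : ℝ}
    (hm : (cellFibers hd hreal).IsMode 0 E (cellClass hf)) (i : Fin 2) :
    cellInner u₁ u₂ g (weakPartial i f) = Complex.I / 2 *
      (((E + (cellFibers hd hreal).c : ℝ) : ℂ) *
        ⟪cellClass hg, (cellFibers hd hreal).B (basisVec i) (cellClass hf)⟫_ℂ) := by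
  set F := (Complex.I / 2 * ((E + (cellFibers hd hreal).c : ℝ) : ℂ)) •
        (cellFibers hd hreal).B (basisVec i) (cellClass hf) with hF
  have h1 : cellInner u₁ u₂ g (weakPartial i f) = cellInner u₁ u₂ g (quasiExt hd 0 F) := by
    refine integral_congr_ae (ae_restrict_of_ae ?_)
    filter_upwards [weakPartial_ae_eq_quasiExt hd hreal hf hm i] with x hx
    rw [hx]
  rw [h1, cellInner_eq_inner hg (memL2k_quasiExt hd 0 F), cellClass_quasiExt, hF,
    inner_smul_right, mul_assoc]

/-- For `g = φ₁` and `f = φ₂` the left side is that of `PhaseNormalized`, which thereby becomes a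
statement about `B`. -/
theorem sum_mul_cellInner_weakPartial {f g : Plane → ℂ} (hf : MemL2k u₁ u₂ 0 f)
    (hg : MemL2k u₁ u₂ 0 g) {E : ℝ}
    (hm : (cellFibers hd hreal).IsMode 0 E (cellClass hf)) (r : Plane) :
    -2 * Complex.I * ∑ i : Fin 2, (r i : ℂ) * cellInner u₁ u₂ g (weakPartial i f) =
      ((E + (cellFibers hd hreal).c : ℝ) : ℂ) *
        ⟪cellClass hg, (cellFibers hd hreal).B r (cellClass hf)⟫_ℂ := by
  have hr : r = r 0 • basisVec 0 + r 1 • basisVec 1 := by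
    ext i; fin_cases i <;> simp [basisVec]
  conv_rhs => rw [hr]
  rw [Fibers.B_add, Fibers.B_smul, Fibers.B_smul, inner_add_right, inner_smul_right,
    inner_smul_right, Fin.sum_univ_two, cellInner_weakPartial hd hreal hf hg hm,
    cellInner_weakPartial hd hreal hf hg hm]
  set X := ((E + (cellFibers hd hreal).c : ℝ) : ℂ)
  set A := ⟪cellClass hg, (cellFibers hd hreal).B (basisVec 0) (cellClass hf)⟫_ℂ
  set A' := ⟪cellClass hg, (cellFibers hd hreal).B (basisVec 1) (cellClass hf)⟫_ℂ
  linear_combination (-(r 0 : ℂ) * X * A - (r 1 : ℂ) * X * A') * Complex.I_sq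

end Gradient

/-! ### The two pairs of degenerate modes and their four branches. -/

section Modes

variable {u₁ u₂ : Plane}

theorem sectorProj_of_translation (hd : det2 u₁ u₂ ≠ 0) {f : Plane → ℂ} (hf : MemL2k u₁ u₂ 0 f)
    {v : Plane} {ξ : ℂ} (h : ∀ᵐ x, f (x + v) = ξ * f x) :
    sectorProj (fourierBasis hd) (phaseSector u₁ u₂ v ξ) (cellClass hf) = cellClass hf := by
  refine (sectorProj_eq_self_iff _ _ _).2 fun m hm => ?_
  have h1 := repr_of_translation hd hf h m
  by_contra h0
  exact hm (mul_right_cancel₀ h0 h1)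

theorem repr_of_rotation (hd : det2 u₁ u₂ ≠ 0) (hrot : u₂ = -rot u₁) {f : Plane → ℂ}
    (hf : MemL2k u₁ u₂ 0 f) {ξ : ℂ} (h : ∀ᵐ x, f (rot x) = ξ * f x) (m : Fin 2 → ℤ) :
    (fourierBasis hd).repr (cellClass hf) (rotIndex m) =
      ξ * (fourierBasis hd).repr (cellClass hf) m :=
  repr_of_isometry hd hf rotIso (det2_rotIso hd hrot) (lattice_rotIso hrot) h
    (freq_rotIndex hd hrot m)

theorem coeFn_combination (x y : L2Cell u₁ u₂) (r ε : ℂ) :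
    (r • (x + ε • y) : L2Cell u₁ u₂) =ᵐ[volume.restrict (cell u₁ u₂)]
      fun z => r * (x z + ε * y z) := by
  filter_upwards [Lp.coeFn_smul r (x + ε • y), Lp.coeFn_add x (ε • y), Lp.coeFn_smul ε y]
    with z h1 h2 h3
  rw [h1, Pi.smul_apply, h2, Pi.add_apply, h3, Pi.smul_apply, smul_eq_mul, smul_eq_mul]

theorem coeFn_cellClass_zero {f : Plane → ℂ} (hf : MemL2k u₁ u₂ 0 f) :
    cellClass hf =ᵐ[volume.restrict (cell u₁ u₂)] f := by
  filter_upwards [coeFn_cellClass hf] with x hx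
  rw [hx, neg_zero, planeWave_zero_left, one_mul]

theorem cellClass_eq_sum {f : Plane → ℂ} (hf : MemL2k u₁ u₂ 0 f) {g : Fin 4 → Plane → ℂ}
    (hg : ∀ l, MemL2k u₁ u₂ 0 (g l)) {c : Fin 4 → ℂ} (h : ∀ᵐ x, f x = ∑ l, c l * g l x) :
    cellClass hf = (c 0 • cellClass (hg 0) + c 1 • cellClass (hg 1)) +
      (c 2 • cellClass (hg 2) + c 3 • cellClass (hg 3)) := by
  refine Lp.ext ?_
  filter_upwards [coeFn_cellClass_zero hf, ae_restrict_of_ae h, coeFn_cellClass_zero (hg 0),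
    coeFn_cellClass_zero (hg 1), coeFn_cellClass_zero (hg 2), coeFn_cellClass_zero (hg 3),
    Lp.coeFn_smul (c 0) (cellClass (hg 0)), Lp.coeFn_smul (c 1) (cellClass (hg 1)),
    Lp.coeFn_smul (c 2) (cellClass (hg 2)), Lp.coeFn_smul (c 3) (cellClass (hg 3)),
    Lp.coeFn_add (c 0 • cellClass (hg 0)) (c 1 • cellClass (hg 1)),
    Lp.coeFn_add (c 2 • cellClass (hg 2)) (c 3 • cellClass (hg 3)),
    Lp.coeFn_add (c 0 • cellClass (hg 0) + c 1 • cellClass (hg 1))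
      (c 2 • cellClass (hg 2) + c 3 • cellClass (hg 3))] with x h1 h2 a0 a1 a2 a3 b0 b1 b2 b3 d1 d2 d3
  rw [h1, h2, d3, Pi.add_apply, d1, d2, Pi.add_apply, Pi.add_apply, b0, b1, b2, b3,
    Pi.smul_apply, Pi.smul_apply, Pi.smul_apply, Pi.smul_apply, a0, a1, a2, a3,
    Fin.sum_univ_four]
  simp only [smul_eq_mul]
  ring

/-- The four analytic branches of modes emanating from the degenerate modes. -/
theorem exists_mode_branches {V : Plane → ℝ} (hV : IsSuperHoneycombPotential u₁ u₂ V)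
    {nStar : ℕ} {ED : ℝ} {φ₁ : Plane → ℂ} (hdeg : FourfoldDegeneracy u₁ u₂ V nStar ED φ₁)
    (hv : fermiVelocity u₁ u₂ φ₁ ≠ 0) {l : Plane} (hl : l ≠ 0)
    (hphase : PhaseNormalized u₁ u₂ φ₁ l) (hd : det2 u₁ u₂ ≠ 0) {Vb : Plane →ᵇ ℂ}
    (hVb : ∀ x, Vb x = V x) (hreal : ∀ x, conj (Vb x) = Vb x)
    (hVp : ∀ x m, Vb (x + latticeVec u₁ u₂ m) = Vb x) :
    ∃ (ν : Fin 4 → ℝ → ℝ) (h : Fin 4 → ℝ → L2Cell u₁ u₂),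
      (∀ j, AnalyticAt ℝ (ν j) 0) ∧ (∀ j, AnalyticAt ℝ (h j) 0) ∧
      (∀ j, ν j 0 = slopeSign j * fermiVelocity u₁ u₂ φ₁ * ‖l‖) ∧
      (∀ j, (cellFibers hd hreal).S 0 (h j 0) =ᵐ[volume.restrict (cell u₁ u₂)]
        leadingMode φ₁ j) ∧
      (∀ j, ‖(cellFibers hd hreal).S 0 (h j 0)‖ = 1) ∧
      ∀ᶠ t in 𝓝 (0 : ℝ),
        (∀ j, (cellFibers hd hreal).IsMode (t • l) (ED + t * ν j t)
          ((cellFibers hd hreal).S 0 (h j t))) ∧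
        ∀ i j, i ≠ j → ⟪(cellFibers hd hreal).S 0 (h i t),
          (cellFibers hd hreal).S 0 (h j t)⟫_ℂ = 0 := by
  set D := cellFibers hd hreal with hD
  have hDe : D.e = fourierBasis hd := rfl
  let M : Fin 4 → L2Cell u₁ u₂ := fun j => cellClass (hdeg.eigen j).mem
  have hmode : ∀ j, D.IsMode 0 ED (M j) := fun j =>
    (hdeg.eigen j).isMode hd hVb hreal hVp
  set s := phaseSector u₁ u₂ (foldFst u₁ u₂) tau with hs
  set s' := phaseSector u₁ u₂ (foldFst u₁ u₂) (conj tau) with hs'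
  have hss : Disjoint s s' := disjoint_phaseSector conj_tau_ne_tau.symm
  have hfold : ∀ x, Vb (x + foldFst u₁ u₂) = Vb x := fun x => by rw [hVb, hVb, hV.fold_fst]
  have hW : ∀ x, D.W (sectorProj D.e s x) = sectorProj D.e s (D.W x) :=
    mulOp_sectorProj hd hreal hVp hfold tau
  have hW' : ∀ x, D.W (sectorProj D.e s' x) = sectorProj D.e s' (D.W x) :=
    mulOp_sectorProj hd hreal hVp hfold (conj tau)
  have p0 : sectorProj D.e s (M 0) = M 0 :=
    sectorProj_of_translation hd (hdeg.eigen 0).mem hdeg.chi_one.fold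
  have p1 : sectorProj D.e s (M 1) = M 1 :=
    sectorProj_of_translation hd (hdeg.eigen 1).mem hdeg.chi_two.fold
  have p2 : sectorProj D.e s' (M 2) = M 2 :=
    sectorProj_of_translation hd (hdeg.eigen 2).mem hdeg.chi_three.fold
  have p3 : sectorProj D.e s' (M 3) = M 3 :=
    sectorProj_of_translation hd (hdeg.eigen 3).mem hdeg.chi_four.fold
  have q0 : ∀ m, D.e.repr (M 0) (rotIndex m) = tau * D.e.repr (M 0) m :=
    repr_of_rotation hd hV.lattice (hdeg.eigen 0).mem hdeg.chi_one.rotation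
  have q1 : ∀ m, D.e.repr (M 1) (rotIndex m) = conj tau * D.e.repr (M 1) m :=
    repr_of_rotation hd hV.lattice (hdeg.eigen 1).mem hdeg.chi_two.rotation
  have q2 : ∀ m, D.e.repr (M 2) (rotIndex m) = tau * D.e.repr (M 2) m :=
    repr_of_rotation hd hV.lattice (hdeg.eigen 2).mem hdeg.chi_three.rotation
  have q3 : ∀ m, D.e.repr (M 3) (rotIndex m) = conj tau * D.e.repr (M 3) m :=
    repr_of_rotation hd hV.lattice (hdeg.eigen 3).mem hdeg.chi_four.rotation
  -- All coefficients come from those of `φ₁` by inverting indices and conjugating, so norms and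
  -- velocity entries need to be known for the first pair only.
  have c2 : ∀ m, D.e.repr (M 2) m = D.e.repr (M 0) (-m) :=
    repr_comp_neg hd (hdeg.eigen 0).mem (hdeg.eigen 2).mem
  have c3 : ∀ m, D.e.repr (M 3) m = conj (D.e.repr (M 0) (-m)) :=
    repr_conj hd (hdeg.eigen 0).mem (hdeg.eigen 3).mem
  have c1 : ∀ m, D.e.repr (M 1) m = conj (D.e.repr (M 0) m) := fun m => by
    have h := repr_conj hd (hdeg.eigen 2).mem (hdeg.eigen 1).mem m
    have h' := c2 (-m)
    rw [neg_neg] at h'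
    rw [← h']
    exact h
  have n0 : ⟪M 0, M 0⟫_ℂ = 1 := by
    rw [← cellInner_eq_inner]
    exact hdeg.normalized
  have n1 : ⟪M 1, M 1⟫_ℂ = 1 := by
    rw [← n0, HilbertBasis.inner_eq_tsum D.e, HilbertBasis.inner_eq_tsum D.e]
    refine tsum_congr fun m => ?_
    rw [c1, Complex.conj_conj, mul_comm]
  have n2 : ⟪M 2, M 2⟫_ℂ = 1 := by
    rw [← n0, HilbertBasis.inner_eq_tsum D.e, HilbertBasis.inner_eq_tsum D.e,
      ← (Equiv.neg (Fin 2 → ℤ)).tsum_eq]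
    refine tsum_congr fun m => ?_
    simp only [Equiv.neg_apply, c2, neg_neg]
  have n3 : ⟪M 3, M 3⟫_ℂ = 1 := by
    rw [← n0, HilbertBasis.inner_eq_tsum D.e, HilbertBasis.inner_eq_tsum D.e,
      ← (Equiv.neg (Fin 2 → ℤ)).tsum_eq]
    refine tsum_congr fun m => ?_
    simp only [Equiv.neg_apply, c3, neg_neg, Complex.conj_conj, mul_comm]
  have o01 : ⟪M 0, M 1⟫_ℂ = 0 :=
    inner_eq_zero_of_symmetry D.e rotIndex q0 q1 conj_tau_mul_conj_tau_ne_one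
  have o23 : ⟪M 2, M 3⟫_ℂ = 0 :=
    inner_eq_zero_of_symmetry D.e rotIndex q2 q3 conj_tau_mul_conj_tau_ne_one
  have hρ : ∀ m, D.K (rotIndex m) = rotIso (D.K m) := freq_rotIndex hd hV.lattice
  have hτ : conj (conj tau) * conj tau = 1 := by
    rw [Complex.conj_conj, mul_comm, conj_tau_mul_tau]
  have b0 := D.inner_B_eq_zero_of_rotation rotIndex hρ conj_tau_mul_tau q0 (hmode 0) l
  have b1 := D.inner_B_eq_zero_of_rotation rotIndex hρ hτ q1 (hmode 1) l
  have b2 := D.inner_B_eq_zero_of_rotation rotIndex hρ conj_tau_mul_tau q2 (hmode 2) l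
  have b3 := D.inner_B_eq_zero_of_rotation rotIndex hρ hτ q3 (hmode 3) l
  set σ : ℝ := fermiVelocity u₁ u₂ φ₁ * ‖l‖ with hσ
  have hl' : ‖l‖ ≠ 0 := norm_ne_zero_iff.2 hl
  have hσ0 : σ ≠ 0 := mul_ne_zero hv hl'
  have hσ0' : -σ ≠ 0 := neg_ne_zero.2 hσ0
  -- The phase normalization is used at `r = l`, where the determinant vanishes.
  have b01 : ((ED + D.c : ℝ) : ℂ) * ⟪M 0, D.B l (M 1)⟫_ℂ = σ := by
    have h := sum_mul_cellInner_weakPartial hd hreal (hdeg.eigen 1).mem (hdeg.eigen 0).mem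
      (hmode 1) l
    refine h.symm.trans ((hphase l).trans ?_)
    have h0 : det2 l l = 0 := by simp only [det2]; ring
    rw [h0, real_inner_self_eq_norm_sq, hσ, Complex.ofReal_zero, zero_mul, sub_zero,
      ← Complex.ofReal_mul]
    congr 1
    field_simp
  have b10 : ((ED + D.c : ℝ) : ℂ) * ⟪M 1, D.B l (M 0)⟫_ℂ = σ := by
    rw [D.mul_inner_B_symm (hmode 0) (hmode 1), b01, Complex.conj_ofReal]
  -- The second pair is obtained from the first by inverting the frequencies, which reverses the
  -- sign of the velocity.
  have b23 : ((ED + D.c : ℝ) : ℂ) * ⟪M 2, D.B l (M 3)⟫_ℂ = ((-σ : ℝ) : ℂ) := by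
    rw [Complex.ofReal_neg, ← b01, D.mul_inner_B (hmode 3), D.mul_inner_B (hmode 1),
      ← (Equiv.neg (Fin 2 → ℤ)).tsum_eq, ← tsum_neg]
    refine tsum_congr fun m => ?_
    have : D.K (-m) = -D.K m := freq_neg m
    simp only [Equiv.neg_apply, c2, c3, c1, neg_neg, this, inner_neg_right]
    push_cast; ring
  have b32 : ((ED + D.c : ℝ) : ℂ) * ⟪M 3, D.B l (M 2)⟫_ℂ = ((-σ : ℝ) : ℂ) := by
    rw [D.mul_inner_B_symm (hmode 2) (hmode 3), b23, Complex.conj_ofReal]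
  have hspan : ∀ z, D.IsMode 0 ED z → ∃ c : Fin 4 → ℂ,
      z = (c 0 • M 0 + c 1 • M 1) + (c 2 • M 2 + c 3 • M 3) := fun z hz => by
    have hq := (isEigenmode_quasiExt_iff hd hVb hreal hVp 0 ED z).2 hz
    obtain ⟨c, hc⟩ := hdeg.spanning _ hq
    refine ⟨c, ?_⟩
    rw [← cellClass_quasiExt hd 0 z]
    exact cellClass_eq_sum _ (fun l => (hdeg.eigen l).mem) hc
  have hproj : ∀ {t t' : Set (Fin 2 → ℤ)}, Disjoint t t' → ∀ y, sectorProj D.e t' y = y →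
      sectorProj D.e t y = 0 := fun {t t'} htt y hy => by
    refine repr_ext D.e fun m => ?_
    rw [repr_sectorProj, map_zero, lp.coeFn_zero, Pi.zero_apply]
    by_cases hm : m ∈ t
    · rw [(sectorProj_eq_self_iff D.e t' y).1 hy m (disjoint_left.1 htt hm), mul_zero]
    · rw [indicator_of_notMem hm, zero_mul]
  -- Projecting the spanning relation on the sector removes the other pair.
  have hk : ∀ z, D.IsMode 0 ED z → sectorProj D.e s z = z → ∃ α β : ℂ, z = α • M 0 + β • M 1 :=
    fun z hz hzs => by
      obtain ⟨c, hc⟩ := hspan z hz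
      refine ⟨c 0, c 1, ?_⟩
      rw [hc] at hzs ⊢
      simp only [map_add, map_smul, p0, p1, hproj hss _ p2, hproj hss _ p3, smul_zero,
        add_zero] at hzs
      exact hzs.symm
  have hk' : ∀ z, D.IsMode 0 ED z → sectorProj D.e s' z = z →
      ∃ α β : ℂ, z = α • M 2 + β • M 3 := fun z hz hzs => by
      obtain ⟨c, hc⟩ := hspan z hz
      refine ⟨c 2, c 3, ?_⟩
      rw [hc] at hzs ⊢
      simp only [map_add, map_smul, p2, p3, hproj hss.symm _ p0, hproj hss.symm _ p1, smul_zero,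
        add_zero, zero_add] at hzs
      exact hzs.symm
  -- The off-diagonal entries being `σ` and `-σ`, the slopes `-, -, +, +` correspond to `ε = -1, 1,
  -- -1, 1` with the pairs first, second, second, first.
  obtain ⟨ν0, h0, an0, ah0, e0, f0, ev0⟩ := D.exists_branch_of_pair hW p0 p1 n0 n1 o01 (hmode 0)
    (hmode 1) hk hσ0 b0 b1 b01 b10 (ε := -1) (by norm_num)
  obtain ⟨ν1, h1, an1, ah1, e1, f1, ev1⟩ := D.exists_branch_of_pair hW' p2 p3 n2 n3 o23 (hmode 2)
    (hmode 3) hk' hσ0' b2 b3 b23 b32 (ε := 1) (by norm_num)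
  obtain ⟨ν2, h2, an2, ah2, e2, f2, ev2⟩ := D.exists_branch_of_pair hW' p2 p3 n2 n3 o23 (hmode 2)
    (hmode 3) hk' hσ0' b2 b3 b23 b32 (ε := -1) (by norm_num)
  obtain ⟨ν3, h3, an3, ah3, e3, f3, ev3⟩ := D.exists_branch_of_pair hW p0 p1 n0 n1 o01 (hmode 0)
    (hmode 1) hk hσ0 b0 b1 b01 b10 (ε := 1) (by norm_num)
  have hr : (((1 / Real.sqrt 2 : ℝ)) : ℂ) * ((1 / Real.sqrt 2 : ℝ) : ℂ) = 1 / 2 := by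
    rw [← Complex.ofReal_mul, div_mul_div_comm, Real.mul_self_sqrt (by norm_num)]
    push_cast; norm_num
  have hlead : ∀ {x y : L2Cell u₁ u₂} {ε : ℝ}, ε * ε = 1 → ⟪x, x⟫_ℂ = 1 → ⟪y, y⟫_ℂ = 1 →
      ⟪x, y⟫_ℂ = 0 → ‖((1 / Real.sqrt 2 : ℝ) : ℂ) • (x + (ε : ℂ) • y)‖ = 1 := by
    intro x y ε hε hx hy hxy
    have hyx : ⟪y, x⟫_ℂ = 0 := by rw [← inner_conj_symm, hxy, map_zero]
    have hεε : (ε : ℂ) * ε = 1 := by rw [← Complex.ofReal_mul, hε, Complex.ofReal_one]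
    have h1 : ⟪((1 / Real.sqrt 2 : ℝ) : ℂ) • (x + (ε : ℂ) • y),
        ((1 / Real.sqrt 2 : ℝ) : ℂ) • (x + (ε : ℂ) • y)⟫_ℂ = 1 := by
      simp only [inner_smul_left, inner_smul_right, inner_add_left, inner_add_right, hx, hy, hxy,
        hyx, Complex.conj_ofReal]
      linear_combination 2 * hr +
        ((1 / Real.sqrt 2 : ℝ) : ℂ) * ((1 / Real.sqrt 2 : ℝ) : ℂ) * hεε
    have h2 : ‖((1 / Real.sqrt 2 : ℝ) : ℂ) • (x + (ε : ℂ) • y)‖ ^ 2 = 1 := by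
      rw [← inner_self_eq_norm_sq (𝕜 := ℂ), h1]; rfl
    exact (pow_eq_one_iff_of_nonneg (norm_nonneg _) two_ne_zero).1 h2
  have hcell : ∀ j, M j =ᵐ[volume.restrict (cell u₁ u₂)] modes φ₁ j := fun j =>
    coeFn_cellClass_zero (hdeg.eigen j).mem
  refine ⟨![ν0, ν1, ν2, ν3], ![h0, h1, h2, h3], ?_, ?_, ?_, ?_, ?_, ?_⟩
  · intro j; fin_cases j
    exacts [an0, an1, an2, an3]
  · intro j; fin_cases j
    exacts [ah0, ah1, ah2, ah3]
  · intro j; fin_cases j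
    · exact e0.trans (by simp [slopeSign, hσ])
    · exact e1.trans (by simp [slopeSign, hσ])
    · exact e2.trans (by simp [slopeSign, hσ])
    · exact e3.trans (by simp [slopeSign, hσ])
  · intro j; fin_cases j
    · change D.S 0 (h0 0) =ᵐ[_] _
      rw [f0]
      filter_upwards [coeFn_combination (M 0) (M 1) ((1 / Real.sqrt 2 : ℝ) : ℂ) ((-1 : ℝ) : ℂ),
        hcell 0, hcell 1] with x a1 a2 a3
      rw [a1, a2, a3]
      simp [leadingMode, sub_eq_add_neg]
    · change D.S 0 (h1 0) =ᵐ[_] _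
      rw [f1]
      filter_upwards [coeFn_combination (M 2) (M 3) ((1 / Real.sqrt 2 : ℝ) : ℂ) ((1 : ℝ) : ℂ),
        hcell 2, hcell 3] with x a1 a2 a3
      rw [a1, a2, a3]
      simp [leadingMode]
    · change D.S 0 (h2 0) =ᵐ[_] _
      rw [f2]
      filter_upwards [coeFn_combination (M 2) (M 3) ((1 / Real.sqrt 2 : ℝ) : ℂ) ((-1 : ℝ) : ℂ),
        hcell 2, hcell 3] with x a1 a2 a3
      rw [a1, a2, a3]
      simp [leadingMode, sub_eq_add_neg]
    · change D.S 0 (h3 0) =ᵐ[_] _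
      rw [f3]
      filter_upwards [coeFn_combination (M 0) (M 1) ((1 / Real.sqrt 2 : ℝ) : ℂ) ((1 : ℝ) : ℂ),
        hcell 0, hcell 1] with x a1 a2 a3
      rw [a1, a2, a3]
      simp [leadingMode]
  · intro j; fin_cases j
    · change ‖D.S 0 (h0 0)‖ = 1
      rw [f0]; exact hlead (by norm_num) n0 n1 o01
    · change ‖D.S 0 (h1 0)‖ = 1
      rw [f1]; exact hlead (by norm_num) n2 n3 o23
    · change ‖D.S 0 (h2 0)‖ = 1
      rw [f2]; exact hlead (by norm_num) n2 n3 o23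
    · change ‖D.S 0 (h3 0)‖ = 1
      rw [f3]; exact hlead (by norm_num) n0 n1 o01
  · have horth : ∀ {x y : L2Cell u₁ u₂}, ⟪x, x⟫_ℂ = 1 → ⟪y, y⟫_ℂ = 1 → ⟪x, y⟫_ℂ = 0 →
        ⟪((1 / Real.sqrt 2 : ℝ) : ℂ) • (x + ((1 : ℝ) : ℂ) • y),
          ((1 / Real.sqrt 2 : ℝ) : ℂ) • (x + ((-1 : ℝ) : ℂ) • y)⟫_ℂ = 0 := by
      intro x y hx hy hxy
      have hyx : ⟪y, x⟫_ℂ = 0 := by rw [← inner_conj_symm, hxy, map_zero]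
      simp only [inner_smul_left, inner_smul_right, inner_add_left, inner_add_right, hx, hy, hxy,
        hyx, Complex.conj_ofReal]
      push_cast; ring
    -- Within a sector the slopes differ, so for `t ≠ 0` the energies differ and the modes are
    -- orthogonal; at `t = 0` orthogonality is explicit.
    have d30 : ∀ᶠ t in 𝓝 (0 : ℝ), ν3 t ≠ ν0 t :=
      ((an3.continuousAt.sub an0.continuousAt).eventually_ne (y := 0) (by
        rw [Pi.sub_apply, e3, e0]; intro h; apply hσ0; linarith)).mono fun t => sub_ne_zero.1
    have d12 : ∀ᶠ t in 𝓝 (0 : ℝ), ν1 t ≠ ν2 t :=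
      ((an1.continuousAt.sub an2.continuousAt).eventually_ne (y := 0) (by
        rw [Pi.sub_apply, e1, e2]; intro h; apply hσ0; linarith)).mono fun t => sub_ne_zero.1
    filter_upwards [ev0, ev1, ev2, ev3, d30, d12] with t ev0 ev1 ev2 ev3 d30 d12
    have r30 : ⟪D.S 0 (h3 t), D.S 0 (h0 t)⟫_ℂ = 0 := by
      by_cases ht : t = 0
      · rw [ht, f3, f0]; exact horth n0 n1 o01
      · refine D.inner_eq_zero_of_isMode ev3.1 ev0.1 fun h => d30 ?_
        exact mul_left_cancel₀ ht (add_left_cancel h)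
    have r12 : ⟪D.S 0 (h1 t), D.S 0 (h2 t)⟫_ℂ = 0 := by
      by_cases ht : t = 0
      · rw [ht, f1, f2]; exact horth n2 n3 o23
      · refine D.inner_eq_zero_of_isMode ev1.1 ev2.1 fun h => d12 ?_
        exact mul_left_cancel₀ ht (add_left_cancel h)
    -- Across sectors the Fourier supports are disjoint, which matters because energies may coincide
    -- there.
    have r01 := inner_eq_zero_of_disjoint D.e hss ev0.2 ev1.2
    have r02 := inner_eq_zero_of_disjoint D.e hss ev0.2 ev2.2
    have r31 := inner_eq_zero_of_disjoint D.e hss ev3.2 ev1.2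
    have r32 := inner_eq_zero_of_disjoint D.e hss ev3.2 ev2.2
    have sym : ∀ {x y : L2Cell u₁ u₂}, ⟪x, y⟫_ℂ = 0 → ⟪y, x⟫_ℂ = 0 := fun {x y} h => by
      rw [← inner_conj_symm, h, map_zero]
    refine ⟨fun j => ?_, fun i j hij => ?_⟩
    · fin_cases j
      exacts [ev0.1, ev1.1, ev2.1, ev3.1]
    · fin_cases i <;> fin_cases j
      exacts [absurd rfl hij, r01, r02, sym r30, sym r01, absurd rfl hij, r12, sym r31, sym r02,
        sym r12, absurd rfl hij, sym r32, r30, r31, r32, absurd rfl hij]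

end Modes

/-! ### Analyticity with values in the Sobolev space. -/

theorem AnalyticAt.bilinear_apply {X E F G : Type*} [NormedAddCommGroup X] [NormedSpace ℝ X]
    [NormedAddCommGroup E] [NormedSpace ℂ E]
    [NormedAddCommGroup F] [NormedSpace ℂ F] [NormedAddCommGroup G] [NormedSpace ℂ G]
    [NormedSpace ℝ E] [IsScalarTower ℝ ℂ E] [NormedSpace ℝ F] [IsScalarTower ℝ ℂ F]
    [NormedSpace ℝ G] [IsScalarTower ℝ ℂ G]
    (T : E →L[ℂ] F →L[ℂ] G) {f : X → E} {g : X → F} {x : X} (hf : AnalyticAt ℝ f x)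
    (hg : AnalyticAt ℝ g x) : AnalyticAt ℝ (fun t => T (f t) (g t)) x :=
  ((T.bilinearRestrictScalars ℝ).analyticAt_bilinear (f x, g x)).comp₂ hf hg

section Evaluation

variable {α : Type*} [TopologicalSpace α]

/-- Evaluation of bounded continuous functions at a point. -/
def bcfEval (x : α) : (α →ᵇ ℂ) →+* ℂ where
  toFun f := f x
  map_one' := rfl
  map_mul' _ _ := rfl
  map_zero' := rfl
  map_add' _ _ := rfl

theorem exp_apply (f : α →ᵇ ℂ) (x : α) : NormedSpace.exp f x = Complex.exp (f x) := by
  have := NormedSpace.map_exp (bcfEval x) (continuous_eval_const x) f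
  rw [← Complex.exp_eq_exp_ℂ] at this
  exact this

end Evaluation

/-- The defining integrals are inner products with fixed `L²` vectors, hence continuous. Closedness
provides the orthogonal projection used in `analyticAt_sobolevH2`. -/
theorem isClosed_sobolevH2 (U : Set Plane) :
    IsClosed (SobolevH2 U : Set (PiLp 2 (fun _ : SobolevIndex => Lp ℂ 2 (volume.restrict U)))) := by
  have hcont : ∀ {ψ : Plane → ℂ}, MemLp ψ 2 (volume.restrict U) → ∀ s : SobolevIndex,
      Continuous fun F : PiLp 2 (fun _ : SobolevIndex => Lp ℂ 2 (volume.restrict U)) =>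
        ∫ x in U, F s x * ψ x := by
    intro ψ hψ s
    have h1 : ∀ F : PiLp 2 (fun _ : SobolevIndex => Lp ℂ 2 (volume.restrict U)),
        ∫ x in U, F s x * ψ x = ⟪hψ.star.toLp _, F s⟫_ℂ := fun F => by
      rw [L2.inner_def]
      refine integral_congr_ae ?_
      filter_upwards [hψ.star.coeFn_toLp] with x hx
      rw [hx, RCLike.inner_apply]
      simp
    simp only [h1]
    exact continuous_const.inner (PiLp.continuous_apply 2 _ s)
  have hset : (SobolevH2 U : Set (PiLp 2 (fun _ : SobolevIndex => Lp ℂ 2 (volume.restrict U)))) =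
      ⋂ (s : SobolevIndex) (φ : Plane → ℂ) (_ : IsTestFunction U φ),
        {F | ∫ x in U, F emptyWord x * wordDeriv s.2 φ x =
          (-1) ^ (s.1 : ℕ) * ∫ x in U, F s x * φ x} := by
    ext F
    simp only [mem_iInter]
    rfl
  rw [hset]
  refine isClosed_iInter fun s => isClosed_iInter fun φ => isClosed_iInter fun hφ => ?_
  have hmem : ∀ {ψ : Plane → ℂ}, IsTestFunction U ψ → MemLp ψ 2 (volume.restrict U) := fun h =>
    (h.smooth.continuous.memLp_of_hasCompactSupport h.compact).restrict U
  exact isClosed_eq (hcont (hmem (hφ.wordDeriv s.2)) emptyWord)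
    (continuous_const.mul (hcont (hmem hφ) s))

/-- A function with values in the Sobolev space is analytic if its components are. -/
theorem analyticAt_sobolevH2 {U : Set Plane} {F : ℝ → SobolevH2 U} {t : ℝ}
    (h : ∀ s, AnalyticAt ℝ (fun t => (F t).1 s) t) : AnalyticAt ℝ F t := by
  have hcomplete : CompleteSpace (SobolevH2 U) := (isClosed_sobolevH2 U).completeSpace_coe
  have h1 : AnalyticAt ℝ (fun t => (F t).1) t := by
    have h2 : AnalyticAt ℝ (fun t => fun s => (F t).1 s) t := AnalyticAt.pi h
    exact ((PiLp.continuousLinearEquiv 2 ℝ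
      (fun _ : SobolevIndex => Lp ℂ 2 (volume.restrict U))).symm.toContinuousLinearMap.analyticAt
        _).comp h2
  -- The projection is the identity on `F`, so composing with it transfers analyticity from the
  -- ambient sum to the subspace.
  have h2 : F = fun t => ((SobolevH2 U).orthogonalProjectionOnto.restrictScalars ℝ) (F t).1 := by
    funext t
    exact ((SobolevH2 U).orthogonalProjectionOnto_mem_subspace_eq_self (F t)).symm
  rw [h2]
  exact (((SobolevH2 U).orthogonalProjectionOnto.restrictScalars ℝ).analyticAt _).comp h1

namespace Fibers

variable {ι H : Type*} [TopologicalSpace ι] [DiscreteTopology ι]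
  [NormedAddCommGroup H] [InnerProductSpace ℂ H] (D : Fibers ι H)

/-- The inverse square root of the symbol. -/
def sqrtRes : ι →ᵇ ℂ :=
  BoundedContinuousFunction.ofNormedAddCommGroupDiscrete
    (fun m => (((Real.sqrt (D.symbol 0 m))⁻¹ : ℝ) : ℂ)) 1 (fun m => by
      rw [Complex.norm_real, Real.norm_of_nonneg (by positivity)]
      exact inv_le_one_of_one_le₀ (Real.one_le_sqrt.2 (D.one_le.trans (D.c_le_symbol 0 m))))

/-- The symbol of a partial derivative divided by the square root of the symbol. -/
def partialRes (i : Fin 2) : ι →ᵇ ℂ :=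
  BoundedContinuousFunction.ofNormedAddCommGroupDiscrete
    (fun m => Complex.I * (D.K m i : ℂ) * (((Real.sqrt (D.symbol 0 m))⁻¹ : ℝ) : ℂ)) 1 (fun m => by
      have hs : 0 < Real.sqrt (D.symbol 0 m) := Real.sqrt_pos.2 (D.symbol_pos 0 m)
      rw [norm_mul, norm_mul, Complex.norm_I, one_mul, Complex.norm_real, Complex.norm_real,
        Real.norm_of_nonneg (inv_pos.2 hs).le, ← div_eq_mul_inv, div_le_one hs]
      refine (PiLp.norm_apply_le (D.K m) i).trans (Real.le_sqrt_of_sq_le ?_)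
      rw [symbol, zero_add]
      exact le_add_of_nonneg_right D.c_pos.le)

/-- The symbol of a derivative along a word at quasi-momentum `t l`, divided by the symbol. -/
def wordRes (l : Plane) {n : ℕ} (w : Fin n → Fin 2) (t : ℝ) : ι →ᵇ ℂ :=
  -- Each derivative uses one factor `symbol^(-1/2)` of the two in the free resolvent, and the `2 -
  -- n` unused ones remain; so the family is polynomial in `t` with bounded coefficients.
  (∏ j, (D.partialRes (w j) + t • ((Complex.I * (l (w j) : ℂ)) • D.sqrtRes))) * D.sqrtRes ^ (2 - n)

theorem wordRes_apply (l : Plane) {n : ℕ} (hn : n ≤ 2) (w : Fin n → Fin 2) (t : ℝ) (m : ι) :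
    D.wordRes l w t m = (∏ j, Complex.I * ((t • l + D.K m) (w j) : ℂ)) * D.res 0 m := by
  have h1 : D.wordRes l w t m = bcfEval m (D.wordRes l w t) := rfl
  have hs : bcfEval m D.sqrtRes = (((Real.sqrt (D.symbol 0 m))⁻¹ : ℝ) : ℂ) := rfl
  have h2 : ∀ i, bcfEval m (D.partialRes i + t • ((Complex.I * (l i : ℂ)) • D.sqrtRes)) =
      Complex.I * ((t • l + D.K m) i : ℂ) * bcfEval m D.sqrtRes := fun i => by
    change Complex.I * (D.K m i : ℂ) * (((Real.sqrt (D.symbol 0 m))⁻¹ : ℝ) : ℂ) +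
      t • ((Complex.I * (l i : ℂ)) * (((Real.sqrt (D.symbol 0 m))⁻¹ : ℝ) : ℂ)) = _
    rw [hs, PiLp.add_apply, PiLp.smul_apply, Complex.real_smul, smul_eq_mul]
    push_cast; ring
  have h3 : D.res 0 m = bcfEval m D.sqrtRes ^ 2 := by
    rw [hs, res_apply, ← Complex.ofReal_pow, inv_pow, Real.sq_sqrt (D.symbol_pos 0 m).le]
  rw [h1, wordRes, map_mul, map_prod, map_pow]
  simp only [h2]
  rw [Finset.prod_mul_distrib, Finset.prod_const, Finset.card_univ, Fintype.card_fin, mul_assoc,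
    ← pow_add, Nat.add_sub_cancel' hn, h3]

theorem analyticAt_wordRes (l : Plane) {n : ℕ} (w : Fin n → Fin 2) (t : ℝ) :
    AnalyticAt ℝ (D.wordRes l w) t := by
  refine AnalyticAt.mul (Finset.analyticAt_fun_prod _ fun j _ => ?_) analyticAt_const
  exact analyticAt_const.add (analyticAt_id.smul analyticAt_const)

end Fibers

/-! ### Lifting Fourier data to quasi-periodic functions in the Sobolev space. -/

section Lift

variable {u₁ u₂ : Plane} (hd : det2 u₁ u₂ ≠ 0) {Vb : Plane →ᵇ ℂ}
  (hreal : ∀ x, conj (Vb x) = Vb x)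

-- The linear phase is unbounded on the plane; truncating it at a level not reached on the cell puts
-- it in the Banach algebra of bounded continuous functions.
include hd in
theorem exists_boundedContinuous_inner (l : Plane) :
    ∃ q : Plane →ᵇ ℂ, ∀ x ∈ cell u₁ u₂, q x = Complex.I * (inner ℝ l x : ℝ) := by
  obtain ⟨K, hK, hsub⟩ := exists_isCompact_cell_subset hd
  obtain ⟨M, hM⟩ := hK.exists_bound_of_continuousOn (f := fun x : Plane => (inner ℝ l x : ℝ))
    (by fun_prop)
  refine ⟨BoundedContinuousFunction.ofNormedAddCommGroup
    (fun x => Complex.I * ((max (-|M|) (min |M| (inner ℝ l x)) : ℝ) : ℂ)) (by fun_prop) |M|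
    (fun x => ?_), fun x hx => ?_⟩
  · rw [norm_mul, Complex.norm_I, one_mul, Complex.norm_real, Real.norm_eq_abs, abs_le]
    exact ⟨le_max_left _ _, max_le (by linarith [abs_nonneg M]) (min_le_left _ _)⟩
  · have h := abs_le.1 ((Real.norm_eq_abs _) ▸ (hM x (hsub hx)).trans (le_abs_self M))
    change Complex.I * ((max (-|M|) (min |M| (inner ℝ l x)) : ℝ) : ℂ) = _
    rw [min_eq_right h.2, max_eq_right h.1]

-- The exponential of that Banach algebra gives the plane wave as an analytic curve in the sup norm,
-- correct on the cell.
include hd in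
theorem exists_analytic_phase (l : Plane) :
    ∃ e : ℝ → Plane →ᵇ ℂ, (∀ t, AnalyticAt ℝ e t) ∧
      ∀ t, ∀ x ∈ cell u₁ u₂, e t x = planeWave (t • l) x := by
  obtain ⟨q, hq⟩ := exists_boundedContinuous_inner hd l
  refine ⟨fun t => NormedSpace.exp (t • q), fun t => ?_, fun t x hx => ?_⟩
  · have h1 : AnalyticAt ℝ (fun t : ℝ => t • q) t := analyticAt_id.smul analyticAt_const
    exact AnalyticAt.fun_comp (g := NormedSpace.exp) (f := fun t : ℝ => t • q)
      (NormedSpace.exp_analytic (𝕂 := ℝ) (t • q)) h1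
  · rw [exp_apply, BoundedContinuousFunction.smul_apply, hq x hx, planeWave, real_inner_smul_left,
      Complex.real_smul]
    congr 1
    push_cast; ring

/-- Analytic families of Fourier data give analytic families of quasi-periodic functions in the
Sobolev space of the cell. -/
theorem exists_sobolev_lift (l : Plane) :
    ∃ J : ℝ → L2Cell u₁ u₂ → SobolevH2 (cell u₁ u₂),
      (∀ t y, Represents (J t y) (quasiExt hd (t • l) ((cellFibers hd hreal).R 0 y))) ∧
      (∀ t, J t 0 = 0) ∧
      ∀ (y : ℝ → L2Cell u₁ u₂) (t : ℝ), AnalyticAt ℝ y t → AnalyticAt ℝ (fun t => J t (y t)) t := by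
  obtain ⟨e, he, hex⟩ := exists_analytic_phase hd l
  set D := cellFibers hd hreal with hD
  have hcomp : ∀ (t : ℝ) (F : L2Cell u₁ u₂),
      mulOp u₁ u₂ (e t) F =ᵐ[volume.restrict (cell u₁ u₂)] quasiExt hd (t • l) F := fun t F => by
    filter_upwards [coeFn_mulOp (e t) F, ae_cell_quasiExt hd (t • l) F,
      ae_restrict_mem (measurableSet_cell hd)] with x h1 h2 h3
    rw [h1, h2, hex t x h3]
  have hempty : ∀ t y, diagOp D.e (D.wordRes l emptyWord.2 t) y = D.R 0 y := fun t y => by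
    refine repr_ext D.e fun m => ?_
    rw [repr_diagOp, D.wordRes_apply l (by simp [emptyWord]), Fibers.R, repr_diagOp]
    have : (∏ j : Fin ((emptyWord.1 : Fin 3) : ℕ),
        Complex.I * ((t • l + D.K m) (emptyWord.2 j) : ℂ)) = 1 := Fin.prod_univ_zero _
    rw [this, one_mul]
  have hmem : ∀ t y, WithLp.toLp 2 (fun s : SobolevIndex =>
      mulOp u₁ u₂ (e t) (diagOp D.e (D.wordRes l s.2 t) y)) ∈ SobolevH2 (cell u₁ u₂) := by
    intro t y s
    have h1 : IsWeakDeriv (cell u₁ u₂) s.2 (quasiExt hd (t • l) (D.R 0 y))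
        (quasiExt hd (t • l) (diagOp D.e (D.wordRes l s.2 t) y)) := by
      refine isWeakDeriv_quasiExt hd (t • l) _ s.2 fun m => ?_
      change D.e.repr _ m = _ * D.e.repr _ m
      rw [repr_diagOp, D.wordRes_apply l (Nat.le_of_lt_succ s.1.2), Fibers.R, repr_diagOp,
        ← mul_assoc]
      rfl
    refine (h1.congr_left ?_).congr_right (hcomp t _).symm
    change _ =ᵐ[_] mulOp u₁ u₂ (e t) (diagOp D.e (D.wordRes l emptyWord.2 t) y)
    rw [hempty]
    exact (hcomp t _).symm
  refine ⟨fun t y => ⟨_, hmem t y⟩, fun t y => ?_, fun t => ?_, fun y t hy => ?_⟩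
  · change mulOp u₁ u₂ (e t) (diagOp D.e (D.wordRes l emptyWord.2 t) y) =ᵐ[_] _
    rw [hempty]
    exact hcomp t _
  · refine Subtype.ext (PiLp.ext fun s => ?_)
    change mulOp u₁ u₂ (e t) (diagOp D.e (D.wordRes l s.2 t) 0) = 0
    rw [map_zero, map_zero]
  · refine analyticAt_sobolevH2 fun s => ?_
    exact AnalyticAt.bilinear_apply _ (he t)
      (AnalyticAt.bilinear_apply _ (D.analyticAt_wordRes l s.2 t) hy)

end Lift

/-! ### Counting modes and stability of the counts. -/

theorem orthonormal_append {H : Type*} [NormedAddCommGroup H] [InnerProductSpace ℂ H] {a b : ℕ}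
    {x : Fin a → H} {y : Fin b → H} (hx : Orthonormal ℂ x) (hy : Orthonormal ℂ y)
    (hxy : ∀ i j, ⟪x i, y j⟫_ℂ = 0) : Orthonormal ℂ (Fin.append x y) := by
  rw [orthonormal_iff_ite] at hx hy ⊢
  intro i j
  refine Fin.addCases (fun i => ?_) (fun i => ?_) i <;>
    refine Fin.addCases (fun j => ?_) (fun j => ?_) j
  · simp only [Fin.append_left, hx, Fin.castAdd_inj]
  · have : Fin.castAdd b i ≠ Fin.natAdd a j := fun h => by
      have := congrArg Fin.val h
      simp at this
      omega
    rw [Fin.append_left, Fin.append_right, hxy, if_neg this]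
  · have : Fin.natAdd a i ≠ Fin.castAdd b j := fun h => by
      have := congrArg Fin.val h
      simp at this
      omega
    rw [Fin.append_left, Fin.append_right, ← inner_conj_symm, hxy, map_zero, if_neg this]
  · simp only [Fin.append_right, hy, Fin.natAdd_inj]

namespace Fibers

variable {ι H : Type*} [TopologicalSpace ι] [DiscreteTopology ι]
  [NormedAddCommGroup H] [InnerProductSpace ℂ H] [CompleteSpace H] (D : Fibers ι H)

/-- There are `n` orthonormal modes at quasi-momentum `k` with energies at most `E`. -/
def HasModes (k : Plane) (n : ℕ) (E : ℝ) : Prop :=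
  ∃ y : Fin n → H, Orthonormal ℂ y ∧ ∀ i, ∃ e ≤ E, D.IsMode k e (y i)

/-- Modes of different energies are orthogonal, so modes of strictly higher energy may be appended
to a given family. -/
theorem HasModes.append {D : Fibers ι H} {k : Plane} {a b : ℕ} {E E' : ℝ} (h : D.HasModes k a E)
    (hE : E ≤ E') {y : Fin b → H} (hy : Orthonormal ℂ y) {θ : Fin b → ℝ}
    (hm : ∀ j, D.IsMode k (θ j) (y j)) (h1 : ∀ j, E < θ j) (h2 : ∀ j, θ j ≤ E') :
    D.HasModes k (a + b) E' := by
  obtain ⟨x, hx, hxe⟩ := h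
  choose e he hxm using hxe
  refine ⟨Fin.append x y, orthonormal_append hx hy fun i j =>
    D.inner_eq_zero_of_isMode (hxm i) (hm j) ((he i).trans_lt (h1 j)).ne, fun i => ?_⟩
  refine Fin.addCases (fun i => ?_) (fun i => ?_) i
  · rw [Fin.append_left]; exact ⟨e i, (he i).trans hE, hxm i⟩
  · rw [Fin.append_right]; exact ⟨θ i, h2 i, hm i⟩

/-- The min-max values inside a spectral gap are given by the known modes in the gap. -/
theorem isLeast_of_modes {k : Plane} {N : ℕ} {E₁ E₂ : ℝ} (hlow : D.HasModes k N E₁)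
    (hup : ¬ D.HasModes k (N + 5) E₂) {y : Fin 4 → H} (hy : Orthonormal ℂ y) {θ : Fin 4 → ℝ}
    (hθ : Monotone θ) (hm : ∀ j, D.IsMode k (θ j) (y j)) (h1 : ∀ j, E₁ < θ j)
    (h2 : ∀ j, θ j ≤ E₂) (j : Fin 4) :
    IsLeast {E | D.HasModes k (N + 1 + (j : ℕ)) E} (θ j) := by
  constructor
  -- The `N` low modes together with the first `j + 1` modes of the window.
  · have hcard : N + 1 + (j : ℕ) = N + ((j : ℕ) + 1) := by omega
    have hj := j.2
    rw [mem_ofPred_eq, hcard]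
    refine hlow.append (h1 j).le
      (y := fun i : Fin ((j : ℕ) + 1) => y ⟨i, by omega⟩)
      (θ := fun i => θ ⟨i, by omega⟩) (hy.comp _ fun a b h => ?_) (fun i => hm _) (fun i => h1 _)
      (fun i => hθ ?_)
    · simpa [Fin.ext_iff] using h
    · rw [Fin.le_def]
      exact Nat.le_of_lt_succ i.2
  · intro E hE
    by_contra hlt
    rw [not_le] at hlt
    have hj := j.2
    -- If `N + 1 + j` modes had energies at most `E < θ j`, the window modes numbered `j` to `3`
    -- would complete them to `N + 5` modes with energies at most `E₂`.
    have hcard : N + 1 + (j : ℕ) + (4 - (j : ℕ)) = N + 5 := by omega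
    refine hup ?_
    rw [← hcard]
    refine HasModes.append hE (hlt.le.trans (h2 j))
      (y := fun i : Fin (4 - (j : ℕ)) => y ⟨(j : ℕ) + i, by omega⟩)
      (θ := fun i => θ ⟨(j : ℕ) + i, by omega⟩) (hy.comp _ fun a b h => ?_) (fun i => hm _)
      (fun i => hlt.trans_le (hθ ?_)) (fun i => h2 _)
    · simpa [Fin.ext_iff] using h
    · rw [Fin.le_def]
      exact Nat.le_add_right _ _

theorem isMode_of_eigenvector {k : Plane} {ν : ℝ} (hν : 0 < ν) {y : H}
    (h : D.S k y = (ν : ℂ) • y) : D.IsMode k (ν⁻¹ - D.c) y := by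
  rw [isMode_iff, h, sub_add_cancel, smul_smul, ← Complex.ofReal_mul, inv_mul_cancel₀ hν.ne',
    Complex.ofReal_one, one_smul]

theorem IsMode.apply_eq {D : Fibers ι H} {k : Plane} {E : ℝ} {y : H} (h : D.IsMode k E y)
    (hy : y ≠ 0) : D.S k y = (((E + D.c)⁻¹ : ℝ) : ℂ) • y := by
  have h1 := h.energy_pos hy
  conv_rhs => rw [← (D.isMode_iff k E y).1 h]
  rw [smul_smul, ← Complex.ofReal_mul, inv_mul_cancel₀ h1.ne', Complex.ofReal_one, one_smul]

/-- The form of `S` is positive on an infinite dimensional space. This makes the sets defining the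
bands nonempty. -/
theorem exists_hasModes [Infinite ι] (k : Plane) (n : ℕ) : ∃ E, D.HasModes k n E := by
  obtain ⟨y, ν, hy, h⟩ := exists_orthonormal_eigenvectors (D.S_compact k) (D.S_symm k) 0 n
    fun Y _ hY => by
      let f := Infinite.natEmbedding ι
      have hli : LinearIndependent ℂ fun i : Fin n => D.e (f i) :=
        (D.e.orthonormal.comp (fun i : Fin n => f i)
          (f.injective.comp Fin.val_injective)).linearIndependent
      have hX : finrank ℂ (Submodule.span ℂ (range fun i : Fin n => D.e (f i))) = n := by
        rw [finrank_span_eq_card hli, Fintype.card_fin]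
      have : FiniteDimensional ℂ (Submodule.span ℂ (range fun i : Fin n => D.e (f i))) :=
        FiniteDimensional.span_of_finite ℂ (finite_range _)
      obtain ⟨x, -, hxY, hx0⟩ := exists_ne_zero_orthogonal (hY.trans_eq hX.symm)
      have hpos := D.re_inner_S_pos k hx0
      have hn : 0 < ‖x‖ ^ 2 := by positivity
      refine ⟨x, hxY, hx0, (⟪D.S k x, x⟫_ℂ).re / ‖x‖ ^ 2, div_pos hpos hn, (div_pos hpos hn).le, ?_⟩
      rw [div_mul_cancel₀ _ hn.ne']
  refine ⟨∑ i, |(ν i)⁻¹ - D.c|, y, hy, fun i =>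
    ⟨(ν i)⁻¹ - D.c, (le_abs_self _).trans ?_, D.isMode_of_eigenvector (h i).1 (h i).2.2⟩⟩
  exact Finset.single_le_sum (f := fun i => |(ν i)⁻¹ - D.c|) (fun i _ => abs_nonneg _)
    (Finset.mem_univ i)

/-- Bounds the sets defining the bands from below, for `n > 0`. -/
theorem energy_bound {k : Plane} {n : ℕ} (hn : 0 < n) {E : ℝ} (h : D.HasModes k n E) :
    0 < E + D.c := by
  obtain ⟨y, hy, hm⟩ := h
  obtain ⟨e, he, hme⟩ := hm ⟨0, hn⟩
  have := hme.energy_pos (hy.ne_zero _)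
  linarith

theorem eventually_norm_sub_le (l : Plane) {ε : ℝ} (hε : 0 < ε) :
    ∀ᶠ t : ℝ in 𝓝 0, ‖D.S (t • l) - D.S 0‖ ≤ ε := by
  have h := (D.continuousAt_S l).sub (continuousAt_const (y := D.S 0))
  have h2 := h.norm
  have h3 := h2.eventually_le_const (u := ε) (by simpa using hε)
  simpa using h3

/-- On the span of the given modes the form of `S 0` is at least `1/(E + c)` times the squared norm;
closeness in norm leaves `1/(E' + c)` for `S (t l)`, and min-max returns `N` modes. -/
theorem eventually_hasModes {N : ℕ} (hN : 0 < N) {E E' : ℝ} (h : D.HasModes 0 N E) (hE : E < E')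
    (l : Plane) : ∀ᶠ t : ℝ in 𝓝 0, D.HasModes (t • l) N E' := by
  have hpos := D.energy_bound hN h
  obtain ⟨y, hy, hm⟩ := h
  choose e he hme using hm
  have hpos' : 0 < E' + D.c := by linarith
  have hlt : (E' + D.c)⁻¹ < (E + D.c)⁻¹ := inv_strictAnti₀ hpos (by linarith)
  filter_upwards [D.eventually_norm_sub_le l (sub_pos.2 hlt)] with t ht
  obtain ⟨z, ν, hz, hν⟩ := exists_orthonormal_eigenvectors (D.S_compact (t • l)) (D.S_symm (t • l))
    (E' + D.c)⁻¹ N fun Y _ hY => by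
      have hX : finrank ℂ (Submodule.span ℂ (range y)) = N := by
        rw [finrank_span_eq_card hy.linearIndependent, Fintype.card_fin]
      have : FiniteDimensional ℂ (Submodule.span ℂ (range y)) :=
        FiniteDimensional.span_of_finite ℂ (finite_range _)
      obtain ⟨x, hxX, hxY, hx0⟩ := exists_ne_zero_orthogonal (hY.trans_eq hX.symm)
      refine ⟨x, hxY, hx0, (E' + D.c)⁻¹, inv_pos.2 hpos', le_rfl, ?_⟩
      obtain ⟨c, rfl⟩ := (Submodule.mem_span_range_iff_exists_fun ℂ).1 hxX
      obtain ⟨q1, q2⟩ := inner_apply_of_eigenvectors hy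
        (fun i => (hme i).apply_eq (hy.ne_zero i)) c
      have q3 : (E + D.c)⁻¹ * ‖∑ i, c i • y i‖ ^ 2 ≤
          (⟪D.S 0 (∑ i, c i • y i), ∑ i, c i • y i⟫_ℂ).re := by
        rw [q1, q2, Finset.mul_sum]
        refine Finset.sum_le_sum fun i _ => ?_
        gcongr
        · exact (hme i).energy_pos (hy.ne_zero i)
        · exact he i
      have q4 := re_inner_apply_le_add (S := D.S 0) (T := D.S (t • l))
        ((norm_sub_rev _ _).trans_le ht) (∑ i, c i • y i)
      nlinarith
  refine ⟨z, hz, fun i => ⟨(ν i)⁻¹ - D.c, ?_, D.isMode_of_eigenvector (hν i).1 (hν i).2.2⟩⟩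
  have := inv_anti₀ (inv_pos.2 hpos') (hν i).2.1
  rw [inv_inv] at this
  linarith

/-- Let `M < n` be such that `M`, but not `M + 1`, orthonormal eigenvectors of `S 0` have
eigenvalues at least `μ = 1/(E + c)`. On their complement the form of `S (t l)` stays below the
midpoint of `μ` and `1/(E' + c)`, so at most `M` modes have energy up to `E'`. -/
theorem eventually_not_hasModes {n : ℕ} {E E' : ℝ} (h : ¬ D.HasModes 0 n E) (hE : E' < E)
    (hpos : 0 < E' + D.c) (l : Plane) : ∀ᶠ t : ℝ in 𝓝 0, ¬ D.HasModes (t • l) n E' := by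
  have hpos' : 0 < E + D.c := by linarith
  set μ := (E + D.c)⁻¹ with hμ
  have hμ0 : 0 < μ := inv_pos.2 hpos'
  let P : ℕ → Prop := fun M => ∃ (x : Fin M → H) (ν : Fin M → ℝ), Orthonormal ℂ x ∧
    ∀ i, μ ≤ ν i ∧ D.S 0 (x i) = (ν i : ℂ) • x i
  have hPn : ¬ P n := by
    rintro ⟨x, ν, hx, hν⟩
    refine h ⟨x, hx, fun i => ⟨(ν i)⁻¹ - D.c, ?_,
      D.isMode_of_eigenvector (hμ0.trans_le (hν i).1) (hν i).2⟩⟩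
    have := inv_anti₀ hμ0 (hν i).1
    rw [hμ, inv_inv] at this
    linarith
  have hP0 : P 0 := ⟨Fin.elim0, Fin.elim0, by
    constructor
    · intro i; exact i.elim0
    · intro i; exact i.elim0, fun i => i.elim0⟩
  obtain ⟨M, hMn, hM, hM1⟩ : ∃ M, M < n ∧ P M ∧ ¬ P (M + 1) := by
    by_contra! hcon
    have : ∀ M ≤ n, P M := by
      intro M
      induction M with
      | zero => exact fun _ => hP0
      | succ M ih => exact fun hM => hcon M hM (ih (Nat.le_of_succ_le hM))
    exact hPn (this n le_rfl)
  obtain ⟨x, ν, hx, hν⟩ := hM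
  have hform := inner_le_on_orthogonal_of_maximal (D.S_compact 0) (D.S_symm 0) hx hμ0 hν
    fun y ν' hy hyν => hM1 ⟨y, ν', hy, hyν⟩
  have hlt : μ < (E' + D.c)⁻¹ := inv_strictAnti₀ hpos (by linarith)
  filter_upwards [D.eventually_norm_sub_le l (half_pos (sub_pos.2 hlt))] with t ht
  rintro ⟨y, hy, hm⟩
  choose e he hme using hm
  have hle := card_le_of_inner_le_on_orthogonal (S := D.S (t • l)) (x := x)
    (μ := μ + ((E' + D.c)⁻¹ - μ) / 2) (y := y) (ν := fun i => (e i + D.c)⁻¹) (fun z hz => by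
      have h1 := re_inner_apply_le_add ht z
      have h2 := hform z hz
      linarith) hy (fun i => ⟨by
      have h1 : (E' + D.c)⁻¹ ≤ (e i + D.c)⁻¹ :=
        inv_anti₀ ((hme i).energy_pos (hy.ne_zero i)) (by linarith [he i])
      linarith, (hme i).apply_eq (hy.ne_zero i)⟩)
  omega

end Fibers

theorem edgeDual_ne_zero {u₁ u₂ : Plane} (hd : det2 u₁ u₂ ≠ 0) {a₁ b₁ : ℤ}
    (hab : IsCoprime a₁ b₁) : edgeDual u₁ u₂ a₁ b₁ ≠ 0 := by
  intro h
  obtain ⟨h1, h2, h3, h4⟩ := dual_inner hd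
  have e1 : inner ℝ (edgeDual u₁ u₂ a₁ b₁) u₁ = -(b₁ : ℝ) * (2 * Real.pi) := by
    rw [edgeDual, inner_add_left, real_inner_smul_left, real_inner_smul_left, h1, h3]; ring
  have e2 : inner ℝ (edgeDual u₁ u₂ a₁ b₁) u₂ = (a₁ : ℝ) * (2 * Real.pi) := by
    rw [edgeDual, inner_add_left, real_inner_smul_left, real_inner_smul_left, h2, h4]; ring
  have hpi : (2 * Real.pi) ≠ 0 := by positivity
  rw [h, inner_zero_left] at e1 e2
  have hb : b₁ = 0 := by
    have := (mul_eq_zero.1 e1.symm).resolve_right hpi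
    exact_mod_cast neg_eq_zero.1 this
  have ha : a₁ = 0 := by
    have := (mul_eq_zero.1 e2.symm).resolve_right hpi
    exact_mod_cast this
  rw [ha, hb] at hab
  exact not_isCoprime_zero_zero hab

/-- Normalizing the image of an analytic curve under a bounded operator is analytic. -/
theorem analyticAt_inv_norm_smul {H : Type*} [NormedAddCommGroup H] [InnerProductSpace ℂ H] [CompleteSpace H]
    (L : H →L[ℂ] H) {f : ℝ → H} {t : ℝ} (hf : AnalyticAt ℝ f t) (h0 : L (f t) ≠ 0) :
    AnalyticAt ℝ (fun t => ((‖L (f t)‖⁻¹ : ℝ) : ℂ) • f t) t := by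
  have h1 : AnalyticAt ℝ (fun t => L (f t)) t :=
    ((L.restrictScalars ℝ).analyticAt _).comp hf
  have h2 : AnalyticAt ℝ (fun t => ‖L (f t)‖) t := by
    have := (h1.contDiffAt (n := ω)).norm ℂ h0
    exact this.analyticAt
  have h3 := (h2.inv (norm_ne_zero_iff.2 h0)).smul hf
  refine h3.congr (Eventually.of_forall fun t => ?_)
  exact (Complex.coe_smul _ _).symm

/-- An analytic curve vanishing at the origin is bounded by a multiple of the parameter. -/
theorem exists_bound_of_analyticAt {E : Type*} [NormedAddCommGroup E] [NormedSpace ℝ E]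
    {f : ℝ → E} (hf : AnalyticAt ℝ f 0) (h0 : f 0 = 0) :
    ∃ C : ℝ, ∀ᶠ t in 𝓝 (0 : ℝ), ‖f t‖ ≤ C * |t| := by
  have h := hf.differentiableAt.isBigO_sub
  simp only [h0, sub_zero] at h
  obtain ⟨C, hC⟩ := h.bound
  exact ⟨C, hC.mono fun t ht => by rwa [Real.norm_eq_abs] at ht⟩

/-! ### Identification of the bands with the branches. -/

section Bands

variable {u₁ u₂ : Plane} (hd : det2 u₁ u₂ ≠ 0) {V : Plane → ℝ} {Vb : Plane →ᵇ ℂ}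
  (hVb : ∀ x, Vb x = V x) (hreal : ∀ x, conj (Vb x) = Vb x)
  (hV : ∀ x m, Vb (x + latticeVec u₁ u₂ m) = Vb x)

theorem cellOrthonormal_quasiExt {k : Plane} {n : ℕ} {y : Fin n → L2Cell u₁ u₂}
    (hy : Orthonormal ℂ y) : CellOrthonormal u₁ u₂ fun i => quasiExt hd k (y i) := by
  intro i j
  rw [cellInner_eq_inner (memL2k_quasiExt hd k _) (memL2k_quasiExt hd k _), cellClass_quasiExt,
    cellClass_quasiExt]
  exact orthonormal_iff_ite.1 hy i j

include hVb hV

/-- The energy bands are the min-max values of the family of fibers. -/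
theorem band_eq_sInf (n : ℕ) (k : Plane) :
    band u₁ u₂ V n k = sInf {E | (cellFibers hd hreal).HasModes k n E} := by
  unfold band
  congr 1
  ext E
  simp only [mem_ofPred_eq]
  constructor
  · rintro ⟨f, hf, hm⟩
    choose e he hme using hm
    refine ⟨fun i => cellClass (hme i).mem, orthonormal_iff_ite.2 fun i j => ?_, fun i =>
      ⟨e i, he i, (hme i).isMode hd hVb hreal hV⟩⟩
    rw [← cellInner_eq_inner]
    exact hf i j
  · rintro ⟨y, hy, hm⟩
    refine ⟨fun i => quasiExt hd k (y i), cellOrthonormal_quasiExt hd hy, fun i => ?_⟩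
    obtain ⟨e, he, hme⟩ := hm i
    exact ⟨e, he, (isEigenmode_quasiExt_iff hd hVb hreal hV k e (y i)).2 hme⟩

/-- Near a fourfold degeneracy the bands are given by any four orthonormal modes with energies in
a fixed window. -/
theorem eventually_band_eq {nStar : ℕ} {ED : ℝ} (h1 : 1 ≤ nStar)
    (hbelow : band u₁ u₂ V nStar 0 < ED) (habove : ED < band u₁ u₂ V (nStar + 5) 0) (l : Plane) :
    ∃ E₁ E₂ : ℝ, E₁ < ED ∧ ED < E₂ ∧ ∀ᶠ t : ℝ in 𝓝 0,
      ∀ (y : Fin 4 → L2Cell u₁ u₂) (θ : Fin 4 → ℝ), Orthonormal ℂ y →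
        (∀ j, (cellFibers hd hreal).IsMode (t • l) (θ j) (y j)) →
        (∀ j, θ j ∈ Ioo E₁ E₂) → ∃ σ : Equiv.Perm (Fin 4), ∀ j : Fin 4,
          band u₁ u₂ V (nStar + 1 + (j : ℕ)) (t • l) = θ (σ j) := by
  set D := cellFibers hd hreal with hD
  rw [band_eq_sInf hd hVb hreal hV] at hbelow habove
  obtain ⟨E, hE, hlt⟩ := exists_lt_of_csInf_lt (D.exists_hasModes 0 nStar) hbelow
  obtain ⟨E', hE1, hE2⟩ := exists_between habove
  have hnot : ¬ D.HasModes 0 (nStar + 5) E' := fun h => hE2.not_ge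
    (csInf_le ⟨-D.c, fun x hx => by linarith [D.energy_bound (Nat.succ_pos _) hx]⟩ h)
  have hpos := D.energy_bound h1 hE
  obtain ⟨E₁, ha, hb⟩ := exists_between hlt
  obtain ⟨E₂, hc, hd'⟩ := exists_between hE1
  refine ⟨E₁, E₂, hb, hc, ?_⟩
  filter_upwards [D.eventually_hasModes h1 hE ha l,
    D.eventually_not_hasModes hnot hd' (by linarith) l] with t hlow hup y θ hy hm hθ
  refine ⟨Tuple.sort θ, fun j => ?_⟩
  rw [band_eq_sInf hd hVb hreal hV]
  exact (D.isLeast_of_modes hlow hup (hy.comp _ (Tuple.sort θ).injective)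
    (θ := θ ∘ Tuple.sort θ) (Tuple.monotone_sort θ) (fun j => hm _) (fun j => (hθ _).1)
    (fun j => (hθ _).2.le) j).csInf_eq

end Bands

/-- The orthonormal analytic branches of modes, with their lifts to the Sobolev space. -/
theorem exists_normalized_branches {u₁ u₂ : Plane} {V : Plane → ℝ}
    (hV : IsSuperHoneycombPotential u₁ u₂ V) {nStar : ℕ} {ED : ℝ} {φ₁ : Plane → ℂ}
    (hdeg : FourfoldDegeneracy u₁ u₂ V nStar ED φ₁) (hv : fermiVelocity u₁ u₂ φ₁ ≠ 0) {l : Plane}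
    (hl : l ≠ 0) (hphase : PhaseNormalized u₁ u₂ φ₁ l) (hd : det2 u₁ u₂ ≠ 0) {Vb : Plane →ᵇ ℂ}
    (hVb : ∀ x, Vb x = V x) (hreal : ∀ x, conj (Vb x) = Vb x)
    (hVp : ∀ x m, Vb (x + latticeVec u₁ u₂ m) = Vb x) :
    ∃ (ν : Fin 4 → ℝ → ℝ) (g : Fin 4 → ℝ → L2Cell u₁ u₂)
      (F R : Fin 4 → ℝ → SobolevH2 (cell u₁ u₂)),
      (∀ j, AnalyticAt ℝ (ν j) 0) ∧
      (∀ j, ν j 0 = slopeSign j * fermiVelocity u₁ u₂ φ₁ * ‖l‖) ∧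
      (∀ᶠ t in 𝓝 (0 : ℝ), Orthonormal ℂ (fun j => g j t) ∧
        ∀ j, (cellFibers hd hreal).IsMode (t • l) (ED + t * ν j t) (g j t)) ∧
      (∀ j, ∀ᶠ t in 𝓝 (0 : ℝ), AnalyticAt ℝ (F j) t) ∧
      (∀ j t, Represents (F j t) (quasiExt hd (t • l) (g j t))) ∧
      (∀ j t, Represents (R j t) fun x => quasiExt hd (t • l) (g j t) x -
        planeWave (t • l) x * leadingMode φ₁ j x) ∧
      ∀ j, ∃ C : ℝ, ∀ᶠ t in 𝓝 (0 : ℝ), ‖R j t‖ ≤ C * |t| := by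
  obtain ⟨ν, h, hν, hh, hν0, hlead, hone, hev⟩ :=
    exists_mode_branches hV hdeg hv hl hphase hd hVb hreal hVp
  obtain ⟨J, hJ, hJ0, hJa⟩ := exists_sobolev_lift hd hreal l
  set D := cellFibers hd hreal with hD
  have hne : ∀ j, D.S 0 (h j 0) ≠ 0 := fun j hj => by
    have := hone j
    rw [hj, norm_zero] at this
    exact zero_ne_one this
  -- The factorization `S 0 = R 0 * U 0` writes the normalized mode as `R 0 y`, the form required by
  -- the Sobolev lift.
  let y : Fin 4 → ℝ → L2Cell u₁ u₂ := fun j t => ((‖D.S 0 (h j t)‖⁻¹ : ℝ) : ℂ) • D.U 0 (h j t)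
  have hRy : ∀ j t, D.R 0 (y j t) = ((‖D.S 0 (h j t)‖⁻¹ : ℝ) : ℂ) • D.S 0 (h j t) := fun j t => by
    rw [map_smul]; rfl
  have hya : ∀ j, AnalyticAt ℝ (y j) 0 := fun j => by
    have h1 := analyticAt_inv_norm_smul (D.S 0) (hh j) (hne j)
    have h2 := (((D.U 0).restrictScalars ℝ).analyticAt _).comp h1
    refine h2.congr (Eventually.of_forall fun t => ?_)
    exact map_smul (D.U 0) _ _
  have hy0 : ∀ j, D.R 0 (y j 0) = D.S 0 (h j 0) := fun j => by
    rw [hRy, hone, inv_one, Complex.ofReal_one, one_smul]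
  -- The leading mode is `R 0 (y j 0)`, so the remainder is the lift of `y j t - y j 0`, which
  -- vanishes at `t = 0`.
  refine ⟨ν, fun j t => D.R 0 (y j t), fun j t => J t (y j t), fun j t => J t (y j t - y j 0),
    hν, hν0, ?_, fun j => (hya j).eventually_analyticAt.mono fun t => hJa _ t, fun j t => hJ t _, fun j t => ?_, fun j => ?_⟩
  · have hne' : ∀ᶠ t in 𝓝 (0 : ℝ), ∀ j, D.S 0 (h j t) ≠ 0 := eventually_all.2 fun j =>
      ((D.S 0).continuous.continuousAt.comp (hh j).continuousAt).eventually_ne (hne j)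
    filter_upwards [hev, hne'] with t ht hnt
    refine ⟨⟨fun j => ?_, fun i j hij => ?_⟩, fun j => ?_⟩
    · change ‖D.R 0 (y j t)‖ = 1
      rw [hRy, norm_smul, Complex.norm_real, norm_inv, norm_norm,
        inv_mul_cancel₀ (norm_ne_zero_iff.2 (hnt j))]
    · change ⟪D.R 0 (y i t), D.R 0 (y j t)⟫_ℂ = 0
      rw [hRy, hRy, inner_smul_left, inner_smul_right, ht.2 i j hij, mul_zero, mul_zero]
    · rw [hRy]
      exact D.isMode_smul (ht.1 j) _
  · refine (hJ t _).trans ?_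
    filter_upwards [ae_cell_quasiExt hd (t • l) (D.R 0 (y j t - y j 0)),
      ae_cell_quasiExt hd (t • l) (D.R 0 (y j t)), hlead j,
      Lp.coeFn_sub (D.R 0 (y j t)) (D.R 0 (y j 0))] with x h1 h2 h3 h4
    rw [h1, h2, map_sub, h4, Pi.sub_apply, hy0, h3, mul_sub]
  · refine exists_bound_of_analyticAt (hJa (fun t => y j t - y j 0) 0
      ((hya j).sub analyticAt_const)) ?_
    change J 0 (y j 0 - y j 0) = 0
    rw [sub_self, hJ0]

/-- Eventual statements at the origin hold on a common interval. -/
theorem exists_pos_of_eventually {p : ℝ → Prop} (h : ∀ᶠ t in 𝓝 (0 : ℝ), p t) :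
    ∃ δ : ℝ, 0 < δ ∧ ∀ t : ℝ, |t| < δ → p t := by
  obtain ⟨δ, hδ, hp⟩ := Metric.eventually_nhds_iff.1 h
  exact ⟨δ, hδ, fun t ht => hp (by rwa [Real.dist_0_eq_abs])⟩

end SuperHoneycomb

end

/-! ### Assembly on a common interval. -/

theorem proposition3p1
    (u₁ u₂ : SuperHoneycomb.Plane) (hu : u₁ ≠ 0)
    (V : SuperHoneycomb.Plane → ℝ)
    (hV : SuperHoneycomb.IsSuperHoneycombPotential u₁ u₂ V)
    (nStar : ℕ) (ED : ℝ) (φ₁ : SuperHoneycomb.Plane → ℂ)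
    (hdeg : SuperHoneycomb.FourfoldDegeneracy u₁ u₂ V nStar ED φ₁)
    (hv : SuperHoneycomb.fermiVelocity u₁ u₂ φ₁ ≠ 0)
    (a₁ b₁ : ℤ) (hab : IsCoprime a₁ b₁)
    (l₂ : SuperHoneycomb.Plane) (hl : l₂ = SuperHoneycomb.edgeDual u₁ u₂ a₁ b₁)
    (hphase : SuperHoneycomb.PhaseNormalized u₁ u₂ φ₁ l₂)
    (hb : SuperHoneycomb.bCoeff u₁ u₂ V ED φ₁ l₂ ≠ 0) :
    ∃ lam₀ : ℝ, 0 < lam₀ ∧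
      ∃ θ : Fin 4 → ℝ → ℝ,
        -- the four bands are, with multiplicity, four real-analytic functions
        (∀ j, AnalyticOnNhd ℝ (θ j) (Set.Ioo (-lam₀) lam₀)) ∧
        (∀ lam : ℝ, |lam| < lam₀ → ∃ σ : Equiv.Perm (Fin 4), ∀ j : Fin 4,
          SuperHoneycomb.band u₁ u₂ V (nStar + 1 + (j : ℕ)) (lam • l₂) = θ (σ j) lam) ∧
        (∃ (r : Fin 4 → ℝ → ℝ) (C : ℝ), 0 < C ∧ ∀ j, ∀ lam : ℝ, |lam| < lam₀ →
          θ j lam = ED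
            + SuperHoneycomb.slopeSign j * SuperHoneycomb.fermiVelocity u₁ u₂ φ₁ * ‖l₂‖ * lam
            + r j lam * lam ^ 2 ∧ |r j lam| < C) ∧
        -- orthonormal eigenmodes, real-analytic in `H²`, with remainders of size `O(λ)` in `H²`
        ∃ Θ : Fin 4 → ℝ → SuperHoneycomb.Plane → ℂ,
          (∀ lam : ℝ, |lam| < lam₀ →
            SuperHoneycomb.CellOrthonormal u₁ u₂ (fun j => Θ j lam) ∧
            ∀ j, SuperHoneycomb.IsEigenmode u₁ u₂ V (lam • l₂) (θ j lam) (Θ j lam)) ∧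
          (∃ F : Fin 4 → ℝ → SuperHoneycomb.SobolevH2 (SuperHoneycomb.cell u₁ u₂),
            ∀ j, AnalyticOnNhd ℝ (F j) (Set.Ioo (-lam₀) lam₀) ∧
              ∀ lam : ℝ, |lam| < lam₀ → SuperHoneycomb.Represents (F j lam) (Θ j lam)) ∧
          (∃ (R : Fin 4 → ℝ → SuperHoneycomb.SobolevH2 (SuperHoneycomb.cell u₁ u₂)) (C : ℝ),
            ∀ j, ∀ lam : ℝ, |lam| < lam₀ →
              SuperHoneycomb.Represents (R j lam) (fun x => Θ j lam x -
                SuperHoneycomb.planeWave (lam • l₂) x * SuperHoneycomb.leadingMode φ₁ j x) ∧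
              ‖R j lam‖ ≤ C * |lam|) := by
  have hd := SuperHoneycomb.det2_ne_zero_of_rot hu hV.lattice
  have hl0 : l₂ ≠ 0 := hl ▸ SuperHoneycomb.edgeDual_ne_zero hd hab
  obtain ⟨Vb, hVb⟩ := SuperHoneycomb.exists_boundedContinuous hd hV.smooth.continuous
    hV.periodic_fst hV.periodic_snd
  have hreal : ∀ x, starRingEnd ℂ (Vb x) = Vb x := fun x => by rw [hVb, Complex.conj_ofReal]
  have hVp : ∀ x m, Vb (x + SuperHoneycomb.latticeVec u₁ u₂ m) = Vb x := fun x m => by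
    rw [hVb, hVb, SuperHoneycomb.periodic_latticeVec hV.periodic_fst hV.periodic_snd]
  obtain ⟨ν, g, F, R, hν, hν0, hmode, hF, hFrep, hRrep, hRb⟩ :=
    SuperHoneycomb.exists_normalized_branches hV hdeg hv hl0 hphase hd hVb hreal hVp
  obtain ⟨E₁, E₂, hE₁, hE₂, hband⟩ := SuperHoneycomb.eventually_band_eq hd hVb hreal hVp
    hdeg.one_le hdeg.below hdeg.above l₂
  let θ : Fin 4 → ℝ → ℝ := fun j t => ED + t * ν j t
  have hθ : ∀ j, AnalyticAt ℝ (θ j) 0 := fun j =>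
    analyticAt_const.add (analyticAt_id.mul (hν j))
  have hθ0 : ∀ j, θ j 0 ∈ Set.Ioo E₁ E₂ := fun j => by
    change ED + 0 * ν j 0 ∈ _
    rw [zero_mul, add_zero]
    exact ⟨hE₁, hE₂⟩
  choose C hC using hRb
  have hνb : ∀ j, ∃ B : ℝ, ∀ᶠ t in nhds (0 : ℝ), ‖ν j t - ν j 0‖ ≤ B * |t| := fun j =>
    SuperHoneycomb.exists_bound_of_analyticAt ((hν j).sub analyticAt_const) (sub_self _)
  choose B hB using hνb
  obtain ⟨δ, hδ, h⟩ := SuperHoneycomb.exists_pos_of_eventually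
    ((((((Filter.eventually_all.2 fun j => (hθ j).eventually_analyticAt).and hband).and
      (Filter.eventually_all.2 fun j =>
        (hθ j).continuousAt.eventually_mem (isOpen_Ioo.mem_nhds (hθ0 j)))).and
      (Filter.eventually_all.2 hB)).and hmode).and
      ((Filter.eventually_all.2 hF).and
        (Filter.eventually_all.2 hC)))
  have hle : ∀ (A : Fin 4 → ℝ) j, A j ≤ ∑ i, |A i| := fun A j =>
    (le_abs_self _).trans (Finset.single_le_sum (f := fun i => |A i|)
      (fun i _ => abs_nonneg (A i)) (Finset.mem_univ j))
  -- `r` is the difference quotient of `ν`. Its value `0` at `t = 0`, by the convention for division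
  -- by zero, is harmless because it multiplies `t²`. The summand `1` makes the bound positive and
  -- strict.
  refine ⟨δ, hδ, θ, fun j t ht => (h t (abs_lt.2 ht)).1.1.1.1.1 j, fun t ht => ?_,
    ⟨fun j t => (ν j t - ν j 0) / t, 1 + ∑ i, |B i|, by positivity, fun j t ht => ⟨?_, ?_⟩⟩,
    fun j t => SuperHoneycomb.quasiExt hd (t • l₂) (g j t), fun t ht => ⟨?_, fun j => ?_⟩,
    ⟨F, fun j => ⟨fun t ht => (h t (abs_lt.2 ht)).2.1 j, fun t _ => hFrep j t⟩⟩,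
    ⟨R, ∑ i, |C i|, fun j t ht => ⟨hRrep j t, ?_⟩⟩⟩
  · obtain ⟨⟨⟨⟨⟨-, h2⟩, h3⟩, -⟩, h5⟩, -⟩ := h t ht
    exact h2 (fun j => g j t) (fun j => θ j t) h5.1 h5.2 h3
  · change ED + t * ν j t = _
    rw [← hν0 j]
    rcases eq_or_ne t 0 with rfl | ht0
    · simp
    · field_simp
      ring
  · have h4 := (h t ht).1.1.2 j
    rw [Real.norm_eq_abs] at h4
    have h6 : |(ν j t - ν j 0) / t| ≤ ∑ i, |B i| := by
      rw [abs_div]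
      refine div_le_of_le_mul₀ (abs_nonneg _) (by positivity) (h4.trans ?_)
      exact mul_le_mul_of_nonneg_right (hle B j) (abs_nonneg _)
    linarith
  · exact SuperHoneycomb.cellOrthonormal_quasiExt hd (h t ht).1.2.1
  · exact (SuperHoneycomb.isEigenmode_quasiExt_iff hd hVb hreal hVp _ _ _).2 ((h t ht).1.2.2 j)
  · exact ((h t ht).2.2 j).trans (mul_le_mul_of_nonneg_right (hle C j) (abs_nonneg _))
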